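/- Let $(W,S)$ be a Coxeter system with length function $l$ and Bruhat order $\le$, let $J\subseteq S$, and let $D_J=\{w\in W\mid l(ws)>l(w)\text{ for all }s\in J\}$. Let $\mathcal A=\mathbb Z[q,q^{-1}]$ and let $\mathcal H$ be the Hecke algebra of $(W,S)$ over $\mathcal A$, with generators $T_s$ $(s\in S)$ subject to $T_s^2=1+(q-q^{-1})T_s$ and the braid relations; for $w\in W$ put $T_w=T_{s_1}\cdots T_{s_k}$ for a reduced expression $w=s_1\cdots s_k$. Let $h\mapsto\overline h$ be the ring involution of $\mathcal H$ with $\overline q=q^{-1}$ and $\overline{T_s}=T_s^{-1}=T_s-(q-q^{-1})$. Let $\mathcal H_J$ be the subalgebra generated by the $T_s$ with $s\in J$, let $\psi\colon\mathcal H_J\to\mathcal A$ be the $\mathcal A$-algebra homomorphism with $\psi(T_u)=q^{l(u)}$ for $u\in W_J$, and let $\mathcal A_\psi$ be $\mathcal A$ regarded as an $\mathcal H_J$-module via $\psi$. Let $\mathscr S_\psi=\mathcal H\otimes_{\mathcal H_J}\mathcal A_\psi$, equipped with the involution $\overline{h\otimes a}=\overline h\otimes\overline a$, and for $w\in D_J$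 let $b_w=T_w\otimes 1$. Deodhar's parabolic polynomials for the parameter $q$ are defined as follows. There is a unique family $R_{y,w}\in\mathbb Z[q]$ $(y,w\in D_J)$ with $R_{y,w}=0$ unless $y\le w$, $R_{w,w}=1$, and, whenever $y<w$ and $s\in S$ with $sw<w$: $R_{y,w}=R_{sy,sw}$ if $sy<y$; $R_{y,w}=(q-1)R_{y,sw}+qR_{sy,sw}$ if $y<sy\in D_J$; $R_{y,w}=-R_{y,sw}$ if $y<sy\notin D_J$. Then $(P^J_{y,w})_{y,w\in D_J}$ is the unique family in $\mathbb Z[q]$ with $P^J_{y,w}=0$ unless $y\le w$, $P^J_{w,w}=1$, $\deg P^J_{y,w}\le\frac12(l(w)-l(y)-1)$ if $y<w$, and $q^{l(w)-l(y)}P^J_{y,w}(q^{-1})=\sum_{z\in D_J,\;y\le z\le w}R_{y,z}P^J_{z,w}$ for $y\le w$. Such a family exists and is unique. Then $\mathscr S_\psi$ has an $\mathcal A$-basis $(c_w\mid w\in D_J)$, and there are polynomials $p^J_{y,w}\in\mathbb Z[q]$ $(y,w\in D_J,\ y<w)$, such that the following hold. 1. $(c_w)$ is a $W$-graph basis. That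 is, put $\tau(w)=\{s\in S\mid l(sw)<l(w)\}$, and let $\mu(y,w)\in\mathbb Z$ be the constant term of $p^J_{y,w}$ if $y<w$, the constant term of $p^J_{w,y}$ if $w<y$, and $0$ otherwise. Then for all $s\in S$ and $w\in D_J$ we have $T_sc_w=-q^{-1}c_w$ if $s\in\tau(w)$, and $T_sc_w=qc_w+\sum_{y\in D_J,\,s\in\tau(y)}\mu(y,w)c_y$ (with only finitely many nonzero terms) if $s\notin\tau(w)$. 2. For all $w\in D_J$, $\overline{c_w}=c_w$ and $c_w=b_w-\sum_{y\in D_J,\,y<w}q\,p^J_{y,w}\,b_y$ (a finite sum). 3. For $y<w$ in $D_J$, $p^J_{y,w}$ has degree at most $l(w)-l(y)-1$, and $p^J_{y,w}=(-q)^{l(w)-l(y)-1}P^{J*}_{y,w}$, where $P^{J*}_{y,w}$ is obtained from $P^J_{y,w}$ by replacing $q$ by $q^{-2}$. -/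

import Mathlib

open Polynomial LaurentPolynomial TensorProduct

noncomputable section

namespace ParabolicKL

/-- The ring `𝒜 = ℤ[q, q⁻¹]` of integral Laurent polynomials. -/
abbrev LRing : Type := LaurentPolynomial ℤ

/-- The indeterminate `q`. -/
def qq : LRing := LaurentPolynomial.T 1

/-- The inverse `q⁻¹` of the indeterminate. -/
def qinv : LRing := LaurentPolynomial.T (-1)

theorem qq_mul_qinv : qq * qinv = 1 := by
  unfold qq qinv
  rw [← LaurentPolynomial.T_add]
  simp

/-- The bar involution of `ℤ[q, q⁻¹]`, sending `q` to `q⁻¹`. -/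
def barA : LRing →+* LRing := (LaurentPolynomial.invert (R := ℤ)).toRingEquiv.toRingHom

theorem barA_qq : barA qq = qinv := LaurentPolynomial.invert_T 1

theorem barA_qinv : barA qinv = qq := by
  have h : barA qinv = LaurentPolynomial.T (-(-1)) := LaurentPolynomial.invert_T (-1)
  simpa [qq] using h

/-! ## The Hecke algebra -/

section Hecke

variable {B : Type*} (M : CoxeterMatrix B)

/-- The product of the free generators along the word `… i j` with `M i j` alternating factors. -/
def freeBraid (i j : B) : FreeAlgebra LRing B :=
  ((CoxeterSystem.braidWord M i j).map (FreeAlgebra.ι LRing)).prod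

/-- The defining relations of the Hecke algebra: the quadratic relations
`T_s² = 1 + (q - q⁻¹) T_s` and the braid relations with `m(s, s')` factors on each side.
(In a `CoxeterMatrix` the entry `0` encodes `m(s, s') = ∞`; the relation is then `1 = 1`.) -/
inductive HeckeRel : FreeAlgebra LRing B → FreeAlgebra LRing B → Prop
  | quad (i : B) :
      HeckeRel (FreeAlgebra.ι LRing i * FreeAlgebra.ι LRing i)
        (1 + (qq - qinv) • FreeAlgebra.ι LRing i)
  | braid (i j : B) : HeckeRel (freeBraid M i j) (freeBraid M j i)

/-- The Hecke algebra `ℋ(W)` over `ℤ[q, q⁻¹]`, given by generators and relations. -/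
def HeckeAlgebra : Type _ := RingQuot (HeckeRel M)

instance : Ring (HeckeAlgebra M) := inferInstanceAs (Ring (RingQuot (HeckeRel M)))

instance : Algebra LRing (HeckeAlgebra M) :=
  inferInstanceAs (Algebra LRing (RingQuot (HeckeRel M)))

/-- The quotient map from the free algebra. -/
def heckeMk : FreeAlgebra LRing B →ₐ[LRing] HeckeAlgebra M :=
  RingQuot.mkAlgHom LRing (HeckeRel M)

/-- The generator `T_s` of the Hecke algebra. -/
def heckeGen (i : B) : HeckeAlgebra M := heckeMk M (FreeAlgebra.ι LRing i)

theorem heckeGen_mul_self (i : B) :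
    heckeGen M i * heckeGen M i = 1 + (qq - qinv) • heckeGen M i := by
  have h : heckeMk M (FreeAlgebra.ι LRing i * FreeAlgebra.ι LRing i) =
      heckeMk M (1 + (qq - qinv) • FreeAlgebra.ι LRing i) :=
    RingQuot.mkAlgHom_rel LRing (HeckeRel.quad (M := M) i)
  rwa [map_mul, map_add, map_one, map_smul] at h

theorem heckeGen_braid (i j : B) :
    ((CoxeterSystem.braidWord M i j).map (heckeGen M)).prod =
      ((CoxeterSystem.braidWord M j i).map (heckeGen M)).prod := by
  have h : heckeMk M (freeBraid M i j) = heckeMk M (freeBraid M j i) :=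
    RingQuot.mkAlgHom_rel LRing (HeckeRel.braid (M := M) i j)
  simp only [freeBraid, map_list_prod, List.map_map] at h
  exact h

/-- `T_s⁻¹ = T_s - (q - q⁻¹)`. -/
def heckeGenInv (i : B) : HeckeAlgebra M :=
  heckeGen M i - algebraMap LRing (HeckeAlgebra M) (qq - qinv)

theorem heckeGen_mul_inv (i : B) : heckeGen M i * heckeGenInv M i = 1 := by
  rw [heckeGenInv, mul_sub, heckeGen_mul_self, Algebra.smul_def,
    Algebra.commutes (qq - qinv) (heckeGen M i)]
  abel

theorem heckeGen_inv_mul (i : B) : heckeGenInv M i * heckeGen M i = 1 := by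
  rw [heckeGenInv, sub_mul, heckeGen_mul_self, Algebra.smul_def]
  abel

theorem heckeGenInv_mul_self (i : B) :
    heckeGenInv M i * heckeGenInv M i =
      1 + algebraMap LRing (HeckeAlgebra M) (qinv - qq) * heckeGenInv M i := by
  have h : heckeGenInv M i * heckeGenInv M i =
      (heckeGen M i - algebraMap LRing (HeckeAlgebra M) (qq - qinv)) * heckeGenInv M i := rfl
  rw [h, sub_mul, heckeGen_mul_inv, ← neg_sub qq qinv, map_neg, neg_mul, sub_eq_add_neg]

theorem prod_map_mul_prod_inv (l : List B) :
    (l.map (heckeGen M)).prod * (l.reverse.map (heckeGenInv M)).prod = 1 := by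
  induction l with
  | nil => simp
  | cons i l ih =>
    simp only [List.map_cons, List.prod_cons, List.reverse_cons, List.map_append,
      List.map_nil, List.prod_append, List.prod_nil, mul_one]
    calc _ = heckeGen M i * ((l.map (heckeGen M)).prod * (l.reverse.map (heckeGenInv M)).prod)
          * heckeGenInv M i := by simp only [mul_assoc]
      _ = 1 := by rw [ih, mul_one, heckeGen_mul_inv]

theorem prod_inv_mul_prod_map (l : List B) :
    (l.reverse.map (heckeGenInv M)).prod * (l.map (heckeGen M)).prod = 1 := by
  induction l with
  | nil => simp
  | cons i l ih =>
    simp only [List.map_cons, List.prod_cons, List.reverse_cons, List.map_append,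
      List.map_nil, List.prod_append, List.prod_nil, mul_one]
    calc _ = (l.reverse.map (heckeGenInv M)).prod * (heckeGenInv M i * heckeGen M i)
          * (l.map (heckeGen M)).prod := by simp only [mul_assoc]
      _ = 1 := by rw [heckeGen_inv_mul, mul_one, ih]

theorem alternatingWord_reverse (i j : B) (m : ℕ) :
    (CoxeterSystem.alternatingWord i j m).reverse =
      if Even m then CoxeterSystem.alternatingWord j i m
      else CoxeterSystem.alternatingWord i j m := by
  induction m generalizing i j with
  | zero => simp [CoxeterSystem.alternatingWord]
  | succ m ih =>
    rw [CoxeterSystem.alternatingWord_succ, List.concat_eq_append, List.reverse_append, ih j i]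
    by_cases hm : Even m
    · have h1 : ¬ Even (m + 1) := by simpa [Nat.even_add_one] using hm
      simp only [hm, h1, if_true, if_false]
      rw [← List.concat_eq_append, ← CoxeterSystem.alternatingWord_succ,
        CoxeterSystem.alternatingWord_succ']
      simp [hm]
    · have h1 : Even (m + 1) := by simpa [Nat.even_add_one] using hm
      simp only [hm, h1, if_true, if_false]
      rw [CoxeterSystem.alternatingWord_succ' j i m]
      simp [hm]

theorem heckeGenInv_braid (i j : B) :
    ((CoxeterSystem.braidWord M i j).map (heckeGenInv M)).prod =
      ((CoxeterSystem.braidWord M j i).map (heckeGenInv M)).prod := by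
  have key : (((CoxeterSystem.braidWord M i j).reverse).map (heckeGenInv M)).prod =
      (((CoxeterSystem.braidWord M j i).reverse).map (heckeGenInv M)).prod := by
    refine left_inv_eq_right_inv (prod_inv_mul_prod_map M _) ?_
    rw [heckeGen_braid]
    exact prod_map_mul_prod_inv M _
  have hs : M j i = M i j := M.symmetric j i
  unfold CoxeterSystem.braidWord at key ⊢
  rw [alternatingWord_reverse, alternatingWord_reverse, hs] at key
  rw [hs]
  by_cases hm : Even (M i j)
  · simpa [hm] using key.symm
  · simpa [hm] using key

/-- The bar map on the free algebra: `q ↦ q⁻¹` on scalars and `T_s ↦ T_s⁻¹` on generators. -/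
def barFree : FreeAlgebra LRing B →+* HeckeAlgebra M :=
  letI : Algebra LRing (HeckeAlgebra M) :=
    ((algebraMap LRing (HeckeAlgebra M)).comp barA).toAlgebra'
      (fun a x => Algebra.commutes (barA a) x)
  (FreeAlgebra.lift LRing (heckeGenInv M)).toRingHom

theorem barFree_ι (i : B) : barFree M (FreeAlgebra.ι LRing i) = heckeGenInv M i := by
  let _ : Algebra LRing (HeckeAlgebra M) :=
    ((algebraMap LRing (HeckeAlgebra M)).comp barA).toAlgebra'
      (fun a x => Algebra.commutes (barA a) x)
  exact FreeAlgebra.lift_ι_apply (heckeGenInv M) i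

theorem barFree_algebraMap (a : LRing) :
    barFree M (algebraMap LRing _ a) = algebraMap LRing (HeckeAlgebra M) (barA a) := by
  let _ : Algebra LRing (HeckeAlgebra M) :=
    ((algebraMap LRing (HeckeAlgebra M)).comp barA).toAlgebra'
      (fun a x => Algebra.commutes (barA a) x)
  exact (FreeAlgebra.lift LRing (heckeGenInv M)).commutes a

theorem barFree_rel ⦃x y : FreeAlgebra LRing B⦄ (h : HeckeRel M x y) :
    barFree M x = barFree M y := by
  cases h with
  | quad i =>
    rw [Algebra.smul_def, map_mul, map_add, map_mul, map_one, barFree_ι, barFree_algebraMap,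
      heckeGenInv_mul_self, map_sub barA, barA_qq, barA_qinv]
  | braid i j =>
    have h : ∀ i : B, (⇑(barFree M) ∘ FreeAlgebra.ι LRing) i = heckeGenInv M i := barFree_ι M
    simp only [freeBraid, map_list_prod, List.map_map, funext h]
    exact heckeGenInv_braid M i j

/-- The bar involution `h ↦ h̄` of the Hecke algebra: the ring endomorphism with `q ↦ q⁻¹`
and `T_s ↦ T_s⁻¹ = T_s - (q - q⁻¹)`. -/
def heckeBar : HeckeAlgebra M →+* HeckeAlgebra M :=
  RingQuot.lift ⟨barFree M, barFree_rel M⟩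

theorem heckeBar_mk (x : FreeAlgebra LRing B) : heckeBar M (heckeMk M x) = barFree M x := by
  have h : heckeMk M x = RingQuot.mkRingHom (HeckeRel M) x := by
    rw [heckeMk, ← RingQuot.mkAlgHom_coe LRing]
    rfl
  rw [h]
  exact RingQuot.lift_mkRingHom_apply _ _ _

theorem heckeBar_gen (i : B) : heckeBar M (heckeGen M i) = heckeGenInv M i := by
  rw [heckeGen, heckeBar_mk, barFree_ι]

theorem heckeBar_algebraMap (a : LRing) :
    heckeBar M (algebraMap LRing _ a) = algebraMap LRing (HeckeAlgebra M) (barA a) := by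
  rw [← AlgHom.commutes (heckeMk M) a, heckeBar_mk, barFree_algebraMap]

/-! ## The parabolic subalgebra and its character `T_u ↦ q ^ l(u)` -/

/-- The subalgebra `ℋ_J` of `ℋ` generated by the `T_s` with `s ∈ J`. -/
def parabolic (J : Set B) : Subalgebra LRing (HeckeAlgebra M) :=
  Algebra.adjoin LRing (heckeGen M '' J)

theorem heckeBar_mem_parabolic (J : Set B) {k : HeckeAlgebra M} (hk : k ∈ parabolic M J) :
    heckeBar M k ∈ parabolic M J := by
  induction hk using Algebra.adjoin_induction with
  | mem x hx =>
    obtain ⟨i, hi, rfl⟩ := hx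
    rw [heckeBar_gen, heckeGenInv]
    exact sub_mem (Algebra.subset_adjoin ⟨i, hi, rfl⟩) (Subalgebra.algebraMap_mem _ _)
  | algebraMap r =>
    rw [heckeBar_algebraMap]
    exact Subalgebra.algebraMap_mem _ _
  | add x y _ _ hx hy => rw [map_add]; exact add_mem hx hy
  | mul x y _ _ hx hy => rw [map_mul]; exact mul_mem hx hy

theorem indexChar_rel ⦃x y : FreeAlgebra LRing B⦄ (h : HeckeRel M x y) :
    FreeAlgebra.lift LRing (fun _ : B => qq) x = FreeAlgebra.lift LRing (fun _ : B => qq) y := by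
  cases h with
  | quad i =>
    simp only [map_mul, map_add, map_one, map_smul, FreeAlgebra.lift_ι_apply, smul_eq_mul,
      sub_mul]
    rw [mul_comm qinv qq, qq_mul_qinv]
    ring
  | braid i j =>
    have h : ∀ i : B, (⇑(FreeAlgebra.lift LRing (fun _ : B => qq)) ∘ FreeAlgebra.ι LRing) i = qq :=
      fun i => FreeAlgebra.lift_ι_apply _ i
    simp only [freeBraid, map_list_prod, List.map_map, funext h]
    simp [M.symmetric i j]

/-- The `𝒜`-algebra homomorphism `ℋ → 𝒜` sending every `T_s` to `q`. -/
def indexChar : HeckeAlgebra M →ₐ[LRing] LRing :=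
  RingQuot.liftAlgHom LRing ⟨FreeAlgebra.lift LRing (fun _ : B => qq), indexChar_rel M⟩

theorem indexChar_gen (i : B) : indexChar M (heckeGen M i) = qq := by
  refine (RingQuot.liftAlgHom_mkAlgHom_apply LRing _ (indexChar_rel M) _).trans ?_
  exact FreeAlgebra.lift_ι_apply _ i

/-- The homomorphism `ψ : ℋ_J → 𝒜` with `ψ(T_s) = q` for `s ∈ J`, hence with
`ψ(T_u) = q ^ l(u)` for all `u ∈ W_J`. -/
def psi (J : Set B) : parabolic M J →ₐ[LRing] LRing :=
  (indexChar M).comp (parabolic M J).val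

theorem psi_gen (J : Set B) (i : B) (hi : i ∈ J) :
    psi M J ⟨heckeGen M i, Algebra.subset_adjoin ⟨i, hi, rfl⟩⟩ = qq :=
  indexChar_gen M i

theorem indexChar_bar (k : HeckeAlgebra M) : indexChar M (heckeBar M k) = barA (indexChar M k) := by
  obtain ⟨x, rfl⟩ : ∃ x, heckeMk M x = k := RingQuot.mkAlgHom_surjective LRing (HeckeRel M) k
  induction x using FreeAlgebra.induction with
  | grade0 r => simp only [AlgHom.commutes, heckeBar_algebraMap]; rfl
  | grade1 i =>
    change indexChar M (heckeBar M (heckeGen M i)) = barA (indexChar M (heckeGen M i))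
    rw [heckeBar_gen, heckeGenInv, map_sub, indexChar_gen, AlgHom.commutes, barA_qq]
    simp
  | mul a b ha hb => simp only [map_mul, ha, hb]
  | add a b ha hb => simp only [map_add, ha, hb]

/-! ## The induced module `𝒮_ψ = ℋ ⊗_{ℋ_J} 𝒜_ψ` -/

/-- The relations `hk ⊗ a = h ⊗ ψ(k)a`, for `k ∈ ℋ_J`, which turn the tensor product
over `𝒜` into the tensor product over `ℋ_J`. -/
def inducedRel (J : Set B) : Submodule (HeckeAlgebra M) (HeckeAlgebra M ⊗[LRing] LRing) :=
  Submodule.span (HeckeAlgebra M)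
    {x | ∃ (h : HeckeAlgebra M) (k : parabolic M J) (a : LRing),
      x = (h * (k : HeckeAlgebra M)) ⊗ₜ[LRing] a - h ⊗ₜ[LRing] (psi M J k * a)}

/-- The left `ℋ`-module `𝒮_ψ = ℋ ⊗_{ℋ_J} 𝒜_ψ`. -/
abbrev Induced (J : Set B) : Type _ :=
  (HeckeAlgebra M ⊗[LRing] LRing) ⧸ inducedRel M J

/-- The element `h ⊗ a` of `𝒮_ψ`. -/
def inducedTmul (J : Set B) (h : HeckeAlgebra M) (a : LRing) : Induced M J :=
  Submodule.Quotient.mk (h ⊗ₜ[LRing] a)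

theorem inducedTmul_mul (J : Set B) (h : HeckeAlgebra M) (k : parabolic M J) (a : LRing) :
    inducedTmul M J (h * k) a = inducedTmul M J h (psi M J k * a) :=
  (Submodule.Quotient.eq _).2 (Submodule.subset_span ⟨h, k, a, rfl⟩)

/-- `h ⊗ a ↦ h̄ ⊗ ā`, as an additive map on the tensor product over `𝒜`. -/
def preBar (J : Set B) : HeckeAlgebra M ⊗[LRing] LRing →+ Induced M J :=
  TensorProduct.liftAddHom
    { toFun := fun h =>
        { toFun := fun a => inducedTmul M J (heckeBar M h) (barA a)
          map_zero' := by simp [inducedTmul]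
          map_add' := fun a b => by simp [inducedTmul, TensorProduct.tmul_add] }
      map_zero' := by ext a; simp [inducedTmul]
      map_add' := fun h k => by ext a; simp [inducedTmul, TensorProduct.add_tmul] }
    (fun r h a => by
      simp only [AddMonoidHom.coe_mk, ZeroHom.coe_mk, smul_eq_mul, inducedTmul, map_mul,
        Algebra.smul_def r h, heckeBar_algebraMap]
      rw [← Algebra.smul_def, ← smul_eq_mul (barA r) (barA a), TensorProduct.smul_tmul])

theorem preBar_tmul (J : Set B) (h : HeckeAlgebra M) (a : LRing) :
    preBar M J (h ⊗ₜ a) = inducedTmul M J (heckeBar M h) (barA a) := rfl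

/-- `preBar` as an additive map which is semilinear with respect to the bar map of `ℋ`. -/
def preBarₛ (J : Set B) : (HeckeAlgebra M ⊗[LRing] LRing) →ₛₗ[heckeBar M] Induced M J :=
  { preBar M J with
    map_smul' := fun h x => by
      change preBar M J (h • x) = heckeBar M h • preBar M J x
      induction x using TensorProduct.induction_on with
      | zero => simp
      | tmul k a =>
        rw [TensorProduct.smul_tmul', preBar_tmul, preBar_tmul, smul_eq_mul, map_mul]
        simp only [inducedTmul]
        rw [← Submodule.Quotient.mk_smul, TensorProduct.smul_tmul', smul_eq_mul]
      | add x y hx hy => rw [smul_add, map_add, map_add, smul_add, hx, hy] }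

theorem preBarₛ_apply (J : Set B) (x : HeckeAlgebra M ⊗[LRing] LRing) :
    preBarₛ M J x = preBar M J x := rfl

theorem inducedRel_le_ker (J : Set B) : inducedRel M J ≤ LinearMap.ker (preBarₛ M J) := by
  refine Submodule.span_le.2 ?_
  rintro x ⟨h, k, a, rfl⟩
  rw [SetLike.mem_coe, LinearMap.mem_ker]
  rw [preBarₛ_apply, map_sub, preBar_tmul, preBar_tmul, map_mul, map_mul, sub_eq_zero]
  have hk := inducedTmul_mul M J (heckeBar M h)
    ⟨heckeBar M k, heckeBar_mem_parabolic M J k.2⟩ (barA a)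
  refine hk.trans ?_
  have : psi M J ⟨heckeBar M k, heckeBar_mem_parabolic M J k.2⟩ = barA (psi M J k) :=
    indexChar_bar M k
  rw [this]

/-- The bar involution of `𝒮_ψ`, with `h ⊗ a ↦ h̄ ⊗ ā`.  Semilinearity over the bar map of `ℋ`
says that the bar of `hα` is `h̄ ᾱ`. -/
def inducedBar (J : Set B) : Induced M J →ₛₗ[heckeBar M] Induced M J :=
  (inducedRel M J).liftQ (preBarₛ M J) (inducedRel_le_ker M J)

theorem inducedBar_tmul (J : Set B) (h : HeckeAlgebra M) (a : LRing) :
    inducedBar M J (inducedTmul M J h a) = inducedTmul M J (heckeBar M h) (barA a) := rfl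

/-- `(V, μ, τ)`, realised by an `𝒜`-basis `c` of an `ℋ`-module `N`, is a `W`-graph:
`T_s c_v = -q⁻¹ c_v` if `s ∈ τ(v)`, and
`T_s c_v = q c_v + ∑_{u, s ∈ τ(u)} μ(u, v) c_u` (a finite sum) if `s ∉ τ(v)`. -/
structure IsWGraphBasis {V N : Type*} [AddCommGroup N] [Module LRing N]
    [Module (HeckeAlgebra M) N] (c : Module.Basis V LRing N) (μ : V → V → ℤ)
    (τ : V → Set B) : Prop where
  smul_of_mem : ∀ (i : B) (v : V), i ∈ τ v → heckeGen M i • c v = (-qinv) • c v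
  finite_edges : ∀ (i : B) (v : V), i ∉ τ v → {u : V | i ∈ τ u ∧ μ u v ≠ 0}.Finite
  smul_of_notMem : ∀ (i : B) (v : V), i ∉ τ v →
    heckeGen M i • c v = qq • c v + ∑ᶠ u ∈ {u : V | i ∈ τ u}, μ u v • c u

end Hecke

/-! ## Bruhat order, minimal coset representatives -/

section Coxeter

variable {B W : Type*} [Group W] {M : CoxeterMatrix B} (cs : CoxeterSystem M W)

/-- The relation `u → w`: `l(u) ≤ l(w)` and `w = tu` for some `t ∈ T ∪ {1}`, where `T` is the set
of reflections. -/
def BruhatStep (u w : W) : Prop :=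
  cs.length u ≤ cs.length w ∧ ∃ t : W, (cs.IsReflection t ∨ t = 1) ∧ w = t * u

/-- The Bruhat order `u ≤ w`. -/
def BruhatLE : W → W → Prop := Relation.TransGen (BruhatStep cs)

/-- The strict Bruhat order `u < w`. -/
def BruhatLT (u w : W) : Prop := BruhatLE cs u w ∧ u ≠ w

/-- The set `D_J` of minimal left coset representatives of `W_J`. -/
def minReps (J : Set B) : Set W :=
  {w | ∀ i ∈ J, cs.length w < cs.length (w * cs.simple i)}

/-- The element `T_w` of the Hecke algebra: the product `T_{s₁} ⋯ T_{s_k}` along a reduced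
expression of `w` (by Matsumoto's theorem it does not depend on the reduced expression). -/
def heckeT (w : W) : HeckeAlgebra M :=
  (((cs.exists_isReduced w).choose).map (heckeGen M)).prod

theorem indexChar_heckeT (w : W) : indexChar M (heckeT cs w) = qq ^ cs.length w := by
  have h := (cs.exists_isReduced w).choose_spec
  have hl : cs.length w = (cs.exists_isReduced w).choose.length :=
    (congrArg cs.length h.2).trans h.1
  have hg : ∀ i : B, (⇑(indexChar M) ∘ heckeGen M) i = qq := indexChar_gen M
  rw [hl, heckeT, map_list_prod, List.map_map, funext hg]
  simp

/-- The element `b_w = T_w ⊗ 1` of `𝒮_ψ`, for `w ∈ D_J`. -/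
def stdElt (J : Set B) (w : minReps cs J) : Induced M J :=
  inducedTmul M J (heckeT cs w) 1

/-! ## Deodhar's parabolic polynomials -/

/-- Deodhar's parabolic `R`-polynomials `R^{J,x}_{u,v}` (`u, v ∈ D_J`), where the parameter `x` is
one of the two roots `-1`, `q` of `x² = q + (q - 1)x`, in the traditional normalisation in which
the Hecke algebra satisfies `T_s² = q + (q - 1)T_s`.  They are characterised by
`R_{u,v} = 0` unless `u ≤ v`, `R_{u,u} = 1` and, for `u < v` and `s` with `sv < v`,
* `R_{u,v} = R_{su,sv}` if `su < u`;
* `R_{u,v} = (q - 1) R_{u,sv} + q R_{su,sv}` if `su > u` and `su ∈ D_J`;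
* `R_{u,v} = (q - 1 - x) R_{u,sv}` if `su > u` and `su ∉ D_J`.

The traditional `q` is the indeterminate `X` of `ℤ[X]`. Elements `sv`, `su` of `D_J` are written
`v'`, `u'`. -/
structure IsDeodharR (J : Set B) (x : ℤ[X]) (R : minReps cs J → minReps cs J → ℤ[X]) :
    Prop where
  eq_zero : ∀ u v : minReps cs J, ¬ BruhatLE cs u v → R u v = 0
  self : ∀ u : minReps cs J, R u u = 1
  strong_descent : ∀ (u v u' v' : minReps cs J) (i : B), BruhatLT cs u v →
    (v' : W) = cs.simple i * v → cs.length v' < cs.length v →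
    (u' : W) = cs.simple i * u → cs.length u' < cs.length u →
    R u v = R u' v'
  strong_ascent : ∀ (u v u' v' : minReps cs J) (i : B), BruhatLT cs u v →
    (v' : W) = cs.simple i * v → cs.length v' < cs.length v →
    (u' : W) = cs.simple i * u → cs.length u < cs.length u' →
    R u v = (X - 1) * R u v' + X * R u' v'
  weak : ∀ (u v v' : minReps cs J) (i : B), BruhatLT cs u v →
    (v' : W) = cs.simple i * v → cs.length v' < cs.length v →
    cs.length u < cs.length (cs.simple i * u) → cs.simple i * (u : W) ∉ minReps cs J →
    R u v = (X - 1 - x) * R u v'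

/-- Deodhar's parabolic Kazhdan–Lusztig polynomials `P^{J,x}_{u,v}` (`u, v ∈ D_J`): they satisfy
`P_{u,v} = 0` unless `u ≤ v`, `P_{u,u} = 1`, `deg P_{u,v} ≤ (l(v) - l(u) - 1) / 2` if `u < v`, and
`q ^ (l(v) - l(u)) P_{u,v}(q⁻¹) = ∑_{u ≤ z ≤ v} R_{u,z} P_{z,v}` if `u ≤ v`. -/
structure IsDeodharKL (J : Set B) (x : ℤ[X]) (P : minReps cs J → minReps cs J → ℤ[X]) :
    Prop where
  eq_zero : ∀ u v : minReps cs J, ¬ BruhatLE cs u v → P u v = 0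
  self : ∀ u : minReps cs J, P u u = 1
  degree_le : ∀ u v : minReps cs J, BruhatLT cs u v →
    2 * (P u v).natDegree + cs.length u + 1 ≤ cs.length v
  identity : ∃ R : minReps cs J → minReps cs J → ℤ[X], IsDeodharR cs J x R ∧
    ∀ u v : minReps cs J, BruhatLE cs u v →
      LaurentPolynomial.T ((cs.length v : ℤ) - cs.length u) *
          LaurentPolynomial.invert (Polynomial.toLaurent (P u v)) =
        Polynomial.toLaurent
          (∑ᶠ z ∈ {z : minReps cs J | BruhatLE cs u z ∧ BruhatLE cs z v}, R u z * P z v)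

/-- The symmetric edge weights `μ` attached to a family of polynomials `p_{y,w}` (`y < w`):
`μ(y, w)` is the constant term of `p_{y,w}` if `y < w`, of `p_{w,y}` if `w < y`, and `0`
otherwise. -/
def edgeWeight (J : Set B) (p : minReps cs J → minReps cs J → ℤ[X])
    (y w : minReps cs J) : ℤ :=
  open Classical in
  if BruhatLT cs y w then (p y w).coeff 0
  else if BruhatLT cs w y then (p w y).coeff 0
  else 0

end Coxeter

end ParabolicKL

end

open ParabolicKL

/-!
The canonical basis of `𝒮_ψ` is the unique family of bar-invariant elements `c_w` with
`c_w ∈ b_w + ∑_{y < w} q ℤ[q] b_y`; everything else follows from this characterisation.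

*Coxeter groups.* The geometric representation shows that the entries of the Coxeter matrix are the
true orders of the products of two generators (`dvd_of_simple_mul_simple_pow_eq_one`). The action of
`W` on `W × ℤ/2` which conjugates the first component and counts inversions in the second one gives
a cocycle `invCocycle`, hence the strong exchange condition (`exists_wordProd_eraseIdx`). From the
latter follow the finiteness of lower intervals and the lifting property of the Bruhat order
(`finite_bruhatLE`, `BruhatLE.simple_mul_le`), Matsumoto's theorem (`prod_map_eq_of_isReduced`) and
the fact that each coset of `W_J` meets `D_J` in exactly one element. For `w ∈ D_J` and `s ∈ S`
either `s w ∈ D_J`, or `s w = w r` with `r ∈ J` (`exists_simple_mul_eq_mul_simple`).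

*The standard basis.* On the free module with basis `W`, the operators of left multiplication by
`T_s` commute with those of right multiplication, and an operator commuting with all the latter is
determined by its value at `1`. The left operators therefore satisfy the braid relations and define
the regular representation `regularRep`. It provides coordinates on the Hecke algebra in which
`T_w` is the unit vector at `w`; collapsing the cosets of `W_J` by `d u ↦ q ^ l(u) d` gives
coordinates on `𝒮_ψ` in which `b_w` is the unit vector at `w`. So the `b_w` form a basis
(`stdBasis`), with the three cases `s w < w`, `w < s w ∈ D_J`, `s w ∉ D_J` for the action of `T_s`.

*`R`-polynomials.* The coefficient of `b_y` in the bar conjugate of `b_w` is, up to the factor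
`(-q) ^ (l(y) - l(w))` and the substitution `q ↦ q²`, a polynomial satisfying Deodhar's recursion
(`RepresentsBar.isDeodharR`), and conversely the recursion determines these coefficients
(`IsDeodharR.representsBar`). A bar-invariant element all of whose coefficients lie in `q ℤ[q]`
vanishes, since its coefficient at an element of maximal length in its support is bar-invariant
(`eq_zero_of_inducedBar_eq`).

*The canonical basis.* If `s w > w` and `s w ∈ D_J`, then `(T_s - q) c_w` is bar-invariant, because
`T_s - q` is, and its coefficients are polynomials in `q` whose constant terms, apart from the
leading one, are removed by subtracting integral multiples of the `c_z` with `z < w` and `s z < z`.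
The result is `c_{s w}` (`IsCanonical.stepElt`). If `s w ∉ D_J`, the same combination lies in the
`q ℤ[q]`-span of the `b_y`, and hence vanishes (`stepElt_eq_zero`). Both cases give `T_s c_w` for
`s w > w`. As `T_s` acts by `-q⁻¹` on the image of `T_s - q`, an induction on the length gives
`T_s c_w = -q⁻¹ c_w` for `s w < w`. Comparing coefficients in the latter identity shows that no
elements other than `s w` lie above `w` and contribute to `T_s c_w`
(`coeff_one_stdCoeff_canonElt`), so that the weights `μ` can be taken symmetric.

*Deodhar's polynomials.* Write the coefficient of `b_y` in `c_w` as
`(-q) ^ (l(w) - l(y)) P_{y,w}(q⁻²)`. Through the description of the bar involution by the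
`R`-polynomials, bar invariance of `c_w` is the defining identity of the parabolic Kazhdan-Lusztig
polynomials (`HasKLCoeffs.inducedBar_eq_iff`), and membership of the lower coefficients in `q ℤ[q]`
is the bound on their degrees. This gives existence, uniqueness and the formula for `p^J_{y,w}`.
-/

noncomputable section

namespace ParabolicKL

/-! ### The geometric representation -/

section GeometricRepresentation

open Module Polynomial.Chebyshev

variable {B : Type*} (M : CoxeterMatrix B)

/-- Twice the entries of the Gram matrix of the geometric representation,
`-2 cos (π / m(i, j))`. The encoding `m = 0` of `m = ∞` gives the correct value `-2`,
since `π / 0 = 0`. -/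
def cartanEntry (i j : B) : ℝ := -2 * Real.cos (Real.pi / M i j)

theorem cartanEntry_self (i : B) : cartanEntry M i i = 2 := by
  simp [cartanEntry]

theorem cartanEntry_comm (i j : B) : cartanEntry M i j = cartanEntry M j i := by
  simp [cartanEntry, M.symmetric i j]

/-- The coroot of `i` as a linear form on the space with basis the simple roots. -/
def coroot (i : B) : Dual ℝ (B →₀ ℝ) := Finsupp.linearCombination ℝ (cartanEntry M i)

theorem coroot_single (i j : B) : coroot M i (Finsupp.single j 1) = cartanEntry M i j := by
  simp [coroot]

theorem coroot_self (i : B) : coroot M i (Finsupp.single i 1) = 2 := by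
  rw [coroot_single, cartanEntry_self]

/-- The reflection of the geometric representation attached to `i`. -/
def geomReflection (i : B) : (B →₀ ℝ) ≃ₗ[ℝ] (B →₀ ℝ) := reflection (coroot_self M i)

theorem geomReflection_mul_self (i : B) : geomReflection M i * geomReflection M i = 1 := by
  ext1 x
  exact involutive_reflection (coroot_self M i) x

/-- The zeros of the rescaled Chebyshev polynomials `S`, in terms of which Mathlib expresses the
powers of a product of two reflections. -/
theorem eval_S_eq_zero_iff {θ : ℝ} (hθ : Real.sin θ ≠ 0) (n : ℤ) :
    (S ℝ n).eval (2 * Real.cos θ) = 0 ↔ Real.sin ((n + 1) * θ) = 0 := by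
  rw [← S_two_mul_real_cos θ n, mul_eq_zero, or_iff_left hθ]

/-- The trace of the rotation `r_i r_j` on the plane of the two simple roots. -/
theorem cartanEntry_mul_sub_two (i j : B) :
    cartanEntry M i j * cartanEntry M j i - 2 = 2 * Real.cos (2 * Real.pi / M i j) := by
  rw [cartanEntry_comm M j i, cartanEntry, mul_div_assoc, Real.cos_two_mul]
  ring

theorem sin_two_pi_div_pos {m : ℕ} (hm : 3 ≤ m) : 0 < Real.sin (2 * Real.pi / m) := by
  have h3 : (3 : ℝ) ≤ m := by exact_mod_cast hm
  have hpi := Real.pi_pos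
  apply Real.sin_pos_of_pos_of_lt_pi
  · positivity
  · rw [div_lt_iff₀ (by linarith)]
    nlinarith

/-- The reflections satisfy the Coxeter relations, so that `W` acts on the geometric
representation. -/
theorem geomReflection_isLiftable : M.IsLiftable (geomReflection M) := by
  intro i j
  by_cases hij : i = j
  · subst hij
    simp [geomReflection_mul_self]
  ext1 z
  rw [LinearEquiv.coe_one, id, geomReflection, geomReflection,
    reflection_mul_reflection_pow_apply _ _ _ _ (2 * Real.cos (2 * Real.pi / M i j))
      (by rw [coroot_single, coroot_single, cartanEntry_mul_sub_two])]
  simp only [coroot_single]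
  have h1 : M i j ≠ 1 := M.off_diagonal i j hij
  obtain h0 | h2 | h3 : M i j = 0 ∨ M i j = 2 ∨ 3 ≤ M i j := by omega
  · simp [h0]
  · have ha : cartanEntry M i j = 0 := by simp [cartanEntry, h2]
    have hb : cartanEntry M j i = 0 := by rw [cartanEntry_comm, ha]
    rw [ha, hb, h2]
    norm_num
    module
  · have hs := (sin_two_pi_div_pos h3).ne'
    have hm : (M i j : ℝ) ≠ 0 := by positivity
    set θ := 2 * Real.pi / M i j with hθ
    have hmθ : M i j * θ = 2 * Real.pi := by rw [hθ]; field_simp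
    -- one factor of each of the two coefficients vanishes, according to the parity of `m`
    have key : ((S ℝ ((M i j - 2 : ℤ) / 2)).eval (2 * Real.cos θ) = 0 ∧
          (S ℝ ((M i j - 1 : ℤ) / 2)).eval (2 * Real.cos θ) = 0) ∨
        ((S ℝ ((M i j - 1 : ℤ) / 2)).eval (2 * Real.cos θ) +
            (S ℝ ((M i j - 3 : ℤ) / 2)).eval (2 * Real.cos θ) = 0 ∧
          (S ℝ ((M i j : ℤ) / 2)).eval (2 * Real.cos θ) +
            (S ℝ ((M i j - 2 : ℤ) / 2)).eval (2 * Real.cos θ) = 0) := by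
      obtain ⟨k, hk⟩ | ⟨k, hk⟩ := Nat.even_or_odd (M i j)
      · left
        have e1 : (M i j - 2 : ℤ) / 2 = k - 1 := by omega
        have e2 : (M i j - 1 : ℤ) / 2 = k - 1 := by omega
        have hkθ : (((k : ℤ) - 1 : ℤ) + 1 : ℝ) * θ = Real.pi := by
          rw [hk] at hmθ
          push_cast at hmθ ⊢
          linarith
        rw [e1, e2, eval_S_eq_zero_iff hs, hkθ]
        simp
      · right
        have e1 : (M i j - 1 : ℤ) / 2 = k := by omega
        have e2 : (M i j - 3 : ℤ) / 2 = k - 1 := by omega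
        have e3 : (M i j : ℤ) / 2 = k := by omega
        have e4 : (M i j - 2 : ℤ) / 2 = k - 1 := by omega
        rw [e1, e2, e3, e4, and_self, ← mul_eq_zero_iff_right hs, add_mul, S_two_mul_real_cos,
          S_two_mul_real_cos]
        have hkθ : ((k : ℤ) + 1 : ℝ) * θ = 2 * Real.pi - (((k : ℤ) - 1 : ℤ) + 1 : ℝ) * θ := by
          rw [hk] at hmθ
          push_cast at hmθ ⊢
          linarith
        rw [hkθ, Real.sin_two_pi_sub]
        ring
    obtain ⟨h, h'⟩ | ⟨h, h'⟩ := key <;> simp [h, h']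

end GeometricRepresentation

/-! ### Orders of products of two generators -/

section Order

open Module Polynomial.Chebyshev

variable {B W : Type*} [Group W] {M : CoxeterMatrix B} (cs : CoxeterSystem M W)

/-- The entries of the Coxeter matrix are the true orders of the products `s_i s_j`, because
`r_i r_j` has order `m(i, j)` in the geometric representation. -/
theorem dvd_of_simple_mul_simple_pow_eq_one (i j : B) (n : ℕ)
    (h : (cs.simple i * cs.simple j) ^ n = 1) : M i j ∣ n := by
  by_cases hij : i = j
  · subst hij
    simp
  have h' : (geomReflection M i * geomReflection M j) ^ n = 1 := by
    have := congrArg (cs.lift ⟨geomReflection M, geomReflection_isLiftable M⟩) h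
    simpa [cs.lift_apply_simple] using this
  have h'' := reflection_mul_reflection_pow_apply_self (coroot_self M i) (coroot_self M j) n
    (2 * Real.cos (2 * Real.pi / M i j))
    (by rw [coroot_single, coroot_single, cartanEntry_mul_sub_two])
  change ((geomReflection M i * geomReflection M j) ^ n) _ = _ at h''
  rw [h'] at h''
  have hi := DFunLike.congr_fun h'' i
  have hj := DFunLike.congr_fun h'' j
  simp [hij, Ne.symm hij, coroot_single] at hi hj
  have h1 : M i j ≠ 1 := M.off_diagonal i j hij
  obtain h0 | h2 | h3 : M i j = 0 ∨ M i j = 2 ∨ 3 ≤ M i j := by omega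
  · have ha : cartanEntry M j i = -2 := by
      rw [cartanEntry_comm]
      simp [cartanEntry, h0]
    have ht : 2 * Real.cos (2 * Real.pi / M i j) = 2 := by simp [h0]
    rw [ha, ht, S_eval_two] at hj
    rw [h0, zero_dvd_iff]
    simpa using hj
  · rw [h2]
    have : 2 * Real.pi / M i j = Real.pi := by rw [h2]; push_cast; ring
    rw [this, Real.cos_pi, mul_neg_one, S_eval_neg_two, S_eval_neg_two] at hi
    by_contra hn
    have hodd : Odd n := by rwa [← Nat.not_even_iff_odd, even_iff_two_dvd]
    rw [Int.negOnePow_sub, Int.negOnePow_odd (n : ℤ) (by exact_mod_cast hodd)] at hi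
    simp at hi
    linarith
  · have hs := (sin_two_pi_div_pos h3).ne'
    have hm : (M i j : ℝ) ≠ 0 := by positivity
    have hc : cartanEntry M j i ≠ 0 := by
      intro h
      have := cartanEntry_mul_sub_two M i j
      rw [h, mul_zero] at this
      have hcos : Real.cos (2 * Real.pi / M i j) = -1 := by linarith
      have := Real.sin_sq_add_cos_sq (2 * Real.pi / M i j)
      rw [hcos] at this
      apply hs
      nlinarith
    -- the coefficient of the root of `j` gives `sin (n θ) = 0`, that of the root of `i` then gives
    -- `cos (n θ) = 1`, for `θ = 2 π / m(i, j)`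
    have hj' := hj.resolve_right hc
    rw [hj', add_zero] at hi
    rw [eval_S_eq_zero_iff hs] at hj'
    have hn := S_two_mul_real_cos (2 * Real.pi / M i j) n
    rw [← hi, one_mul] at hn
    push_cast at hj' hn
    rw [sub_add_cancel] at hj'
    rw [add_mul, one_mul, Real.sin_add, hj', zero_mul, zero_add] at hn
    have hcos : Real.cos (n * (2 * Real.pi / M i j)) = 1 :=
      mul_right_cancel₀ hs (by rw [one_mul]; exact hn.symm)
    obtain ⟨k, hk⟩ := (Real.cos_eq_one_iff _).1 hcos
    have hpi := Real.pi_ne_zero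
    have : (n : ℝ) = M i j * k := by
      field_simp at hk
      linarith
    exact Int.natCast_dvd_natCast.1 ⟨k, by exact_mod_cast this⟩

end Order

/-! ### The inversion cocycle and the strong exchange condition -/

section Cocycle

variable {B W : Type*} [Group W] {M : CoxeterMatrix B} (cs : CoxeterSystem M W)

open Classical in
/-- The action of a simple reflection on `W × ℤ/2`: it conjugates the first component, and changes
the second one exactly at the reflection itself. -/
def signedConj (i : B) : Equiv.Perm (W × ZMod 2) :=
  Function.Involutive.toPerm
    (fun x => (cs.simple i * x.1 * cs.simple i, x.2 + if x.1 = cs.simple i then 1 else 0))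
    (by
      rintro ⟨x, e⟩
      have h : cs.simple i * x * cs.simple i = cs.simple i ↔ x = cs.simple i := by
        rw [mul_eq_right, mul_eq_one_iff_eq_inv', cs.inv_simple]
      ext
      · simp [mul_assoc]
      · simp only [h, add_assoc, CharTwo.add_self_eq_zero, add_zero])

open Classical in
theorem signedConj_apply (i : B) (x : W) (e : ZMod 2) :
    signedConj cs i (x, e) =
      (cs.simple i * x * cs.simple i, e + if x = cs.simple i then 1 else 0) := rfl

open Classical in
/-- The second component counts the occurrences of `x` among the first `2n` terms of the sequence of
reflections `s_j (s_i s_j) ^ l`. -/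
theorem signedConj_mul_pow_apply (i j : B) (n : ℕ) (x : W) (e : ZMod 2) :
    ((signedConj cs i * signedConj cs j) ^ n) (x, e) =
      ((cs.simple i * cs.simple j) ^ n * x * ((cs.simple i * cs.simple j) ^ n)⁻¹,
        e + ∑ l ∈ Finset.range (2 * n),
          if x = cs.simple j * (cs.simple i * cs.simple j) ^ l then 1 else 0) := by
  induction n with
  | zero => simp
  | succ n ih =>
    set u := cs.simple i * cs.simple j with hu
    have hui : u⁻¹ = cs.simple j * cs.simple i := by simp [hu]
    have hj : ∀ k : ℕ, cs.simple j * u ^ k * cs.simple j = (u ^ k)⁻¹ := by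
      intro k
      have h : cs.simple j * u * (cs.simple j)⁻¹ = u⁻¹ := by simp [hu, mul_assoc]
      rw [← inv_pow, ← h, conj_pow, cs.inv_simple]
    have hj' : ∀ k : ℕ, (u ^ k)⁻¹ * cs.simple j = cs.simple j * u ^ k := by
      intro k
      rw [← hj, mul_assoc, cs.simple_mul_simple_self, mul_one]
    have h1 : u ^ n * x * (u ^ n)⁻¹ = cs.simple j ↔ x = cs.simple j * u ^ (2 * n) := by
      rw [mul_inv_eq_iff_eq_mul, ← eq_inv_mul_iff_mul_eq, ← mul_assoc, hj', mul_assoc, ← pow_add,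
        two_mul]
    have h2 : cs.simple j * (u ^ n * x * (u ^ n)⁻¹) * cs.simple j = cs.simple i ↔
        x = cs.simple j * u ^ (2 * n + 1) := by
      have e1 : cs.simple j * (u ^ n * x * (u ^ n)⁻¹) * cs.simple j = cs.simple i ↔
          u ^ n * x * (u ^ n)⁻¹ = cs.simple j * u := by
        rw [← eq_mul_inv_iff_mul_eq, cs.inv_simple, ← hu, ← eq_inv_mul_iff_mul_eq, cs.inv_simple]
      rw [e1, mul_inv_eq_iff_eq_mul, ← eq_inv_mul_iff_mul_eq, ← mul_assoc, ← mul_assoc, hj',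
        mul_assoc, mul_assoc, ← pow_succ', ← pow_add]
      congr! 3
      ring
    rw [pow_succ', Equiv.Perm.mul_apply, ih, Equiv.Perm.mul_apply, signedConj_apply,
      signedConj_apply, show 2 * (n + 1) = 2 * n + 1 + 1 by ring, Finset.sum_range_succ,
      Finset.sum_range_succ]
    simp only [h1, h2]
    ext
    · simp only [pow_succ' u n, mul_inv_rev, hui]
      simp only [hu, mul_assoc]
    · simp only [add_assoc]

/-- The Coxeter relations hold because the sequence `s_j (s_i s_j) ^ l` has period `m(i, j)`, so
that over `2 m(i, j)` terms every reflection is counted an even number of times. -/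
theorem signedConj_isLiftable : M.IsLiftable (signedConj cs) := by
  classical
  intro i j
  ext1 ⟨x, e⟩
  rw [signedConj_mul_pow_apply, cs.simple_mul_simple_pow, two_mul, Finset.sum_range_add]
  simp only [pow_add, cs.simple_mul_simple_pow, one_mul, CharTwo.add_self_eq_zero]
  simp

/-- The inversion cocycle: for a reflection `t`, `invCocycle w t` is `1` or `0` according to whether
`t` is a left inversion of `w` or not; see `invCocycle_ne_zero_iff`. -/
def invCocycle (w t : W) : ZMod 2 :=
  (cs.lift ⟨signedConj cs, signedConj_isLiftable cs⟩ w⁻¹ (t, 0)).2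

theorem lift_signedConj_apply (w t : W) (e : ZMod 2) :
    cs.lift ⟨signedConj cs, signedConj_isLiftable cs⟩ w⁻¹ (t, e) =
      (w⁻¹ * t * w, e + invCocycle cs w t) := by
  classical
  unfold invCocycle
  induction w using cs.simple_induction_left generalizing t e with
  | one => simp
  | mul_simple_left w i ih =>
    rw [mul_inv_rev, map_mul, Equiv.Perm.mul_apply, Equiv.Perm.mul_apply, cs.inv_simple,
      cs.lift_apply_simple, signedConj_apply, signedConj_apply, ih]
    rw [ih _ (0 + _), zero_add, add_assoc]
    simp only [mul_assoc]

/-- The cocycle identity. -/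
theorem invCocycle_mul (x y t : W) :
    invCocycle cs (x * y) t = invCocycle cs x t + invCocycle cs y (x⁻¹ * t * x) := by
  have h := lift_signedConj_apply cs (x * y) t 0
  rw [mul_inv_rev, map_mul, Equiv.Perm.mul_apply, lift_signedConj_apply, lift_signedConj_apply,
    zero_add, zero_add] at h
  exact (congrArg Prod.snd h).symm

theorem invCocycle_one (t : W) : invCocycle cs 1 t = 0 := by
  simp [invCocycle]

open Classical in
theorem invCocycle_simple (i : B) (t : W) :
    invCocycle cs (cs.simple i) t = if t = cs.simple i then 1 else 0 := by
  rw [invCocycle, cs.inv_simple, cs.lift_apply_simple, signedConj_apply, zero_add]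

theorem invCocycle_inv (x t : W) : invCocycle cs x⁻¹ t = invCocycle cs x (x * t * x⁻¹) := by
  have h := invCocycle_mul cs x x⁻¹ (x * t * x⁻¹)
  rw [mul_inv_cancel, invCocycle_one] at h
  have e : x⁻¹ * (x * t * x⁻¹) * x = t := by group
  rw [e] at h
  exact (CharTwo.add_eq_zero.1 h.symm).symm

theorem invCocycle_self {t : W} (ht : cs.IsReflection t) : invCocycle cs t t = 1 := by
  obtain ⟨x, i, rfl⟩ := ht
  have e : (x * cs.simple i)⁻¹ * (x * cs.simple i * x⁻¹) * (x * cs.simple i) = cs.simple i := by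
    group
  have e' : x⁻¹ * (x * cs.simple i * x⁻¹) * x = cs.simple i := by group
  rw [invCocycle_mul, e, invCocycle_inv, invCocycle_mul, e', invCocycle_simple, add_right_comm,
    CharTwo.add_self_eq_zero]
  simp

/-- For a reflection `t` the cocycle counts, modulo 2, the occurrences of `t` in the left inversion
sequence of any word for `w`. -/
theorem mem_leftInvSeq_of_invCocycle_ne_zero (ω : List B) (t : W)
    (h : invCocycle cs (cs.wordProd ω) t ≠ 0) : t ∈ cs.leftInvSeq ω := by
  induction ω generalizing t with
  | nil => simp [invCocycle_one] at h
  | cons i ω ih =>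
    rw [cs.wordProd_cons, invCocycle_mul, invCocycle_simple] at h
    rw [CoxeterSystem.leftInvSeq]
    by_cases ht : t = cs.simple i
    · simp [ht]
    · rw [if_neg ht, zero_add] at h
      refine List.mem_cons_of_mem _ (List.mem_map.2 ⟨_, ih _ h, ?_⟩)
      simp [mul_assoc]

theorem invCocycle_ne_zero_iff {t : W} (ht : cs.IsReflection t) (w : W) :
    invCocycle cs w t ≠ 0 ↔ cs.length (t * w) < cs.length w := by
  have key : ∀ w, invCocycle cs w t ≠ 0 → cs.length (t * w) < cs.length w := by
    intro w h
    obtain ⟨ω, hω, rfl⟩ := cs.exists_isReduced w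
    exact (cs.isLeftInversion_of_mem_leftInvSeq hω
      (mem_leftInvSeq_of_invCocycle_ne_zero cs ω t h)).2
  refine ⟨key w, fun h h0 => ?_⟩
  have h1 : invCocycle cs (t * w) t ≠ 0 := by
    rw [invCocycle_mul, invCocycle_self cs ht, inv_mul_cancel, one_mul, h0]
    simp
  have h2 := key _ h1
  rw [← mul_assoc, ht.mul_self, one_mul] at h2
  omega

/-- The strong exchange condition. The word `ω` need not be reduced. -/
theorem exists_wordProd_eraseIdx {t : W} (ht : cs.IsReflection t) (ω : List B)
    (h : cs.length (t * cs.wordProd ω) < cs.length (cs.wordProd ω)) :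
    ∃ j < ω.length, t * cs.wordProd ω = cs.wordProd (ω.eraseIdx j) := by
  have hmem := mem_leftInvSeq_of_invCocycle_ne_zero cs ω t ((invCocycle_ne_zero_iff cs ht _).2 h)
  obtain ⟨j, hj, rfl⟩ := List.getElem_of_mem hmem
  refine ⟨j, by simpa using hj, ?_⟩
  rw [← List.getD_eq_getElem _ 1 hj, cs.getD_leftInvSeq_mul_wordProd]

/-- Multiplication on the right by `s_j` does not change the left descents of `w`, except in the
case `s_i w = w s_j`. -/
theorem length_simple_mul_mul_simple_lt_iff (i j : B) (w : W)
    (h : cs.simple i * w ≠ w * cs.simple j) :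
    cs.length (cs.simple i * (w * cs.simple j)) < cs.length (w * cs.simple j) ↔
      cs.length (cs.simple i * w) < cs.length w := by
  have hi := cs.isReflection_simple i
  rw [← invCocycle_ne_zero_iff cs hi, ← invCocycle_ne_zero_iff cs hi, invCocycle_mul,
    invCocycle_simple, if_neg, add_zero]
  rw [mul_assoc, inv_mul_eq_iff_eq_mul]
  exact h

/-- The mirror image of `length_simple_mul_mul_simple_lt_iff`. -/
theorem length_simple_mul_mul_simple_lt_iff' (i j : B) (w : W)
    (h : cs.simple i * w ≠ w * cs.simple j) :
    cs.length (cs.simple i * (w * cs.simple j)) < cs.length (cs.simple i * w) ↔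
      cs.length (w * cs.simple j) < cs.length w := by
  have h' : cs.simple j * w⁻¹ ≠ w⁻¹ * cs.simple i := by
    intro e
    apply h
    have := congrArg (·⁻¹) e
    simpa using this.symm
  have := length_simple_mul_mul_simple_lt_iff cs j i w⁻¹ h'
  rw [← cs.length_inv, ← cs.length_inv (w⁻¹ * _), ← cs.length_inv (_ * w⁻¹),
    ← cs.length_inv w⁻¹] at this
  simpa [mul_assoc] using this

theorem lt_length_simple_mul_of_not_lt {i : B} {w : W}
    (h : ¬ cs.length (cs.simple i * w) < cs.length w) :
    cs.length w < cs.length (cs.simple i * w) := by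
  have := cs.length_simple_mul_ne w i
  omega

end Cocycle

/-! ### The Bruhat order -/

section Bruhat

variable {B W : Type*} [Group W] {M : CoxeterMatrix B} (cs : CoxeterSystem M W)

theorem BruhatLE.refl (w : W) : BruhatLE cs w w :=
  .single ⟨le_rfl, 1, .inr rfl, (one_mul w).symm⟩

variable {cs}

theorem BruhatLE.trans {u v w : W} (h : BruhatLE cs u v) (h' : BruhatLE cs v w) :
    BruhatLE cs u w := Relation.TransGen.trans h h'

theorem BruhatStep.eq_or_length_lt {u w : W} (h : BruhatStep cs u w) :
    u = w ∨ cs.length u < cs.length w := by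
  obtain ⟨hl, t, ht | rfl, rfl⟩ := h
  · exact .inr (lt_of_le_of_ne hl (ht.length_mul_right_ne u).symm)
  · simp

theorem BruhatLE.eq_or_length_lt {u w : W} (h : BruhatLE cs u w) :
    u = w ∨ cs.length u < cs.length w := by
  induction h with
  | single h => exact h.eq_or_length_lt
  | tail _ h ih =>
    obtain rfl | h' := h.eq_or_length_lt
    · exact ih
    · obtain rfl | ih := ih
      · exact .inr h'
      · exact .inr (ih.trans h')

theorem BruhatLE.length_le {u w : W} (h : BruhatLE cs u w) : cs.length u ≤ cs.length w := by
  obtain rfl | h := h.eq_or_length_lt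
  · exact le_rfl
  · exact h.le

theorem BruhatLT.length_lt {u w : W} (h : BruhatLT cs u w) : cs.length u < cs.length w :=
  h.1.eq_or_length_lt.resolve_left h.2

theorem BruhatLE.antisymm {u w : W} (h : BruhatLE cs u w) (h' : BruhatLE cs w u) : u = w := by
  refine h.eq_or_length_lt.resolve_right fun hlt => ?_
  have := h'.length_le
  omega

theorem BruhatLE.lt_of_ne {u w : W} (h : BruhatLE cs u w) (hne : u ≠ w) : BruhatLT cs u w :=
  ⟨h, hne⟩

theorem BruhatLT.of_length_lt_simple_mul {w : W} {i : B}
    (h : cs.length w < cs.length (cs.simple i * w)) : BruhatLT cs w (cs.simple i * w) :=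
  ⟨.single ⟨h.le, _, .inl (cs.isReflection_simple i), rfl⟩, fun e => by
    rw [← e] at h
    exact lt_irrefl _ h⟩

theorem BruhatLT.of_simple_mul_length_lt {w : W} {i : B}
    (h : cs.length (cs.simple i * w) < cs.length w) : BruhatLT cs (cs.simple i * w) w := by
  have := BruhatLT.of_length_lt_simple_mul (cs := cs) (w := cs.simple i * w) (i := i) (by simpa)
  simpa using this

theorem BruhatLT.not_le {u w : W} (h : BruhatLT cs u w) : ¬ BruhatLE cs w u :=
  fun h' => h.2 (h.1.antisymm h')

variable (cs)

/-- Half of the subword property: a Bruhat lower bound of `π ω` is the product of a subword. -/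
theorem BruhatLE.exists_sublist {u w : W} (h : BruhatLE cs u w) (ω : List B)
    (hω : cs.wordProd ω = w) : ∃ ω' : List B, ω'.Sublist ω ∧ cs.wordProd ω' = u := by
  have step : ∀ {u w : W}, BruhatStep cs u w → ∀ ω : List B, cs.wordProd ω = w →
      ∃ ω' : List B, ω'.Sublist ω ∧ cs.wordProd ω' = u := by
    rintro u _ ⟨hl, t, ht | rfl, rfl⟩ ω hω
    · have h : cs.length (t * cs.wordProd ω) < cs.length (cs.wordProd ω) := by
        rw [hω, ← mul_assoc, ht.mul_self, one_mul]
        exact lt_of_le_of_ne hl (ht.length_mul_right_ne u).symm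
      obtain ⟨j, -, hj⟩ := exists_wordProd_eraseIdx cs ht ω h
      refine ⟨_, List.eraseIdx_sublist ω j, ?_⟩
      rw [← hj, hω, ← mul_assoc, ht.mul_self, one_mul]
    · exact ⟨ω, .refl _, by rw [hω, one_mul]⟩
  induction h generalizing ω with
  | single h => exact step h ω hω
  | tail _ h ih =>
    obtain ⟨ω₁, h₁, e₁⟩ := step h ω hω
    obtain ⟨ω₂, h₂, e₂⟩ := ih ω₁ e₁
    exact ⟨ω₂, h₂.trans h₁, e₂⟩

theorem finite_bruhatLE (w : W) : {u : W | BruhatLE cs u w}.Finite := by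
  obtain ⟨ω, rfl⟩ := cs.wordProd_surjective w
  refine ((List.finite_toSet ω.sublists).image cs.wordProd).subset fun u hu => ?_
  obtain ⟨ω', h, rfl⟩ := BruhatLE.exists_sublist cs hu ω rfl
  exact ⟨ω', List.mem_sublists.2 h, rfl⟩

variable {cs}

/-- The lifting property for a chain `u → x ≤ w`, given the property for `x ≤ w`. -/
theorem BruhatStep.simple_mul_le {u x w : W} {i : B} (h : BruhatStep cs u x)
    (hxw : BruhatLE cs x w) (hw : cs.length w < cs.length (cs.simple i * w))
    (ih : BruhatLE cs (cs.simple i * x) (cs.simple i * w)) :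
    BruhatLE cs (cs.simple i * u) (cs.simple i * w) := by
  obtain ⟨hl, t, ht | rfl, rfl⟩ := h
  · have hlt := lt_of_le_of_ne hl (ht.length_mul_right_ne u).symm
    by_cases hc : cs.length (cs.simple i * u) ≤ cs.length (cs.simple i * (t * u))
    · refine .trans (.single ⟨hc, cs.simple i * t * (cs.simple i)⁻¹, .inl (ht.conj _), ?_⟩) ih
      simp [mul_assoc]
    -- Here `s u > u` and `s t u < t u`, and the exchange condition forces `s u = t u`.
    · have h1 := cs.length_simple_mul u i
      have h2 := cs.length_simple_mul (t * u) i
      obtain ⟨ω, hω, hωx⟩ := cs.exists_isReduced (cs.simple i * (t * u))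
      have hprod : cs.wordProd (i :: ω) = t * u := by
        rw [cs.wordProd_cons, ← hωx, cs.simple_mul_simple_cancel_left]
      have htt : t * (t * u) = u := by rw [← mul_assoc, ht.mul_self, one_mul]
      obtain ⟨j, hj, hju⟩ := exists_wordProd_eraseIdx cs ht (i :: ω) (by rwa [hprod, htt])
      rw [hprod, htt] at hju
      cases j with
      | zero =>
        have e : cs.simple i * u = t * u := by
          rw [List.eraseIdx_cons_zero, ← hωx] at hju
          exact (congrArg (cs.simple i * ·) hju).trans (cs.simple_mul_simple_cancel_left i)
        rw [e]
        exact hxw.trans (BruhatLT.of_length_lt_simple_mul hw).1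
      | succ j =>
        exfalso
        have hj' : j < ω.length := by simpa using hj
        rw [List.eraseIdx_cons_succ, cs.wordProd_cons] at hju
        have e : cs.simple i * u = cs.wordProd (ω.eraseIdx j) := by
          rw [hju, cs.simple_mul_simple_cancel_left]
        have h3 := cs.length_wordProd_le (ω.eraseIdx j)
        have h4 := List.length_eraseIdx_of_lt hj'
        have h5 : cs.length (cs.simple i * (t * u)) = ω.length := by rw [hωx]; exact hω
        rw [← e] at h3
        omega
  · rwa [one_mul] at ih

/-- The lifting property of the Bruhat order. -/
theorem BruhatLE.simple_mul_le {u w : W} {i : B} (h : BruhatLE cs u w)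
    (hw : cs.length w < cs.length (cs.simple i * w)) :
    BruhatLE cs (cs.simple i * u) (cs.simple i * w) := by
  induction h using Relation.TransGen.head_induction_on with
  | single h => exact h.simple_mul_le (.refl cs w) hw (.refl cs _)
  | head h h' ih => exact h.simple_mul_le h' hw ih

end Bruhat

/-! ### Minimal coset representatives -/

section CosetRepresentatives

variable {B W : Type*} [Group W] {M : CoxeterMatrix B} {cs : CoxeterSystem M W} {J : Set B}

theorem one_mem_minReps : (1 : W) ∈ minReps cs J := fun i _ => by simp

theorem simple_mul_mem_minReps {w : W} (hw : w ∈ minReps cs J) {i : B}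
    (h : cs.length (cs.simple i * w) < cs.length w) : cs.simple i * w ∈ minReps cs J := by
  intro r hr
  have h1 := hw r hr
  have h2 := cs.length_simple_mul (w * cs.simple r) i
  have h3 := cs.length_mul_simple_ne (cs.simple i * w) r
  rw [← mul_assoc] at h2
  omega

/-- If `s w` is not a minimal coset representative, then `s w` and `w` lie in the same coset of the
parabolic subgroup. -/
theorem exists_simple_mul_eq_mul_simple {w : W} (hw : w ∈ minReps cs J) {i : B}
    (h' : cs.simple i * w ∉ minReps cs J) :
    ∃ r ∈ J, cs.simple i * w = w * cs.simple r := by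
  simp only [minReps, Set.mem_ofPred_eq, not_forall] at h'
  obtain ⟨r, hr, hlt⟩ := h'
  refine ⟨r, hr, ?_⟩
  by_contra hne
  have h1 := length_simple_mul_mul_simple_lt_iff' cs i r w hne
  have h2 := hw r hr
  have h3 := cs.length_mul_simple_ne (cs.simple i * w) r
  rw [← mul_assoc] at h1
  omega

variable (cs J)

/-- The parabolic subgroup `W_J`. -/
def parabolicSubgroup : Subgroup W := Subgroup.closure (cs.simple '' J)

variable {cs J}

theorem simple_mem_parabolicSubgroup {i : B} (hi : i ∈ J) :
    cs.simple i ∈ parabolicSubgroup cs J := Subgroup.subset_closure ⟨i, hi, rfl⟩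

theorem exists_word_of_mem_parabolicSubgroup {u : W} (hu : u ∈ parabolicSubgroup cs J) :
    ∃ ω : List B, (∀ i ∈ ω, i ∈ J) ∧ cs.wordProd ω = u := by
  induction hu using Subgroup.closure_induction with
  | mem x hx =>
    obtain ⟨i, hi, rfl⟩ := hx
    exact ⟨[i], by simpa, by simp⟩
  | one => exact ⟨[], by simp, by simp⟩
  | mul x y _ _ hx hy =>
    obtain ⟨ω, h, rfl⟩ := hx
    obtain ⟨ω', h', rfl⟩ := hy
    refine ⟨ω ++ ω', fun i hi => ?_, cs.wordProd_append ω ω'⟩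
    exact (List.mem_append.1 hi).elim (h i) (h' i)
  | inv x _ hx =>
    obtain ⟨ω, h, rfl⟩ := hx
    exact ⟨ω.reverse, by simpa using h, cs.wordProd_reverse ω⟩

/-- A nontrivial element of `W_J` has a right descent in `J`. -/
theorem exists_length_mul_simple_lt (ω : List B) (hω : ∀ i ∈ ω, i ∈ J) (h1 : cs.wordProd ω ≠ 1) :
    ∃ r ∈ J, cs.length (cs.wordProd ω * cs.simple r) < cs.length (cs.wordProd ω) := by
  induction hn : ω.length using Nat.strong_induction_on generalizing ω with
  | _ n ih =>
  obtain rfl | ⟨ω, r, rfl⟩ := ω.eq_nil_or_concat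
  · simp at h1
  by_cases hlt : cs.length (cs.wordProd (ω.concat r) * cs.simple r) <
      cs.length (cs.wordProd (ω.concat r))
  · exact ⟨r, hω r (by simp), hlt⟩
  -- Otherwise the exchange condition produces a word in `J` with two letters fewer.
  have hp : cs.wordProd (ω.concat r) = cs.wordProd ω * cs.simple r := cs.wordProd_concat r ω
  rw [hp, cs.simple_mul_simple_cancel_right] at hlt
  have ht : cs.IsReflection (cs.wordProd ω * cs.simple r * (cs.wordProd ω)⁻¹) := ⟨_, _, rfl⟩
  have he : cs.wordProd ω * cs.simple r * (cs.wordProd ω)⁻¹ * cs.wordProd ω =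
      cs.wordProd ω * cs.simple r := by group
  obtain ⟨j, hj, hju⟩ := exists_wordProd_eraseIdx cs ht ω (by
    rw [he]
    have := cs.length_mul_simple_ne (cs.wordProd ω) r
    omega)
  rw [he, ← hp] at hju
  rw [hju] at h1 ⊢
  refine ih _ ?_ _ (fun i hi => hω i ?_) h1 rfl
  · rw [List.length_eraseIdx_of_lt hj, ← hn]
    simp
  · have := List.mem_of_mem_eraseIdx hi
    simp [this]

variable (cs J)

/-- Each coset `w W_J` has an element of minimal length. -/
theorem exists_length_le_mul_mem (w : W) : ∃ u ∈ parabolicSubgroup cs J,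
    ∀ u' ∈ parabolicSubgroup cs J, cs.length (w * u) ≤ cs.length (w * u * u') := by
  obtain ⟨u, hu, hmin⟩ := WellFounded.has_min
    (InvImage.wf (fun u => cs.length (w * u)) (Nat.lt_wfRel.wf))
    (parabolicSubgroup cs J : Set W) ⟨1, one_mem _⟩
  refine ⟨u, hu, fun u' hu' => ?_⟩
  have := hmin (u * u') (mul_mem hu hu')
  rw [mul_assoc]
  exact not_lt.1 this

variable {cs J}

/-- If `d` has minimal length in its coset, then no other element of `d W_J` lies in `D_J`: since
`d` has no right inversion in `W_J`, the right descent in `J` of a nontrivial `u ∈ W_J` remains a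
right descent of `d u`. -/
theorem eq_one_of_mul_mem_minReps {d u : W} (hu : u ∈ parabolicSubgroup cs J)
    (hd : ∀ u' ∈ parabolicSubgroup cs J, cs.length d ≤ cs.length (d * u'))
    (hdu : d * u ∈ minReps cs J) : u = 1 := by
  by_contra h1
  obtain ⟨ω, hω, rfl⟩ := exists_word_of_mem_parabolicSubgroup hu
  set u := cs.wordProd ω
  obtain ⟨r, hr, hlt⟩ := exists_length_mul_simple_lt ω hω h1
  have hsr := cs.isReflection_simple r
  have hd' : ∀ t ∈ parabolicSubgroup cs J, cs.IsReflection t → invCocycle cs d⁻¹ t = 0 := by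
    intro t htJ ht
    by_contra h
    rw [← Ne, invCocycle_ne_zero_iff cs ht, ← cs.length_inv, cs.length_inv d, mul_inv_rev, inv_inv,
      ht.inv] at h
    have := hd t htJ
    omega
  have h2 : invCocycle cs u⁻¹ (cs.simple r) ≠ 0 := by
    rw [invCocycle_ne_zero_iff cs hsr, ← cs.length_inv, cs.length_inv u]
    simpa using hlt
  have h3 : invCocycle cs (d * u)⁻¹ (cs.simple r) ≠ 0 := by
    rw [mul_inv_rev, invCocycle_mul, inv_inv, hd', add_zero]
    · exact h2
    · exact mul_mem (mul_mem hu (simple_mem_parabolicSubgroup hr)) (inv_mem hu)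
    · exact hsr.conj u
  rw [invCocycle_ne_zero_iff cs hsr, ← cs.length_inv, cs.length_inv (d * u)] at h3
  simp only [mul_inv_rev, inv_inv, cs.inv_simple] at h3
  exact lt_asymm (hdu r hr) h3

theorem exists_minRep_mul (w : W) : ∃ d : minReps cs J, (d : W)⁻¹ * w ∈ parabolicSubgroup cs J := by
  obtain ⟨u, hu, hmin⟩ := exists_length_le_mul_mem cs J w
  refine ⟨⟨w * u, fun r hr => ?_⟩, ?_⟩
  · have h1 := hmin _ (simple_mem_parabolicSubgroup hr)
    have h2 := cs.length_mul_simple_ne (w * u) r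
    omega
  · simpa using inv_mem hu

/-- Each coset of `W_J` meets `D_J` in at most one element. -/
theorem minRep_unique {d d' : W} (hd : d ∈ minReps cs J) (hd' : d' ∈ minReps cs J)
    (h : d⁻¹ * d' ∈ parabolicSubgroup cs J) : d = d' := by
  obtain ⟨u, hu, hmin⟩ := exists_length_le_mul_mem cs J d
  have h1 : u⁻¹ = 1 := eq_one_of_mul_mem_minReps (inv_mem hu) hmin (by simpa using hd)
  have h2 : u⁻¹ * (d⁻¹ * d') = 1 :=
    eq_one_of_mul_mem_minReps (mul_mem (inv_mem hu) h) hmin (by simpa [mul_assoc] using hd')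
  rw [h1, one_mul, inv_mul_eq_one] at h2
  exact h2

variable (cs J)

/-- The minimal representative of the coset `w W_J`. -/
def minRep (w : W) : minReps cs J := (exists_minRep_mul w).choose

theorem minRep_inv_mul_mem (w : W) : (minRep cs J w : W)⁻¹ * w ∈ parabolicSubgroup cs J :=
  (exists_minRep_mul w).choose_spec

theorem minRep_coe (d : minReps cs J) : minRep cs J d = d :=
  Subtype.ext (minRep_unique (Subtype.coe_prop _) d.2 (minRep_inv_mul_mem cs J d))

theorem minRep_mul_simple (w : W) {r : B} (hr : r ∈ J) :
    minRep cs J (w * cs.simple r) = minRep cs J w := by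
  refine Subtype.ext (minRep_unique (Subtype.coe_prop _) (Subtype.coe_prop _) ?_)
  have h1 := minRep_inv_mul_mem cs J w
  have h2 := minRep_inv_mul_mem cs J (w * cs.simple r)
  have h3 := mul_mem h2
    (mul_mem (inv_mem (simple_mem_parabolicSubgroup (cs := cs) hr)) (inv_mem h1))
  convert h3 using 1
  group

end CosetRepresentatives

/-! ### Matsumoto's theorem -/

section Matsumoto

variable {B : Type*}

/-- The word `i j i ⋯` with `n` letters. -/
def altWord (i j : B) : ℕ → List B
  | 0 => []
  | n + 1 => i :: altWord j i n

theorem alternatingWord_reverse_eq_altWord (i j : B) (n : ℕ) :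
    (CoxeterSystem.alternatingWord i j n).reverse = altWord j i n := by
  induction n generalizing i j with
  | zero => rfl
  | succ n ih => simp [CoxeterSystem.alternatingWord_succ, altWord, ih]

theorem altWord_take (i j : B) {k n : ℕ} (h : k ≤ n) :
    (altWord i j n).take k = altWord i j k := by
  induction k generalizing i j n with
  | zero => rfl
  | succ k ih =>
    obtain ⟨n, rfl⟩ : ∃ m, n = m + 1 := ⟨n - 1, by omega⟩
    simp [altWord, ih j i (by omega : k ≤ n)]

variable {M : CoxeterMatrix B}

/-- The two braid words are the two alternating words of length `m(i, j)`, in an order which depends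
on the parity of `m(i, j)`. -/
theorem braidWord_eq_altWord (i j : B) :
    (CoxeterSystem.braidWord M i j = altWord i j (M i j) ∧
        CoxeterSystem.braidWord M j i = altWord j i (M i j)) ∨
      (CoxeterSystem.braidWord M i j = altWord j i (M i j) ∧
        CoxeterSystem.braidWord M j i = altWord i j (M i j)) := by
  have h := alternatingWord_reverse i j (M i j)
  have h' := alternatingWord_reverse j i (M i j)
  rw [alternatingWord_reverse_eq_altWord] at h h'
  have hs : M j i = M i j := M.symmetric j i
  unfold CoxeterSystem.braidWord
  rw [hs]
  split_ifs at h h'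
  · exact .inl ⟨h'.symm, h.symm⟩
  · exact .inr ⟨h.symm, h'.symm⟩

variable {W : Type*} [Group W] (cs : CoxeterSystem M W)

/-- The left inversions of an alternating product `s_i s_j s_i ⋯` with `n` factors are among the
`(s_i s_j) ^ k s_i` with `k < n`. -/
theorem exists_of_invCocycle_altWord_ne_zero (i j : B) (n : ℕ) (t : W)
    (h : invCocycle cs (cs.wordProd (altWord i j n)) t ≠ 0) :
    ∃ k < n, t = (cs.simple i * cs.simple j) ^ k * cs.simple i := by
  induction n generalizing i j t with
  | zero => simp [altWord, invCocycle_one] at h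
  | succ n ih =>
    classical
    rw [altWord, cs.wordProd_cons, invCocycle_mul, invCocycle_simple] at h
    by_cases ht : t = cs.simple i
    · exact ⟨0, n.succ_pos, by simp [ht]⟩
    · rw [if_neg ht, zero_add] at h
      obtain ⟨k, hk, e⟩ := ih _ _ _ h
      refine ⟨k + 1, by omega, ?_⟩
      rw [cs.inv_simple] at e
      have e' : t = cs.simple i * (cs.simple i * t * cs.simple i) * cs.simple i := by
        simp [mul_assoc]
      have hc : cs.simple i * (cs.simple j * cs.simple i) ^ k * (cs.simple i)⁻¹ =
          (cs.simple i * cs.simple j) ^ k := by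
        rw [← conj_pow]
        simp [mul_assoc]
      rw [e', e, pow_succ, ← hc]
      simp [mul_assoc]

/-- Alternating words stay reduced up to the length `m(i, j)`. -/
theorem lt_length_simple_mul_altWord (i j : B) (n : ℕ) (hn : n < M i j ∨ M i j = 0) :
    cs.length (cs.wordProd (altWord i j n)) <
      cs.length (cs.simple j * cs.wordProd (altWord i j n)) := by
  apply lt_length_simple_mul_of_not_lt
  rw [← invCocycle_ne_zero_iff cs (cs.isReflection_simple j)]
  intro h
  obtain ⟨k, hk, e⟩ := exists_of_invCocycle_altWord_ne_zero cs i j n _ h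
  have h1 : (cs.simple i * cs.simple j) ^ (k + 1) = 1 := by
    rw [pow_succ, ← mul_assoc, ← e, cs.simple_mul_simple_self]
  have h2 := dvd_of_simple_mul_simple_pow_eq_one cs i j _ h1
  obtain hn | hn := hn
  · have := Nat.le_of_dvd k.succ_pos h2
    omega
  · rw [hn, zero_dvd_iff] at h2
    omega

/-- The two alternating products with `n` factors agree only if `m(i, j)` divides `n`. -/
theorem dvd_of_wordProd_altWord_eq (i j : B) (n : ℕ)
    (h : cs.wordProd (altWord i j n) = cs.wordProd (altWord j i n)) : M i j ∣ n := by
  rw [← alternatingWord_reverse_eq_altWord, ← alternatingWord_reverse_eq_altWord,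
    cs.wordProd_reverse, cs.wordProd_reverse, inv_inj, cs.prod_alternatingWord_eq_mul_pow,
    cs.prod_alternatingWord_eq_mul_pow] at h
  apply dvd_of_simple_mul_simple_pow_eq_one cs
  have hinv : cs.simple j * cs.simple i = (cs.simple i * cs.simple j)⁻¹ := by simp
  obtain ⟨k, rfl⟩ | ⟨k, rfl⟩ := n.even_or_odd
  · have hk : (k + k) / 2 = k := by omega
    rw [if_pos ⟨k, rfl⟩, if_pos ⟨k, rfl⟩, one_mul, one_mul, hinv, hk, inv_pow,
      inv_eq_iff_mul_eq_one, ← pow_add] at h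
    exact h
  · have hk : (2 * k + 1) / 2 = k := by omega
    have hodd : ¬ Even (2 * k + 1) := by simp
    rw [if_neg hodd, if_neg hodd, hk, hinv, inv_pow] at h
    have h' : cs.simple i * cs.simple j * (cs.simple i * cs.simple j) ^ k *
        (cs.simple i * cs.simple j) ^ k = 1 := by
      rw [mul_assoc (cs.simple i), ← h]
      simp
    rwa [mul_assoc, ← pow_add, ← two_mul, ← pow_succ'] at h'

theorem le_of_isReduced_altWord (i j : B) (n : ℕ) (hM : M i j ≠ 0)
    (h : cs.IsReduced (altWord i j n)) : n ≤ M i j := by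
  by_contra! hlt
  rw [← alternatingWord_reverse_eq_altWord, cs.isReduced_reverse_iff] at h
  rw [M.symmetric i j] at hM hlt
  exact cs.not_isReduced_alternatingWord j i hM hlt h

variable {G : Type*} [Monoid G] (f : B → G)

/-- One step in the proof of Matsumoto's theorem: the exchange condition replaces a pair of reduced
words of `w` with different values by the pair consisting of the first word, and the first word with
its last letter removed and the first letter of the second word put in front. -/
theorem matsumoto_step {n : ℕ}
    (ih : ∀ ω ω' : List B, cs.IsReduced ω → cs.IsReduced ω' → cs.wordProd ω = cs.wordProd ω' →
      ω.length = n → (ω.map f).prod = (ω'.map f).prod)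
    {ω τ : List B} {i : B} (hω : cs.IsReduced ω) (hτ : cs.IsReduced (i :: τ))
    (he : cs.wordProd ω = cs.wordProd (i :: τ)) (hn : ω.length = n + 1)
    (hne : (ω.map f).prod ≠ ((i :: τ).map f).prod) :
    cs.IsReduced (i :: ω.dropLast) ∧ cs.wordProd (i :: ω.dropLast) = cs.wordProd ω ∧
      ((i :: ω.dropLast).map f).prod ≠ (ω.map f).prod := by
  have hred : ∀ {i : B} {l : List B}, cs.IsReduced (i :: l) → cs.IsReduced l := fun h => h.drop 1
  have hlt : cs.length (cs.simple i * cs.wordProd ω) < cs.length (cs.wordProd ω) := by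
    rw [he, cs.wordProd_cons, cs.simple_mul_simple_cancel_left, ← cs.wordProd_cons, hτ.eq,
      (hred hτ).eq]
    simp
  obtain ⟨j, hj, hju⟩ := exists_wordProd_eraseIdx cs (cs.isReflection_simple i) ω hlt
  -- the exchanged word is reduced, and has the same value as `i :: τ`
  have hw : cs.wordProd (i :: ω.eraseIdx j) = cs.wordProd ω := by
    rw [cs.wordProd_cons, ← hju, cs.simple_mul_simple_cancel_left]
  have hl : (i :: ω.eraseIdx j).length = n + 1 := by
    rw [List.length_cons, List.length_eraseIdx_of_lt hj, hn]
    simp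
  have hr : cs.IsReduced (i :: ω.eraseIdx j) := by
    rw [CoxeterSystem.IsReduced, hw, hω.eq, hl, hn]
  have hval : ((i :: ω.eraseIdx j).map f).prod = ((i :: τ).map f).prod := by
    rw [List.map_cons, List.map_cons, List.prod_cons, List.prod_cons,
      ih _ _ (hred hr) (hred hτ) _ (by simpa using hl)]
    rw [he, cs.wordProd_cons, cs.wordProd_cons] at hw
    exact mul_left_cancel hw
  -- if the deleted letter is not the last one, then the exchanged word also has the value of `ω`
  by_cases hjn : j = n
  · have hd : ω.dropLast = ω.eraseIdx j := by
      rw [hjn, List.dropLast_eq_eraseIdx hn.symm]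
    rw [hd]
    exact ⟨hr, hw, by rw [hval]; exact hne.symm⟩
  · exfalso
    obtain rfl | ⟨ω, k, rfl⟩ := ω.eq_nil_or_concat
    · simp at hn
    have hjω : j < ω.length := by
      simp at hj hn
      omega
    have hn' : ω.length = n := by simpa using hn
    have e : (ω.concat k).eraseIdx j = (ω.eraseIdx j).concat k := by
      rw [List.concat_eq_append, List.eraseIdx_append_of_lt_length hjω, List.concat_eq_append]
    have e' : i :: (ω.concat k).eraseIdx j = (i :: ω.eraseIdx j).concat k := by
      rw [e]
      simp
    have hredc : ∀ {l : List B}, cs.IsReduced (l.concat k) → cs.IsReduced l := fun {l} h => by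
      have := h.take l.length
      simpa using this
    rw [e'] at hr hw hval
    apply hne
    rw [← hval, List.concat_eq_append, List.concat_eq_append, List.map_append, List.map_append,
      List.prod_append, List.prod_append, ih ω _ (hredc hω) (hredc hr) _ hn']
    rw [cs.wordProd_concat, cs.wordProd_concat] at hw
    exact (mul_right_cancel hw).symm

/-- **Matsumoto's theorem**: if `f` satisfies the braid relations, then the product of the values of
`f` along a reduced word depends only on the element that the word represents. -/
theorem prod_map_eq_of_isReduced
    (hf : ∀ i j, ((CoxeterSystem.braidWord M i j).map f).prod =
      ((CoxeterSystem.braidWord M j i).map f).prod)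
    (ω ω' : List B) (hω : cs.IsReduced ω) (hω' : cs.IsReduced ω')
    (he : cs.wordProd ω = cs.wordProd ω') : (ω.map f).prod = (ω'.map f).prod := by
  induction hn : ω.length generalizing ω ω' with
  | zero =>
    have h' : ω'.length = 0 := by rw [← hn, ← hω.eq, ← hω'.eq, he]
    rw [List.length_eq_zero_iff] at hn h'
    rw [hn, h']
  | succ n ih =>
    by_contra hne
    have hn' : ω'.length = n + 1 := by rw [← hn, ← hω.eq, ← hω'.eq, he]
    -- iterating the exchange step produces words with longer and longer alternating prefixes
    have key : ∀ k ≤ n, ∃ (i j : B) (x y : List B), cs.IsReduced x ∧ cs.IsReduced y ∧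
        cs.wordProd x = cs.wordProd y ∧ x.length = n + 1 ∧ (x.map f).prod ≠ (y.map f).prod ∧
        x.take (k + 1) = altWord i j (k + 1) ∧ y.take (max k 1) = altWord j i (max k 1) := by
      intro k
      induction k with
      | zero =>
        intro _
        obtain ⟨i, α, rfl⟩ := List.exists_cons_of_length_eq_add_one hn
        obtain ⟨j, β, rfl⟩ := List.exists_cons_of_length_eq_add_one hn'
        exact ⟨i, j, _, _, hω, hω', he, hn, hne, by simp [altWord], by simp [altWord]⟩
      | succ k ihk =>
        intro hk
        obtain ⟨i, j, x, y, hx, hy, hxy, hl, hxyne, hpx, hpy⟩ := ihk (by omega)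
        have hly : y.length = n + 1 := by rw [← hl, ← hx.eq, ← hy.eq, hxy]
        obtain ⟨j', β, rfl⟩ := List.exists_cons_of_length_eq_add_one hly
        obtain rfl : j' = j := by
          obtain ⟨m, hm⟩ : ∃ m, max k 1 = m + 1 := ⟨max k 1 - 1, by omega⟩
          rw [hm] at hpy
          simp [altWord] at hpy
          exact hpy.1
        obtain ⟨h1, h2, h3⟩ := matsumoto_step cs f ih hx hy hxy hl hxyne
        refine ⟨j', i, _, x, h1, hx, h2, by simp [hl], h3, ?_, ?_⟩
        · rw [List.take_succ_cons, List.dropLast_eq_take, List.take_take, altWord, ← hpx]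
          congr 2
          omega
        · rw [show max (k + 1) 1 = k + 1 by omega]
          exact hpx
    obtain ⟨i, j, x, y, hx, hy, hxy, hl, hxyne, hpx, hpy⟩ := key n le_rfl
    have hly : y.length = n + 1 := by rw [← hl, ← hx.eq, ← hy.eq, hxy]
    obtain ⟨j', β, rfl⟩ := List.exists_cons_of_length_eq_add_one hly
    obtain rfl : j' = j := by
      obtain ⟨m, hm⟩ : ∃ m, max n 1 = m + 1 := ⟨max n 1 - 1, by omega⟩
      rw [hm] at hpy
      simp [altWord] at hpy
      exact hpy.1
    obtain ⟨h1, h2, h3⟩ := matsumoto_step cs f ih hx hy hxy hl hxyne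
    rw [List.take_of_length_le hl.le] at hpx
    have hz : j' :: x.dropLast = altWord j' i (n + 1) := by
      rw [altWord, List.dropLast_eq_take, hl, Nat.add_sub_cancel, hpx, altWord_take _ _ n.le_succ]
    rw [hz, hpx] at h2 h3
    rw [hpx] at hx
    have hd := dvd_of_wordProd_altWord_eq cs i j' (n + 1) h2.symm
    have hM : M i j' ≠ 0 := by
      rintro h0
      rw [h0, zero_dvd_iff] at hd
      omega
    have hnM : n + 1 = M i j' :=
      le_antisymm (le_of_isReduced_altWord cs i j' _ hM hx) (Nat.le_of_dvd n.succ_pos hd)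
    rw [hnM] at h3
    obtain ⟨e, e'⟩ | ⟨e, e'⟩ := braidWord_eq_altWord (M := M) i j'
    · exact h3 (by rw [← e, ← e', hf])
    · exact h3 (by rw [← e, ← e', hf])

end Matsumoto

/-! ### Multiplication of the elements `T_w` -/

section StandardBasis

variable {B W : Type*} [Group W] {M : CoxeterMatrix B} (cs : CoxeterSystem M W)

theorem heckeT_wordProd {ω : List B} (hω : cs.IsReduced ω) :
    heckeT cs (cs.wordProd ω) = (ω.map (heckeGen M)).prod := by
  have h := (cs.exists_isReduced (cs.wordProd ω)).choose_spec
  exact prod_map_eq_of_isReduced cs (heckeGen M) (heckeGen_braid M) _ _ h.1 hω h.2.symm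

theorem heckeT_one : heckeT cs 1 = 1 := by
  have := heckeT_wordProd cs (ω := []) (by simp [CoxeterSystem.IsReduced])
  simpa using this

/-- Multiplication by `T_s` when the length increases: prepend `s` to a reduced word. -/
theorem heckeGen_mul_heckeT_of_lt {w : W} {i : B}
    (h : cs.length w < cs.length (cs.simple i * w)) :
    heckeGen M i * heckeT cs w = heckeT cs (cs.simple i * w) := by
  obtain ⟨ω, hω, rfl⟩ := cs.exists_isReduced w
  have hr : cs.IsReduced (i :: ω) := by
    have := cs.length_simple_mul (cs.wordProd ω) i
    rw [CoxeterSystem.IsReduced, cs.wordProd_cons, List.length_cons, ← hω.eq]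
    omega
  rw [← cs.wordProd_cons, heckeT_wordProd cs hω, heckeT_wordProd cs hr, List.map_cons,
    List.prod_cons]

theorem heckeT_mul_heckeGen_of_lt {w : W} {i : B}
    (h : cs.length w < cs.length (w * cs.simple i)) :
    heckeT cs w * heckeGen M i = heckeT cs (w * cs.simple i) := by
  obtain ⟨ω, hω, rfl⟩ := cs.exists_isReduced w
  have hr : cs.IsReduced (ω.concat i) := by
    have := cs.length_mul_simple (cs.wordProd ω) i
    rw [CoxeterSystem.IsReduced, cs.wordProd_concat, List.length_concat, ← hω.eq]
    omega
  rw [← cs.wordProd_concat, heckeT_wordProd cs hω, heckeT_wordProd cs hr]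
  simp

theorem heckeGen_mul_heckeT_of_gt {w : W} {i : B}
    (h : cs.length (cs.simple i * w) < cs.length w) :
    heckeGen M i * heckeT cs w = heckeT cs (cs.simple i * w) + (qq - qinv) • heckeT cs w := by
  have h1 := heckeGen_mul_heckeT_of_lt cs (w := cs.simple i * w) (i := i) (by simpa)
  rw [cs.simple_mul_simple_cancel_left] at h1
  rw [← h1, ← mul_assoc, heckeGen_mul_self, add_mul, one_mul, smul_mul_assoc]

end StandardBasis

/-! ### The regular representation of the Hecke algebra -/

section RegularRepresentation

variable {B W : Type*} [Group W] {M : CoxeterMatrix B} (cs : CoxeterSystem M W)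

open Finsupp

open Classical in
/-- Left multiplication by `T_s` on the free module with basis `W`. -/
def leftOp (i : B) : Module.End LRing (W →₀ LRing) :=
  linearCombination LRing fun w => single (cs.simple i * w) 1 +
    (if cs.length (cs.simple i * w) < cs.length w then qq - qinv else 0) • single w 1

open Classical in
/-- Right multiplication by `T_s` on the free module with basis `W`. -/
def rightOp (i : B) : Module.End LRing (W →₀ LRing) :=
  linearCombination LRing fun w => single (w * cs.simple i) 1 +
    (if cs.length (w * cs.simple i) < cs.length w then qq - qinv else 0) • single w 1

open Classical in
theorem leftOp_single (i : B) (w : W) : leftOp cs i (single w 1) = single (cs.simple i * w) 1 +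
    (if cs.length (cs.simple i * w) < cs.length w then qq - qinv else 0) • single w 1 := by
  rw [leftOp, linearCombination_single, one_smul]

open Classical in
theorem rightOp_single (i : B) (w : W) : rightOp cs i (single w 1) = single (w * cs.simple i) 1 +
    (if cs.length (w * cs.simple i) < cs.length w then qq - qinv else 0) • single w 1 := by
  rw [rightOp, linearCombination_single, one_smul]

/-- Left and right multiplications commute. The only case in which the conditions in the two
operators interact is `s w = w r`, where both sides agree by symmetry. -/
theorem commute_leftOp_rightOp (i j : B) : Commute (leftOp cs i) (rightOp cs j) := by
  classical
  refine Finsupp.lhom_ext' fun w => LinearMap.ext_ring ?_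
  change leftOp cs i (rightOp cs j (single w 1)) = rightOp cs j (leftOp cs i (single w 1))
  simp only [rightOp_single, leftOp_single, map_add, map_smul]
  by_cases h : cs.simple i * w = w * cs.simple j
  · have h' : cs.simple i * w * cs.simple j = w := by rw [h, cs.simple_mul_simple_cancel_right]
    simp only [← h, h', cs.simple_mul_simple_cancel_left]
  · have h1 := length_simple_mul_mul_simple_lt_iff cs i j w h
    have h2 := length_simple_mul_mul_simple_lt_iff' cs i j w h
    simp only [h1, mul_assoc, h2]
    module

theorem leftOp_mul_self (i : B) :
    leftOp cs i * leftOp cs i = 1 + (qq - qinv) • leftOp cs i := by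
  classical
  refine Finsupp.lhom_ext' fun w => LinearMap.ext_ring ?_
  change leftOp cs i (leftOp cs i (single w 1)) =
    single w 1 + (qq - qinv) • leftOp cs i (single w 1)
  have := cs.length_simple_mul_ne w i
  simp only [leftOp_single, map_add, map_smul, cs.simple_mul_simple_cancel_left]
  by_cases h : cs.length (cs.simple i * w) < cs.length w
  · rw [if_pos h, if_neg (by omega)]
    module
  · rw [if_neg h, if_pos (by omega)]
    module

theorem prod_map_leftOp_single {ω : List B} (hω : cs.IsReduced ω) :
    (ω.map (leftOp cs)).prod (single 1 1) = single (cs.wordProd ω) 1 := by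
  induction ω with
  | nil => simp
  | cons i ω ih =>
    have h1 : cs.IsReduced ω := hω.drop 1
    have h2 : cs.length (cs.simple i * cs.wordProd ω) = ω.length + 1 := by
      rw [← cs.wordProd_cons, hω.eq, List.length_cons]
    rw [List.map_cons, List.prod_cons, Module.End.mul_apply, ih h1, leftOp_single, if_neg,
      zero_smul, add_zero, cs.wordProd_cons]
    rw [h2, h1.eq]
    omega

/-- An operator which commutes with right multiplications is determined by its value at `1`. -/
theorem ext_of_commute_rightOp {f g : Module.End LRing (W →₀ LRing)}
    (hf : ∀ i, Commute f (rightOp cs i)) (hg : ∀ i, Commute g (rightOp cs i))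
    (h : f (single 1 1) = g (single 1 1)) : f = g := by
  refine Finsupp.lhom_ext' fun w => LinearMap.ext_ring ?_
  change f (single w 1) = g (single w 1)
  induction hn : cs.length w using Nat.strong_induction_on generalizing w with
  | _ n ih =>
  by_cases hw : w = 1
  · rw [hw, h]
  obtain ⟨i, hi⟩ := cs.exists_rightDescent_of_ne_one hw
  have h1 := ih _ (by rw [← hn]; exact hi) (w * cs.simple i) rfl
  have h2 : rightOp cs i (single (w * cs.simple i) 1) = single w 1 := by
    rw [rightOp_single, cs.simple_mul_simple_cancel_right, if_neg, zero_smul, add_zero]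
    exact not_lt.2 (le_of_lt hi)
  rw [← h2]
  have h3 := LinearMap.congr_fun (hf i).eq (single (w * cs.simple i) 1)
  have h4 := LinearMap.congr_fun (hg i).eq (single (w * cs.simple i) 1)
  simp only [Module.End.mul_apply] at h3 h4
  rw [h3, h4, h1]

theorem isReduced_altWord (i j : B) (n : ℕ) (hn : n ≤ M i j ∨ M i j = 0) :
    cs.IsReduced (altWord i j n) := by
  induction n generalizing i j with
  | zero => simp [altWord, CoxeterSystem.IsReduced]
  | succ n ih =>
    have hs : M j i = M i j := M.symmetric j i
    have h1 := ih j i (by omega)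
    have h2 := lt_length_simple_mul_altWord cs j i n (by omega)
    have h3 := cs.length_simple_mul (cs.wordProd (altWord j i n)) i
    rw [altWord, CoxeterSystem.IsReduced, cs.wordProd_cons, List.length_cons, ← h1.eq]
    omega

theorem isReduced_braidWord (i j : B) : cs.IsReduced (CoxeterSystem.braidWord M i j) := by
  have hs : M j i = M i j := M.symmetric j i
  obtain ⟨e, -⟩ | ⟨e, -⟩ := braidWord_eq_altWord (M := M) i j
  · rw [e]
    exact isReduced_altWord cs i j _ (.inl le_rfl)
  · rw [e]
    exact isReduced_altWord cs j i _ (.inl hs.ge)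

/-- The braid relations hold because both sides commute with right multiplications and send `1` to
the same basis vector. -/
theorem leftOp_braid (i j : B) :
    ((CoxeterSystem.braidWord M i j).map (leftOp cs)).prod =
      ((CoxeterSystem.braidWord M j i).map (leftOp cs)).prod := by
  have hc : ∀ (ω : List B) (k : B), Commute (ω.map (leftOp cs)).prod (rightOp cs k) := by
    intro ω k
    refine Commute.list_prod_left _ _ fun x hx => ?_
    obtain ⟨l, -, rfl⟩ := List.mem_map.1 hx
    exact commute_leftOp_rightOp cs l k
  refine ext_of_commute_rightOp cs (hc _) (hc _) ?_
  rw [prod_map_leftOp_single cs (isReduced_braidWord cs i j),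
    prod_map_leftOp_single cs (isReduced_braidWord cs j i), cs.wordProd_braidWord_eq]

theorem leftOp_rel ⦃x y : FreeAlgebra LRing B⦄ (h : HeckeRel M x y) :
    FreeAlgebra.lift LRing (leftOp cs) x = FreeAlgebra.lift LRing (leftOp cs) y := by
  have hι : ∀ i : B, (⇑(FreeAlgebra.lift LRing (leftOp cs)) ∘ FreeAlgebra.ι LRing) i =
      leftOp cs i := fun i => FreeAlgebra.lift_ι_apply _ i
  cases h with
  | quad i =>
    simp only [map_mul, map_add, map_one, map_smul, FreeAlgebra.lift_ι_apply, leftOp_mul_self]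
  | braid i j =>
    simp only [freeBraid, map_list_prod, List.map_map, funext hι]
    exact leftOp_braid cs i j

/-- The left regular representation of the Hecke algebra, on the free module with basis `W`. -/
def regularRep : HeckeAlgebra M →ₐ[LRing] Module.End LRing (W →₀ LRing) :=
  RingQuot.liftAlgHom LRing ⟨FreeAlgebra.lift LRing (leftOp cs), leftOp_rel cs⟩

theorem regularRep_gen (i : B) : regularRep cs (heckeGen M i) = leftOp cs i := by
  refine (RingQuot.liftAlgHom_mkAlgHom_apply LRing _ (leftOp_rel cs) _).trans ?_
  exact FreeAlgebra.lift_ι_apply _ i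

theorem heckeAlgebra_induction {p : HeckeAlgebra M → Prop}
    (algebraMap : ∀ r : LRing, p (algebraMap LRing _ r)) (gen : ∀ i, p (heckeGen M i))
    (mul : ∀ a b, p a → p b → p (a * b)) (add : ∀ a b, p a → p b → p (a + b))
    (h : HeckeAlgebra M) : p h := by
  obtain ⟨x, rfl⟩ : ∃ x, heckeMk M x = h := RingQuot.mkAlgHom_surjective LRing (HeckeRel M) h
  induction x using FreeAlgebra.induction with
  | grade0 r =>
    rw [AlgHom.commutes]
    exact algebraMap r
  | grade1 i => exact gen i
  | mul a b ha hb =>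
    rw [map_mul]
    exact mul _ _ ha hb
  | add a b ha hb =>
    rw [map_add]
    exact add _ _ ha hb

theorem commute_regularRep_rightOp (h : HeckeAlgebra M) (i : B) :
    Commute (regularRep cs h) (rightOp cs i) := by
  induction h using heckeAlgebra_induction with
  | algebraMap r =>
    rw [AlgHom.commutes]
    exact Algebra.commutes r _
  | gen j =>
    rw [regularRep_gen]
    exact commute_leftOp_rightOp cs j i
  | mul a b ha hb =>
    rw [map_mul]
    exact ha.mul_left hb
  | add a b ha hb =>
    rw [map_add]
    exact ha.add_left hb

theorem regularRep_heckeT_single (w : W) :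
    regularRep cs (heckeT cs w) (single 1 1) = single w 1 := by
  obtain ⟨ω, hω, rfl⟩ := cs.exists_isReduced w
  have hg : ∀ i, (⇑(regularRep cs) ∘ heckeGen M) i = leftOp cs i := regularRep_gen cs
  rw [heckeT_wordProd cs hω, map_list_prod, List.map_map, funext hg, prod_map_leftOp_single cs hω]

/-- The coordinates of an element of the Hecke algebra in the basis `T_w`. -/
def heckeCoord : HeckeAlgebra M →ₗ[LRing] (W →₀ LRing) :=
  (LinearMap.applyₗ (single 1 1)).comp (regularRep cs).toLinearMap

theorem heckeCoord_apply (h : HeckeAlgebra M) :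
    heckeCoord cs h = regularRep cs h (single 1 1) := rfl

theorem heckeCoord_mul_gen (h : HeckeAlgebra M) (i : B) :
    heckeCoord cs (h * heckeGen M i) = rightOp cs i (heckeCoord cs h) := by
  have h1 : leftOp cs i (single 1 1) = rightOp cs i (single 1 1) := by
    simp [leftOp_single, rightOp_single]
  rw [heckeCoord_apply, map_mul, Module.End.mul_apply, regularRep_gen, h1]
  exact LinearMap.congr_fun (commute_regularRep_rightOp cs h i).eq (single 1 1)

end RegularRepresentation

/-! ### The standard basis of the induced module -/

section InducedBasis

variable {B W : Type*} [Group W] {M : CoxeterMatrix B} (cs : CoxeterSystem M W) (J : Set B)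

open Finsupp

/-- The map `T_{du} ↦ q ^ l(u) • d` for `d ∈ D_J` and `u ∈ W_J`. -/
def cosetMap : (W →₀ LRing) →ₗ[LRing] (minReps cs J →₀ LRing) :=
  linearCombination LRing fun w =>
    single (minRep cs J w) (T ((cs.length w : ℤ) - cs.length (minRep cs J w : W)))

theorem cosetMap_single (w : W) : cosetMap cs J (single w 1) =
    single (minRep cs J w) (T ((cs.length w : ℤ) - cs.length (minRep cs J w : W))) := by
  rw [cosetMap, linearCombination_single, one_smul]

/-- On coordinates, right multiplication by `T_r` with `r ∈ J` becomes multiplication by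
`ψ(T_r) = q`. -/
theorem cosetMap_rightOp {r : B} (hr : r ∈ J) (x : W →₀ LRing) :
    cosetMap cs J (rightOp cs r x) = qq • cosetMap cs J x := by
  suffices h : (cosetMap cs J).comp (rightOp cs r) = qq • cosetMap cs J from
    LinearMap.congr_fun h x
  refine Finsupp.lhom_ext' fun w => LinearMap.ext_ring ?_
  change cosetMap cs J (rightOp cs r (single w 1)) = qq • cosetMap cs J (single w 1)
  rw [rightOp_single, map_add, map_smul, cosetMap_single, cosetMap_single,
    minRep_mul_simple _ _ _ hr, smul_single, smul_single, ← single_add]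
  congr 1
  rw [smul_eq_mul, smul_eq_mul, qq, qinv]
  obtain h | h := cs.length_mul_simple w r
  · rw [if_neg (by omega), zero_mul, add_zero, ← T_add, h]
    congr 1
    push_cast
    ring
  · have e : (cs.length (w * cs.simple r) : ℤ) - cs.length (minRep cs J w : W) =
        -1 + ((cs.length w : ℤ) - cs.length (minRep cs J w : W)) := by
      rw [← h]
      push_cast
      ring
    rw [if_pos (by omega), sub_mul, ← T_add, ← T_add, e]
    ring

/-- The coordinates in the basis `b_d`, `d ∈ D_J`, of the element `h ⊗ 1` of the induced module. -/
def inducedCoordAux : HeckeAlgebra M →ₗ[LRing] (minReps cs J →₀ LRing) :=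
  (cosetMap cs J).comp (heckeCoord cs)

theorem inducedCoordAux_mul (h : HeckeAlgebra M) {k : HeckeAlgebra M} (hk : k ∈ parabolic M J) :
    inducedCoordAux cs J (h * k) = indexChar M k • inducedCoordAux cs J h := by
  induction hk using Algebra.adjoin_induction generalizing h with
  | mem x hx =>
    obtain ⟨r, hr, rfl⟩ := hx
    rw [indexChar_gen, inducedCoordAux, LinearMap.comp_apply, heckeCoord_mul_gen,
      cosetMap_rightOp _ _ hr]
    rfl
  | algebraMap r =>
    rw [← Algebra.commutes, ← Algebra.smul_def, map_smul, AlgHom.commutes]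
    rfl
  | add x y _ _ hx hy => rw [mul_add, map_add, map_add, hx, hy, add_smul]
  | mul x y _ _ hx hy => rw [← mul_assoc, hy, hx, map_mul, smul_smul, mul_comm]

/-- The coordinates in the basis `b_d`, `d ∈ D_J`, on the tensor product over `𝒜`. -/
def preInducedCoord : HeckeAlgebra M ⊗[LRing] LRing →ₗ[LRing] (minReps cs J →₀ LRing) :=
  (inducedCoordAux cs J).comp (TensorProduct.rid LRing (HeckeAlgebra M)).toLinearMap

theorem preInducedCoord_tmul (h : HeckeAlgebra M) (a : LRing) :
    preInducedCoord cs J (h ⊗ₜ a) = a • inducedCoordAux cs J h := by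
  simp [preInducedCoord]

/-- The coordinates are well defined on the induced module. The submodule of relations is
spanned over the Hecke algebra, while the coordinate map is only `𝒜`-linear, so the induction
establishes vanishing on all multiples `g • x`. -/
theorem preInducedCoord_eq_zero {x : HeckeAlgebra M ⊗[LRing] LRing} (hx : x ∈ inducedRel M J) :
    preInducedCoord cs J x = 0 := by
  suffices H : ∀ g : HeckeAlgebra M, preInducedCoord cs J (g • x) = 0 by simpa using H 1
  refine Submodule.span_induction (p := fun x _ => ∀ g : HeckeAlgebra M,
    preInducedCoord cs J (g • x) = 0) ?_ ?_ ?_ ?_ hx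
  · rintro _ ⟨h, k, a, rfl⟩ g
    rw [smul_sub, TensorProduct.smul_tmul', TensorProduct.smul_tmul', map_sub, preInducedCoord_tmul,
      preInducedCoord_tmul, smul_eq_mul, smul_eq_mul, ← mul_assoc, inducedCoordAux_mul _ _ _ k.2,
      smul_smul, mul_comm a]
    exact sub_self _
  · simp
  · intro x y _ _ hx hy g
    rw [smul_add, map_add, hx, hy, add_zero]
  · intro h x _ hx g
    rw [smul_smul, hx]

/-- The coordinates in the basis `b_d`, `d ∈ D_J`, of the induced module. -/
def inducedCoord : Induced M J →ₗ[LRing] (minReps cs J →₀ LRing) :=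
  (((inducedRel M J).restrictScalars LRing).liftQ (preInducedCoord cs J)
    fun _ hx => preInducedCoord_eq_zero cs J hx).comp
    (Submodule.Quotient.restrictScalarsEquiv LRing (inducedRel M J)).symm.toLinearMap

theorem inducedCoord_tmul (h : HeckeAlgebra M) (a : LRing) :
    inducedCoord cs J (inducedTmul M J h a) = a • inducedCoordAux cs J h :=
  preInducedCoord_tmul cs J h a

theorem inducedCoord_stdElt (w : minReps cs J) :
    inducedCoord cs J (stdElt cs J w) = single w 1 := by
  rw [stdElt, inducedCoord_tmul, one_smul, inducedCoordAux, LinearMap.comp_apply, heckeCoord_apply,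
    regularRep_heckeT_single, cosetMap_single, minRep_coe, sub_self, T_zero]

theorem smul_inducedTmul (g h : HeckeAlgebra M) (a : LRing) :
    g • inducedTmul M J h a = inducedTmul M J (g * h) a := by
  rw [inducedTmul, inducedTmul, ← Submodule.Quotient.mk_smul, TensorProduct.smul_tmul', smul_eq_mul]

theorem inducedTmul_smul (r : LRing) (h : HeckeAlgebra M) (a : LRing) :
    inducedTmul M J h (r * a) = r • inducedTmul M J h a := by
  rw [inducedTmul, inducedTmul, ← Submodule.Quotient.mk_smul, TensorProduct.smul_tmul',
    TensorProduct.smul_tmul, smul_eq_mul]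

theorem inducedTmul_smul_left (r : LRing) (h : HeckeAlgebra M) (a : LRing) :
    inducedTmul M J (r • h) a = r • inducedTmul M J h a := by
  rw [inducedTmul, inducedTmul, ← Submodule.Quotient.mk_smul, TensorProduct.smul_tmul']

theorem inducedTmul_add_left (h k : HeckeAlgebra M) (a : LRing) :
    inducedTmul M J (h + k) a = inducedTmul M J h a + inducedTmul M J k a := by
  rw [inducedTmul, TensorProduct.add_tmul]
  rfl

variable {cs J}

theorem heckeGen_smul_stdElt_of_gt {i : B} {w w' : minReps cs J}
    (hw' : (w' : W) = cs.simple i * w) (h : cs.length (w' : W) < cs.length (w : W)) :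
    heckeGen M i • stdElt cs J w = stdElt cs J w' + (qq - qinv) • stdElt cs J w := by
  rw [hw'] at h
  rw [stdElt, smul_inducedTmul, heckeGen_mul_heckeT_of_gt cs h, inducedTmul_add_left,
    inducedTmul_smul_left, ← hw']
  rfl

theorem heckeGen_smul_stdElt_of_lt {i : B} {w w' : minReps cs J}
    (hw' : (w' : W) = cs.simple i * w) (h : cs.length (w : W) < cs.length (w' : W)) :
    heckeGen M i • stdElt cs J w = stdElt cs J w' := by
  rw [hw'] at h
  rw [stdElt, smul_inducedTmul, heckeGen_mul_heckeT_of_lt cs h, ← hw']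
  rfl

theorem heckeGen_smul_stdElt_of_notMem {i : B} {w : minReps cs J}
    (h : cs.simple i * (w : W) ∉ minReps cs J) :
    heckeGen M i • stdElt cs J w = qq • stdElt cs J w := by
  obtain ⟨r, hr, e⟩ := exists_simple_mul_eq_mul_simple w.2 h
  have hlt : cs.length (w : W) < cs.length (cs.simple i * (w : W)) :=
    lt_length_simple_mul_of_not_lt cs fun h' => h (simple_mul_mem_minReps w.2 h')
  have h1 := inducedTmul_mul M J (heckeT cs w)
    ⟨heckeGen M r, Algebra.subset_adjoin ⟨r, hr, rfl⟩⟩ 1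
  rw [psi_gen M J r hr, inducedTmul_smul] at h1
  rw [stdElt, smul_inducedTmul, heckeGen_mul_heckeT_of_lt cs hlt, e,
    ← heckeT_mul_heckeGen_of_lt cs (w.2 r hr)]
  exact h1

variable (cs J)

/-- The span of the `b_w` is stable under the generators `T_s`, and contains the generator `1 ⊗ 1`
of the induced module. -/
theorem span_stdElt : Submodule.span LRing (Set.range (stdElt cs J)) = ⊤ := by
  set N := Submodule.span LRing (Set.range (stdElt cs J))
  have hN : ∀ w, stdElt cs J w ∈ N := fun w => Submodule.subset_span ⟨w, rfl⟩
  have hgen : ∀ (i : B), ∀ x ∈ N, heckeGen M i • x ∈ N := by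
    intro i x hx
    induction hx using Submodule.span_induction with
    | mem x hx =>
      obtain ⟨w, rfl⟩ := hx
      by_cases hmem : cs.simple i * (w : W) ∈ minReps cs J
      · obtain h | h := lt_or_gt_of_ne (cs.length_simple_mul_ne (w : W) i)
        · rw [heckeGen_smul_stdElt_of_gt (w' := ⟨_, hmem⟩) rfl h]
          exact add_mem (hN _) (N.smul_mem _ (hN _))
        · rw [heckeGen_smul_stdElt_of_lt (w' := ⟨_, hmem⟩) rfl h]
          exact hN _
      · rw [heckeGen_smul_stdElt_of_notMem hmem]
        exact N.smul_mem _ (hN _)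
    | zero => rw [smul_zero]; exact zero_mem N
    | add x y _ _ hx hy => rw [smul_add]; exact add_mem hx hy
    | smul a x _ hx => rw [smul_comm]; exact N.smul_mem a hx
  have hsmul : ∀ (h : HeckeAlgebra M), ∀ x ∈ N, h • x ∈ N := by
    intro h
    induction h using heckeAlgebra_induction with
    | algebraMap r =>
      intro x hx
      rw [algebraMap_smul]
      exact N.smul_mem r hx
    | gen i => exact hgen i
    | mul a b ha hb => exact fun x hx => by rw [mul_smul]; exact ha _ (hb _ hx)
    | add a b ha hb => exact fun x hx => by rw [add_smul]; exact add_mem (ha _ hx) (hb _ hx)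
  rw [eq_top_iff]
  rintro x -
  obtain ⟨x, rfl⟩ := Submodule.Quotient.mk_surjective _ x
  induction x using TensorProduct.induction_on with
  | zero => exact zero_mem N
  | tmul h a =>
    change inducedTmul M J h a ∈ N
    have h1 := hsmul h _ (N.smul_mem a (hN ⟨1, one_mem_minReps⟩))
    rw [stdElt, heckeT_one, smul_comm, smul_inducedTmul, mul_one, ← inducedTmul_smul, mul_one] at h1
    exact h1
  | add x y hx hy => exact add_mem hx hy

/-- The standard basis `b_w`, `w ∈ D_J`, of the induced module. -/
def stdBasis : Module.Basis (minReps cs J) LRing (Induced M J) :=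
  .mk (v := stdElt cs J)
    (by
      refine LinearIndependent.of_comp (inducedCoord cs J) ?_
      have e : ⇑(inducedCoord cs J) ∘ stdElt cs J = fun w => single w 1 :=
        funext (inducedCoord_stdElt cs J)
      rw [e]
      exact Finsupp.linearIndependent_single_one LRing _)
    (span_stdElt cs J).ge

theorem stdBasis_apply (w : minReps cs J) : stdBasis cs J w = stdElt cs J w := by
  simp [stdBasis]

end InducedBasis

/-! ### Substitutions in Laurent polynomials -/

section Laurent

/-- The map `ℤ[X] → ℤ[q, q⁻¹]` with `X ↦ q²`. -/
def evalSq : ℤ[X] →ₐ[ℤ] LRing := Polynomial.aeval (T 2)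

/-- The map `ℤ[X] → ℤ[q, q⁻¹]` with `X ↦ q⁻²`. -/
def evalInvSq : ℤ[X] →ₐ[ℤ] LRing := Polynomial.aeval (T (-2))

/-- The endomorphism of `ℤ[q, q⁻¹]` with `q ↦ q²`. -/
def sqHom : LRing →+* LRing := AddMonoidAlgebra.mapDomainRingHom ℤ (AddMonoidHom.mulLeft (2 : ℤ))

theorem sqHom_T (n : ℤ) : sqHom (T n) = T (2 * n) := by
  exact AddMonoidAlgebra.mapDomain_single

theorem sqHom_injective : Function.Injective sqHom :=
  AddMonoidAlgebra.mapDomain_injective fun a b h => by simpa using h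

theorem evalSq_X : evalSq X = T 2 := by simp [evalSq]

theorem evalInvSq_X : evalInvSq X = T (-2) := by simp [evalInvSq]

theorem sqHom_toLaurent (f : ℤ[X]) : sqHom (Polynomial.toLaurent f) = evalSq f := by
  suffices h : sqHom.comp Polynomial.toLaurent = evalSq.toRingHom from RingHom.congr_fun h f
  refine Polynomial.ringHom_ext' (RingHom.ext_int _ _) ?_
  change sqHom (Polynomial.toLaurent X) = evalSq X
  rw [Polynomial.toLaurent_X, sqHom_T, evalSq_X, mul_one]

theorem evalSq_injective : Function.Injective evalSq := by
  intro f g h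
  rw [← sqHom_toLaurent, ← sqHom_toLaurent] at h
  exact Polynomial.toLaurent_injective (sqHom_injective h)

theorem barA_T (n : ℤ) : barA (T n) = T (-n) := LaurentPolynomial.invert_T n

theorem coeff_barA (f : LRing) (n : ℤ) : (barA f).coeff n = f.coeff (-n) :=
  LaurentPolynomial.invert_apply f n

theorem barA_barA (f : LRing) : barA (barA f) = f := LaurentPolynomial.involutive_invert f

theorem barA_evalInvSq (f : ℤ[X]) : barA (evalInvSq f) = evalSq f := by
  suffices h : barA.comp evalInvSq.toRingHom = evalSq.toRingHom from RingHom.congr_fun h f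
  refine Polynomial.ringHom_ext' (RingHom.ext_int _ _) ?_
  change barA (evalInvSq X) = evalSq X
  rw [evalInvSq_X, barA_T, evalSq_X, neg_neg]

theorem evalInvSq_injective : Function.Injective evalInvSq := by
  intro f g h
  apply evalSq_injective
  rw [← barA_evalInvSq, ← barA_evalInvSq, h]

theorem sqHom_barA (f : LRing) : sqHom (barA f) = barA (sqHom f) := by
  induction f using LaurentPolynomial.induction_on' with
  | add p q hp hq => simp only [map_add, hp, hq]
  | C_mul_T n a =>
    have hC : ∀ φ : LRing →+* LRing, φ (LaurentPolynomial.C a) = LaurentPolynomial.C a := by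
      intro φ
      rw [← Int.cast_id (n := a), map_intCast (LaurentPolynomial.C (R := ℤ)), map_intCast φ]
    simp only [map_mul, hC, barA_T, sqHom_T]
    rw [mul_neg]

/-- The monomial `(-1) ^ (m - n) q ^ (m - n)`. -/
def signedT (m n : ℕ) : LRing := (-1) ^ (m + n) * T ((m : ℤ) - n)

theorem signedT_self (n : ℕ) : signedT n n = 1 := by
  simp [signedT]

theorem signedT_succ_left (m n : ℕ) : signedT (m + 1) n = -qq * signedT m n := by
  rw [signedT, signedT, qq, show ((m + 1 : ℕ) : ℤ) - n = 1 + (m - n) by push_cast; ring, T_add]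
  ring

theorem signedT_succ_right (m n : ℕ) : signedT m (n + 1) = -qinv * signedT m n := by
  rw [signedT, signedT, qinv, show (m : ℤ) - (n + 1 : ℕ) = -1 + (m - n) by push_cast; ring, T_add]
  ring

theorem signedT_succ_succ (m n : ℕ) : signedT (m + 1) (n + 1) = signedT m n := by
  rw [signedT_succ_left, signedT_succ_right]
  linear_combination signedT m n * qq_mul_qinv

theorem signedT_mul (k m n : ℕ) : signedT k m * signedT m n = signedT k n := by
  rw [signedT, signedT, signedT, show (k : ℤ) - n = (k - m) + (m - n) by ring, T_add, pow_add,
    pow_add, pow_add]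
  linear_combination ((-1) ^ k * (-1) ^ n * T ((k : ℤ) - m) * T ((m : ℤ) - n)) *
    (Even.neg_one_pow ⟨m, rfl⟩ : (-1 : LRing) ^ (m + m) = 1)

theorem isUnit_signedT (m n : ℕ) : IsUnit (signedT m n) :=
  IsUnit.of_mul_eq_one (signedT n m) (by rw [signedT_mul, signedT_self])

theorem barA_signedT (m n : ℕ) : barA (signedT m n) = signedT n m := by
  rw [signedT, signedT, map_mul, barA_T, map_pow, map_neg, map_one, neg_sub, add_comm]

theorem T_two_eq : (T 2 : LRing) = qq * qq := by
  rw [qq, ← T_add]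
  rfl

end Laurent

/-! ### Coefficients with respect to the standard basis -/

section Coefficients

variable {B W : Type*} [Group W] {M : CoxeterMatrix B} {cs : CoxeterSystem M W} {J : Set B}

/-- The coefficient of `b_y` in an element of the induced module. -/
def stdCoeff (y : minReps cs J) : Induced M J →ₗ[LRing] LRing := (stdBasis cs J).coord y

open Classical in
theorem stdCoeff_stdElt (y w : minReps cs J) :
    stdCoeff y (stdElt cs J w) = if w = y then 1 else 0 := by
  rw [stdCoeff, ← stdBasis_apply, Module.Basis.coord_apply, Module.Basis.repr_self,
    Finsupp.single_apply]

theorem stdCoeff_ext {x x' : Induced M J}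
    (h : ∀ y : minReps cs J, stdCoeff y x = stdCoeff y x') : x = x' :=
  (stdBasis cs J).ext_elem h

theorem finite_support_stdCoeff (x : Induced M J) :
    {y : minReps cs J | stdCoeff y x ≠ 0}.Finite := by
  refine (((stdBasis cs J).repr x).support.finite_toSet).subset fun y hy => ?_
  exact Finsupp.mem_support_iff.2 hy

/-- Two linear forms on the induced module which agree on the elements `b_w` are equal. -/
theorem linearMap_ext_stdElt {f g : Induced M J →ₗ[LRing] LRing}
    (h : ∀ w : minReps cs J, f (stdElt cs J w) = g (stdElt cs J w)) : f = g :=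
  (stdBasis cs J).ext fun w => by rw [stdBasis_apply]; exact h w

theorem eq_simple_mul_comm {y y' : minReps cs J} {i : B} (h : (y' : W) = cs.simple i * y) :
    (y : W) = cs.simple i * y' := by
  rw [h, cs.simple_mul_simple_cancel_left]

/-- Multiplication by `h` as an `𝒜`-linear map of the induced module. -/
def smulMap (h : HeckeAlgebra M) : Induced M J →ₗ[LRing] Induced M J where
  toFun x := h • x
  map_add' := smul_add h
  map_smul' a x := smul_comm h a x

theorem smulMap_apply (h : HeckeAlgebra M) (x : Induced M J) : smulMap h x = h • x := rfl

/-- The three cases of left multiplication of `w ∈ D_J` by a simple reflection. -/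
theorem minReps_trichotomy (w : minReps cs J) (i : B) :
    (∃ w' : minReps cs J, (w' : W) = cs.simple i * w ∧ cs.length (w' : W) < cs.length (w : W)) ∨
    (∃ w' : minReps cs J, (w' : W) = cs.simple i * w ∧ cs.length (w : W) < cs.length (w' : W)) ∨
    cs.simple i * (w : W) ∉ minReps cs J := by
  by_cases h : cs.simple i * (w : W) ∈ minReps cs J
  · obtain h' | h' := lt_or_gt_of_ne (cs.length_simple_mul_ne (w : W) i)
    · exact .inl ⟨⟨_, h⟩, rfl, h'⟩
    · exact .inr (.inl ⟨⟨_, h⟩, rfl, h'⟩)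
  · exact .inr (.inr h)

theorem stdCoeff_heckeGen_smul_of_gt {y y' : minReps cs J} {i : B}
    (hy : (y' : W) = cs.simple i * y) (hl : cs.length (y' : W) < cs.length (y : W))
    (x : Induced M J) :
    stdCoeff y (heckeGen M i • x) = stdCoeff y' x + (qq - qinv) * stdCoeff y x := by
  classical
  suffices h : (stdCoeff y).comp (smulMap (heckeGen M i)) =
      stdCoeff y' + (qq - qinv) • stdCoeff y from LinearMap.congr_fun h x
  refine linearMap_ext_stdElt (cs := cs) fun w => ?_
  simp only [LinearMap.comp_apply, smulMap_apply, LinearMap.add_apply, LinearMap.smul_apply,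
    smul_eq_mul, stdCoeff_stdElt]
  obtain ⟨w', hw, hlw⟩ | ⟨w', hw, hlw⟩ | hw := minReps_trichotomy w i
  · have h1 : w' = y ↔ w = y' := by
      rw [Subtype.ext_iff, Subtype.ext_iff, hw, hy, ← cs.inv_simple, inv_mul_eq_iff_eq_mul,
        cs.inv_simple]
    rw [heckeGen_smul_stdElt_of_gt hw hlw, map_add, map_smul, stdCoeff_stdElt, stdCoeff_stdElt]
    simp only [h1, smul_eq_mul]
  · have h1 : w' = y ↔ w = y' := by
      rw [Subtype.ext_iff, Subtype.ext_iff, hw, hy, ← cs.inv_simple, inv_mul_eq_iff_eq_mul,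
        cs.inv_simple]
    have h2 : w ≠ y := by
      rintro rfl
      rw [hw] at hlw
      rw [hy] at hl
      omega
    rw [heckeGen_smul_stdElt_of_lt hw hlw, stdCoeff_stdElt, if_neg h2, mul_zero, add_zero]
    simp only [h1]
  · have h1 : w ≠ y' := by
      rintro rfl
      exact hw (eq_simple_mul_comm hy ▸ y.2)
    have h2 : w ≠ y := by
      rintro rfl
      exact hw (hy ▸ y'.2)
    rw [heckeGen_smul_stdElt_of_notMem hw, map_smul, stdCoeff_stdElt, if_neg h1, if_neg h2]
    simp

theorem stdCoeff_heckeGen_smul_of_lt {y y' : minReps cs J} {i : B}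
    (hy : (y' : W) = cs.simple i * y) (hl : cs.length (y : W) < cs.length (y' : W))
    (x : Induced M J) : stdCoeff y (heckeGen M i • x) = stdCoeff y' x := by
  classical
  suffices h : (stdCoeff y).comp (smulMap (heckeGen M i)) = stdCoeff y' from LinearMap.congr_fun h x
  refine linearMap_ext_stdElt (cs := cs) fun w => ?_
  simp only [LinearMap.comp_apply, smulMap_apply, stdCoeff_stdElt]
  obtain ⟨w', hw, hlw⟩ | ⟨w', hw, hlw⟩ | hw := minReps_trichotomy w i
  · have h1 : w' = y ↔ w = y' := by
      rw [Subtype.ext_iff, Subtype.ext_iff, hw, hy, ← cs.inv_simple, inv_mul_eq_iff_eq_mul,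
        cs.inv_simple]
    have h2 : w ≠ y := by
      rintro rfl
      rw [hw] at hlw
      rw [hy] at hl
      omega
    rw [heckeGen_smul_stdElt_of_gt hw hlw, map_add, map_smul, stdCoeff_stdElt, stdCoeff_stdElt,
      if_neg h2, smul_zero, add_zero]
    simp only [h1]
  · have h1 : w' = y ↔ w = y' := by
      rw [Subtype.ext_iff, Subtype.ext_iff, hw, hy, ← cs.inv_simple, inv_mul_eq_iff_eq_mul,
        cs.inv_simple]
    rw [heckeGen_smul_stdElt_of_lt hw hlw, stdCoeff_stdElt]
    simp only [h1]
  · have h1 : w ≠ y' := by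
      rintro rfl
      exact hw (eq_simple_mul_comm hy ▸ y.2)
    have h2 : w ≠ y := by
      rintro rfl
      exact hw (hy ▸ y'.2)
    rw [heckeGen_smul_stdElt_of_notMem hw, map_smul, stdCoeff_stdElt, if_neg h1, if_neg h2]
    simp

theorem stdCoeff_heckeGen_smul_of_notMem {y : minReps cs J} {i : B}
    (hy : cs.simple i * (y : W) ∉ minReps cs J) (x : Induced M J) :
    stdCoeff y (heckeGen M i • x) = qq * stdCoeff y x := by
  classical
  suffices h : (stdCoeff y).comp (smulMap (heckeGen M i)) = qq • stdCoeff y from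
    LinearMap.congr_fun h x
  refine linearMap_ext_stdElt (cs := cs) fun w => ?_
  simp only [LinearMap.comp_apply, smulMap_apply, LinearMap.smul_apply, smul_eq_mul,
    stdCoeff_stdElt]
  have key : ∀ w' : minReps cs J, (w' : W) = cs.simple i * w → w' ≠ y ∧ w ≠ y := by
    rintro w' hw
    constructor
    · rintro rfl
      exact hy (eq_simple_mul_comm hw ▸ w.2)
    · rintro rfl
      exact hy (hw ▸ w'.2)
  obtain ⟨w', hw, hlw⟩ | ⟨w', hw, hlw⟩ | hw := minReps_trichotomy w i
  · rw [heckeGen_smul_stdElt_of_gt hw hlw, map_add, map_smul, stdCoeff_stdElt, stdCoeff_stdElt,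
      if_neg (key w' hw).1, if_neg (key w' hw).2]
    simp
  · rw [heckeGen_smul_stdElt_of_lt hw hlw, stdCoeff_stdElt, if_neg (key w' hw).1,
      if_neg (key w' hw).2, mul_zero]
  · rw [heckeGen_smul_stdElt_of_notMem hw, map_smul, stdCoeff_stdElt, smul_eq_mul]

end Coefficients

/-! ### The bar involution on the standard basis -/

section Bar

variable {B W : Type*} [Group W] {M : CoxeterMatrix B} {cs : CoxeterSystem M W} {J : Set B}

theorem inducedBar_smul (a : LRing) (x : Induced M J) :
    inducedBar M J (a • x) = barA a • inducedBar M J x := by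
  rw [← algebraMap_smul (HeckeAlgebra M) a x, map_smulₛₗ, heckeBar_algebraMap, algebraMap_smul]

theorem inducedBar_heckeGen_smul (i : B) (x : Induced M J) :
    inducedBar M J (heckeGen M i • x) =
      heckeGen M i • inducedBar M J x - (qq - qinv) • inducedBar M J x := by
  rw [map_smulₛₗ, heckeBar_gen, heckeGenInv, sub_smul, algebraMap_smul]

theorem inducedBar_stdElt_of_lt {w w' : minReps cs J} {i : B} (hw : (w' : W) = cs.simple i * w)
    (hl : cs.length (w' : W) < cs.length (w : W)) :
    inducedBar M J (stdElt cs J w) = heckeGen M i • inducedBar M J (stdElt cs J w') -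
      (qq - qinv) • inducedBar M J (stdElt cs J w') := by
  rw [← heckeGen_smul_stdElt_of_lt (eq_simple_mul_comm hw) hl, inducedBar_heckeGen_smul]

/-- The coefficient of `b_y` in the bar conjugate of `b_w`. -/
def barCoeff (y w : minReps cs J) : LRing := stdCoeff y (inducedBar M J (stdElt cs J w))

theorem barCoeff_of_gt {y y' w w' : minReps cs J} {i : B} (hw : (w' : W) = cs.simple i * w)
    (hlw : cs.length (w' : W) < cs.length (w : W)) (hy : (y' : W) = cs.simple i * y)
    (hly : cs.length (y' : W) < cs.length (y : W)) : barCoeff y w = barCoeff y' w' := by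
  rw [barCoeff, inducedBar_stdElt_of_lt hw hlw, map_sub,
    stdCoeff_heckeGen_smul_of_gt hy hly, map_smul, smul_eq_mul, add_sub_cancel_right, barCoeff]

theorem barCoeff_of_lt {y y' w w' : minReps cs J} {i : B} (hw : (w' : W) = cs.simple i * w)
    (hlw : cs.length (w' : W) < cs.length (w : W)) (hy : (y' : W) = cs.simple i * y)
    (hly : cs.length (y : W) < cs.length (y' : W)) :
    barCoeff y w = barCoeff y' w' - (qq - qinv) * barCoeff y w' := by
  rw [barCoeff, inducedBar_stdElt_of_lt hw hlw, map_sub,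
    stdCoeff_heckeGen_smul_of_lt hy hly, map_smul, smul_eq_mul, barCoeff, barCoeff]

theorem barCoeff_of_notMem {y w w' : minReps cs J} {i : B} (hw : (w' : W) = cs.simple i * w)
    (hlw : cs.length (w' : W) < cs.length (w : W)) (hy : cs.simple i * (y : W) ∉ minReps cs J) :
    barCoeff y w = qinv * barCoeff y w' := by
  rw [barCoeff, inducedBar_stdElt_of_lt hw hlw, map_sub,
    stdCoeff_heckeGen_smul_of_notMem hy, map_smul, smul_eq_mul, barCoeff]
  ring

open Classical in
theorem barCoeff_one (y w : minReps cs J) (hw : (w : W) = 1) :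
    barCoeff y w = if w = y then 1 else 0 := by
  have h : inducedBar M J (stdElt cs J w) = stdElt cs J w := by
    rw [stdElt, hw, heckeT_one, inducedBar_tmul, map_one, map_one]
  rw [barCoeff, h, stdCoeff_stdElt]

/-- Induction along left descents inside `D_J`. -/
theorem minReps_induction {p : minReps cs J → Prop} (one : ∀ w : minReps cs J, (w : W) = 1 → p w)
    (step : ∀ (w w' : minReps cs J) (i : B), (w' : W) = cs.simple i * w →
      cs.length (w' : W) < cs.length (w : W) → p w' → p w) (w : minReps cs J) : p w := by
  induction hn : cs.length (w : W) using Nat.strong_induction_on generalizing w with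
  | _ n ih =>
  by_cases hw : (w : W) = 1
  · exact one w hw
  · obtain ⟨i, hi⟩ := cs.exists_leftDescent_of_ne_one hw
    exact step w ⟨_, simple_mul_mem_minReps w.2 hi⟩ i rfl hi (ih _ (hn ▸ hi) _ rfl)

theorem length_eq_of_simple_mul_lt {w w' : W} {i : B} (hw : w' = cs.simple i * w)
    (hl : cs.length w' < cs.length w) : cs.length w = cs.length w' + 1 := by
  subst hw
  have := cs.length_simple_mul w i
  omega

/-- If `y ≤ w' = s w < w`, then `s y ≤ w`. -/
theorem BruhatLE.of_simple_mul {y y' w w' : W} {i : B} (h : BruhatLE cs y' w')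
    (hw : w' = cs.simple i * w) (hl : cs.length w' < cs.length w) (hy : y' = cs.simple i * y) :
    BruhatLE cs y w := by
  have e : cs.simple i * w' = w := by rw [hw, cs.simple_mul_simple_cancel_left]
  have e' : cs.simple i * y' = y := by rw [hy, cs.simple_mul_simple_cancel_left]
  rw [← e, ← e']
  exact h.simple_mul_le (by rwa [e])

theorem BruhatLE.of_lt_simple_mul {y w w' : W} {i : B} (h : BruhatLE cs y w')
    (hw : w' = cs.simple i * w) (hl : cs.length w' < cs.length w) : BruhatLE cs y w := by
  subst hw
  exact h.trans (BruhatLT.of_simple_mul_length_lt hl).1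

theorem barCoeff_eq_zero (y w : minReps cs J) (h : ¬ BruhatLE cs (y : W) w) :
    barCoeff y w = 0 := by
  induction w using minReps_induction generalizing y with
  | one w hw =>
    classical
    rw [barCoeff_one y w hw, if_neg]
    rintro rfl
    exact h (.refl cs _)
  | step w w' i hw hl ih =>
    have h1 : barCoeff y w' = 0 := ih y fun h' => h (h'.of_lt_simple_mul hw hl)
    obtain ⟨y', hy, hly⟩ | ⟨y', hy, hly⟩ | hy := minReps_trichotomy y i
    · rw [barCoeff_of_gt hw hl hy hly]
      exact ih y' fun h' => h (h'.of_simple_mul hw hl hy)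
    · rw [barCoeff_of_lt hw hl hy hly, h1, ih y' fun h' => h (h'.of_simple_mul hw hl hy), mul_zero,
        sub_zero]
    · rw [barCoeff_of_notMem hw hl hy, h1, mul_zero]

theorem barCoeff_self (w : minReps cs J) : barCoeff w w = 1 := by
  induction w using minReps_induction with
  | one w hw =>
    rw [barCoeff_one w w hw, if_pos rfl]
  | step w w' i hw hl ih => rw [barCoeff_of_gt hw hl hw hl, ih]

/-- The bar involution in coordinates. -/
theorem stdCoeff_inducedBar (y : minReps cs J) (x : Induced M J) :
    stdCoeff y (inducedBar M J x) =
      ((stdBasis cs J).repr x).sum fun z a => barA a * barCoeff y z := by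
  conv_lhs => rw [← (stdBasis cs J).linearCombination_repr x, Finsupp.linearCombination_apply]
  rw [Finsupp.sum, Finsupp.sum, map_sum, map_sum]
  refine Finset.sum_congr rfl fun z _ => ?_
  rw [inducedBar_smul, map_smul, smul_eq_mul, stdBasis_apply, barCoeff]

end Bar

/-! ### Parabolic `R`-polynomials -/

section RPolynomials

variable {B W : Type*} [Group W] {M : CoxeterMatrix B} {cs : CoxeterSystem M W} {J : Set B}

/-- `R` gives the coefficients of the bar conjugates of the `b_w`, in the normalisation
`(-q) ^ (l(y) - l(w)) R_{y,w}(q²)`. -/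
def RepresentsBar (R : minReps cs J → minReps cs J → ℤ[X]) : Prop :=
  ∀ y w, barCoeff y w = signedT (cs.length (y : W)) (cs.length (w : W)) * evalSq (R y w)

theorem signedT_mul_evalSq_of_lt (k n : ℕ) (f g : ℤ[X]) :
    signedT (k + 1) n * evalSq g - (qq - qinv) * (signedT k n * evalSq f) =
      signedT k (n + 1) * evalSq ((X - 1) * f + X * g) := by
  simp only [map_add, map_mul, map_sub, map_one, evalSq_X, signedT_succ_left, signedT_succ_right,
    T_two_eq]
  linear_combination ((signedT k n * evalSq f + signedT k n * evalSq g) * qq) * qq_mul_qinv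

theorem qinv_mul_signedT_mul_evalSq (k n : ℕ) (f : ℤ[X]) :
    qinv * (signedT k n * evalSq f) = signedT k (n + 1) * evalSq ((X - 1 - X) * f) := by
  simp only [sub_sub_cancel_left, neg_mul, one_mul, map_neg, signedT_succ_right]
  ring

/-- The coefficients of the bar conjugates of the `b_w` have the shape of `R`-polynomials. -/
theorem exists_representsBar :
    ∃ R : minReps cs J → minReps cs J → ℤ[X], RepresentsBar R := by
  suffices h : ∀ w y : minReps cs J, ∃ f : ℤ[X],
      barCoeff y w = signedT (cs.length (y : W)) (cs.length (w : W)) * evalSq f by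
    choose R hR using h
    exact ⟨fun y w => R w y, fun y w => hR w y⟩
  intro w
  induction w using minReps_induction with
  | one w hw =>
    intro y
    classical
    rw [barCoeff_one y w hw]
    by_cases h : w = y
    · subst h
      exact ⟨1, by rw [if_pos rfl, signedT_self, map_one, mul_one]⟩
    · exact ⟨0, by rw [if_neg h, map_zero, mul_zero]⟩
  | step w w' i hw hl ih =>
    intro y
    rw [length_eq_of_simple_mul_lt hw hl]
    obtain ⟨f, hf⟩ := ih y
    obtain ⟨y', hy, hly⟩ | ⟨y', hy, hly⟩ | hy := minReps_trichotomy y i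
    · obtain ⟨g, hg⟩ := ih y'
      refine ⟨g, ?_⟩
      rw [barCoeff_of_gt hw hl hy hly, hg, length_eq_of_simple_mul_lt hy hly, signedT_succ_succ]
    · obtain ⟨g, hg⟩ := ih y'
      refine ⟨(X - 1) * f + X * g, ?_⟩
      rw [barCoeff_of_lt hw hl hy hly, hf, hg,
        length_eq_of_simple_mul_lt (eq_simple_mul_comm hy) hly, signedT_mul_evalSq_of_lt]
    · exact ⟨_, by rw [barCoeff_of_notMem hw hl hy, hf, qinv_mul_signedT_mul_evalSq]⟩

theorem signedT_mul_evalSq_injective (k n : ℕ) {f g : ℤ[X]}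
    (h : signedT k n * evalSq f = signedT k n * evalSq g) : f = g :=
  evalSq_injective ((isUnit_signedT k n).mul_left_cancel h)

/-- The recursion for the coefficients of the bar conjugates of the `b_w` is that of the parabolic
`R`-polynomials. -/
theorem RepresentsBar.isDeodharR {R : minReps cs J → minReps cs J → ℤ[X]}
    (hR : RepresentsBar R) : IsDeodharR cs J X R where
  eq_zero u v h := by
    have h1 := hR u v
    rw [barCoeff_eq_zero u v h] at h1
    exact signedT_mul_evalSq_injective _ _ (by rw [← h1, map_zero, mul_zero])
  self u := by
    have h1 := hR u u
    rw [barCoeff_self] at h1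
    exact signedT_mul_evalSq_injective _ _ (by rw [← h1, map_one, signedT_self, one_mul])
  strong_descent u v u' v' i _ hv hlv hu hlu := by
    have h1 := hR u v
    rw [barCoeff_of_gt hv hlv hu hlu, hR, length_eq_of_simple_mul_lt hv hlv,
      length_eq_of_simple_mul_lt hu hlu, signedT_succ_succ] at h1
    exact (signedT_mul_evalSq_injective _ _ h1).symm
  strong_ascent u v u' v' i _ hv hlv hu hlu := by
    have h1 := hR u v
    rw [barCoeff_of_lt hv hlv hu hlu, hR, hR, length_eq_of_simple_mul_lt hv hlv,
      length_eq_of_simple_mul_lt (eq_simple_mul_comm hu) hlu, signedT_mul_evalSq_of_lt] at h1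
    exact (signedT_mul_evalSq_injective _ _ h1).symm
  weak u v v' i _ hv hlv _ hu := by
    have h1 := hR u v
    rw [barCoeff_of_notMem hv hlv hu, hR, length_eq_of_simple_mul_lt hv hlv,
      qinv_mul_signedT_mul_evalSq] at h1
    exact (signedT_mul_evalSq_injective _ _ h1).symm

/-- Uniqueness of the parabolic `R`-polynomials: their recursion is that of the coefficients of the
bar conjugates of the `b_w`. -/
theorem IsDeodharR.representsBar {R : minReps cs J → minReps cs J → ℤ[X]}
    (hR : IsDeodharR cs J X R) : RepresentsBar R := by
  intro y w
  induction w using minReps_induction generalizing y with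
  | one w hw =>
    classical
    rw [barCoeff_one y w hw]
    by_cases h : w = y
    · subst h
      rw [if_pos rfl, signedT_self, hR.self, map_one, mul_one]
    · rw [if_neg h, hR.eq_zero, map_zero, mul_zero]
      intro h'
      have h1 := h'.length_le
      rw [hw, cs.length_one, Nat.le_zero, cs.length_eq_zero_iff] at h1
      exact h (Subtype.ext (hw.trans h1.symm))
  | step w w' i hw hl ih =>
    by_cases hyw : BruhatLE cs (y : W) w
    swap
    · rw [barCoeff_eq_zero y w hyw, hR.eq_zero y w hyw, map_zero, mul_zero]
    by_cases hne : y = w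
    · subst hne
      rw [barCoeff_self, signedT_self, hR.self, map_one, mul_one]
    have hlt : BruhatLT cs (y : W) w := hyw.lt_of_ne fun e => hne (Subtype.ext e)
    rw [length_eq_of_simple_mul_lt hw hl]
    obtain ⟨y', hy, hly⟩ | ⟨y', hy, hly⟩ | hy := minReps_trichotomy y i
    · rw [barCoeff_of_gt hw hl hy hly, ih, length_eq_of_simple_mul_lt hy hly, signedT_succ_succ,
        hR.strong_descent y w y' w' i hlt hw hl hy hly]
    · rw [barCoeff_of_lt hw hl hy hly, ih, ih,
        length_eq_of_simple_mul_lt (eq_simple_mul_comm hy) hly, signedT_mul_evalSq_of_lt,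
        hR.strong_ascent y w y' w' i hlt hw hl hy hly]
    · have hly : cs.length (y : W) < cs.length (cs.simple i * (y : W)) :=
        lt_length_simple_mul_of_not_lt cs fun h' => hy (simple_mul_mem_minReps y.2 h')
      rw [barCoeff_of_notMem hw hl hy, ih, qinv_mul_signedT_mul_evalSq,
        hR.weak y w w' i hlt hw hl hly hy]

end RPolynomials

/-! ### Laurent polynomials in `q ℤ[q]` -/

section PositivePart

/-- The Laurent polynomial `f` lies in `q ℤ[q]`. -/
def IsPos (f : LRing) : Prop := ∀ n ≤ 0, f.coeff n = 0

theorem IsPos.zero : IsPos 0 := fun _ _ => rfl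

theorem IsPos.add {f g : LRing} (hf : IsPos f) (hg : IsPos g) : IsPos (f + g) := fun n hn => by
  rw [AddMonoidAlgebra.coeff_add, Finsupp.add_apply, hf n hn, hg n hn, add_zero]

theorem IsPos.neg {f : LRing} (hf : IsPos f) : IsPos (-f) := fun n hn => by
  rw [AddMonoidAlgebra.coeff_neg, Finsupp.neg_apply, hf n hn, neg_zero]

theorem IsPos.sub {f g : LRing} (hf : IsPos f) (hg : IsPos g) : IsPos (f - g) := by
  rw [sub_eq_add_neg]
  exact hf.add hg.neg

theorem IsPos.sum {ι : Type*} {s : Finset ι} {f : ι → LRing} (h : ∀ i ∈ s, IsPos (f i)) :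
    IsPos (∑ i ∈ s, f i) := by
  classical
  induction s using Finset.induction_on with
  | empty => exact .zero
  | insert a s ha ih =>
    rw [Finset.sum_insert ha]
    exact (h a (Finset.mem_insert_self a s)).add
      (ih fun i hi => h i (Finset.mem_insert_of_mem hi))

theorem coeff_zsmul (m : ℤ) (f : LRing) (n : ℤ) : (m • f).coeff n = m * f.coeff n := by
  rw [AddMonoidAlgebra.coeff_smul, Finsupp.smul_apply, smul_eq_mul]

theorem IsPos.zsmul {f : LRing} (hf : IsPos f) (m : ℤ) : IsPos (m • f) := fun n hn => by
  rw [coeff_zsmul, hf n hn, mul_zero]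

theorem coeff_T_mul (m n : ℤ) (f : LRing) : (T m * f).coeff n = f.coeff (n - m) := by
  rw [T, AddMonoidAlgebra.coeff_single_mul_eq_mul_coeff (m₂ := n - m), one_mul]
  intro a _
  constructor <;> intro h <;> omega

theorem coeff_one (n : ℤ) : (1 : LRing).coeff n = if n = 0 then 1 else 0 := by
  rw [← T_zero, T, AddMonoidAlgebra.coeff_single, Finsupp.single_apply]
  simp only [eq_comm]

theorem IsPos.qq_mul {f : LRing} (hf : IsPos f) : IsPos (qq * f) := fun n hn => by
  rw [qq, coeff_T_mul, hf _ (by omega)]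

theorem isPos_qq : IsPos qq := fun n hn => by
  rw [← mul_one qq, qq, coeff_T_mul, coeff_one, if_neg (by omega)]

/-- A bar-invariant element of `q ℤ[q]` vanishes. -/
theorem IsPos.eq_zero_of_barA {f : LRing} (hf : IsPos f) (h : barA f = f) : f = 0 := by
  refine LaurentPolynomial.ext fun n => ?_
  obtain hn | hn := le_total n 0
  · rw [hf n hn]
    rfl
  · rw [← h, coeff_barA, hf _ (by omega)]
    rfl

theorem evalInvSq_monomial (j : ℕ) (a : ℤ) :
    evalInvSq (Polynomial.monomial j a) = LaurentPolynomial.C a * T (-2 * j) := by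
  rw [evalInvSq, Polynomial.aeval_monomial, T_pow, LaurentPolynomial.C_eq_algebraMap,
    mul_comm (j : ℤ)]

theorem coeff_T_mul_evalInvSq_monomial (d n : ℤ) (j : ℕ) (a : ℤ) :
    (T d * evalInvSq (Polynomial.monomial j a)).coeff n = if d - 2 * j = n then a else 0 := by
  rw [evalInvSq_monomial, mul_left_comm, ← T_add, ← LaurentPolynomial.single_eq_C_mul_T,
    AddMonoidAlgebra.coeff_single, Finsupp.single_apply]
  congr! 2

theorem coeff_T_mul_evalInvSq (d : ℤ) (f : ℤ[X]) (j : ℕ) :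
    (T d * evalInvSq f).coeff (d - 2 * j) = f.coeff j := by
  induction f using Polynomial.induction_on' with
  | add f g hf hg => rw [map_add, mul_add, AddMonoidAlgebra.coeff_add, Finsupp.add_apply, hf, hg,
      Polynomial.coeff_add]
  | monomial k a =>
    rw [coeff_T_mul_evalInvSq_monomial, Polynomial.coeff_monomial]
    congr! 1
    omega

theorem coeff_T_mul_evalInvSq_eq_zero (d n : ℤ) (f : ℤ[X]) (h : ∀ j : ℕ, d - 2 * j ≠ n) :
    (T d * evalInvSq f).coeff n = 0 := by
  induction f using Polynomial.induction_on' with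
  | add f g hf hg => rw [map_add, mul_add, AddMonoidAlgebra.coeff_add, Finsupp.add_apply, hf, hg,
      add_zero]
  | monomial k a => rw [coeff_T_mul_evalInvSq_monomial, if_neg (h k)]

theorem signedT_mul_evalInvSq (m n : ℕ) (f : ℤ[X]) : signedT m n * evalInvSq f =
    T ((m : ℤ) - n) * evalInvSq ((-1) ^ (m + n) * f) := by
  rw [signedT, map_mul, map_pow, map_neg, map_one]
  ring

theorem signedT_mul_evalInvSq_injective (m n : ℕ) {f g : ℤ[X]}
    (h : signedT m n * evalInvSq f = signedT m n * evalInvSq g) : f = g :=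
  evalInvSq_injective ((isUnit_signedT m n).mul_left_cancel h)

theorem coeff_neg_one_pow_mul (k j : ℕ) (f : ℤ[X]) :
    ((-1) ^ k * f).coeff j = (-1) ^ k * f.coeff j := by
  obtain h | h := neg_one_pow_eq_or ℤ[X] k <;> obtain h' | h' := k.even_or_odd <;>
    simp [h'.neg_one_pow]

/-- Membership in `q ℤ[q]` expresses the bound on the degrees of the Kazhdan-Lusztig polynomials:
the lowest term of `(-q) ^ (m - n) f(q⁻²)` is a multiple of `q ^ (m - n - 2 deg f)`. -/
theorem IsPos.natDegree_lt {m n : ℕ} {f : ℤ[X]} (h : IsPos (signedT m n * evalInvSq f))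
    (hnm : n < m) : 2 * f.natDegree + n + 1 ≤ m := by
  by_contra! hlt
  have hf : f ≠ 0 := by
    rintro rfl
    rw [Polynomial.natDegree_zero] at hlt
    omega
  have h1 := h (m - n - 2 * f.natDegree) (by omega)
  rw [signedT_mul_evalInvSq, coeff_T_mul_evalInvSq, coeff_neg_one_pow_mul] at h1
  simp [hf] at h1

theorem isPos_signedT_mul_evalInvSq {m n : ℕ} {f : ℤ[X]} (h : 2 * f.natDegree + n + 1 ≤ m) :
    IsPos (signedT m n * evalInvSq f) := by
  intro k hk
  rw [signedT_mul_evalInvSq]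
  by_cases hj : ∃ j : ℕ, (m : ℤ) - n - 2 * j = k
  · obtain ⟨j, rfl⟩ := hj
    rw [coeff_T_mul_evalInvSq, coeff_neg_one_pow_mul, Polynomial.coeff_eq_zero_of_natDegree_lt,
      mul_zero]
    omega
  · exact coeff_T_mul_evalInvSq_eq_zero _ _ _ fun j hj' => hj ⟨j, hj'⟩

end PositivePart

/-! ### Existence and uniqueness of canonical elements -/

section Canonical

variable {B W : Type*} [Group W] {M : CoxeterMatrix B} {cs : CoxeterSystem M W} {J : Set B}

/-- A bar-invariant element of the induced module all of whose coefficients lie in `q ℤ[q]`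
vanishes: compare the coefficients at an element of maximal length in the support. -/
theorem eq_zero_of_inducedBar_eq {x : Induced M J} (hbar : inducedBar M J x = x)
    (hpos : ∀ y : minReps cs J, IsPos (stdCoeff y x)) : x = 0 := by
  by_contra hx
  have hne : ((stdBasis cs J).repr x).support.Nonempty := by
    rw [Finsupp.support_nonempty_iff]
    simpa using hx
  obtain ⟨y, hy, hmax⟩ := Finset.exists_max_image ((stdBasis cs J).repr x).support
    (fun y => cs.length (y : W)) hne
  refine Finsupp.mem_support_iff.1 hy ((hpos y).eq_zero_of_barA ?_)
  have h := stdCoeff_inducedBar y x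
  rw [hbar, Finsupp.sum, Finset.sum_eq_single y, barCoeff_self, mul_one] at h
  · exact h.symm
  · intro z hz hzy
    rw [barCoeff_eq_zero, mul_zero]
    intro hle
    obtain e | hlt := hle.eq_or_length_lt
    · exact hzy (Subtype.ext e.symm)
    · exact absurd (hmax z hz) (not_le.2 hlt)
  · exact fun h => absurd hy h

/-- The characterisation of the canonical basis element with leading term `b_w`. The polynomials in
`exists_poly` are, by uniqueness, Deodhar's `P^J_{y,w}`. -/
structure IsCanonical (w : minReps cs J) (x : Induced M J) : Prop where
  bar : inducedBar M J x = x
  self : stdCoeff w x = 1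
  eq_zero : ∀ y : minReps cs J, ¬ BruhatLE cs (y : W) w → stdCoeff y x = 0
  isPos : ∀ y : minReps cs J, y ≠ w → IsPos (stdCoeff y x)
  exists_poly : ∀ y : minReps cs J, ∃ f : ℤ[X],
    stdCoeff y x = signedT (cs.length (w : W)) (cs.length (y : W)) * evalInvSq f

/-- The difference of two canonical elements with the same leading term is bar-invariant, with
coefficients in `q ℤ[q]`. -/
theorem IsCanonical.unique {w : minReps cs J} {x x' : Induced M J} (h : IsCanonical w x)
    (h' : IsCanonical w x') : x = x' := by
  rw [← sub_eq_zero]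
  refine eq_zero_of_inducedBar_eq (cs := cs) (by rw [map_sub, h.bar, h'.bar]) fun y => ?_
  rw [map_sub]
  by_cases hy : y = w
  · rw [hy, h.self, h'.self, sub_self]
    exact .zero
  · exact (h.isPos y hy).sub (h'.isPos y hy)

theorem isCanonical_one {w : minReps cs J} (hw : (w : W) = 1) :
    IsCanonical w (stdElt cs J w) where
  bar := by rw [stdElt, hw, heckeT_one, inducedBar_tmul, map_one, map_one]
  self := by rw [stdCoeff_stdElt, if_pos rfl]
  eq_zero y hy := by
    rw [stdCoeff_stdElt, if_neg]
    rintro rfl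
    exact hy (.refl cs _)
  isPos y hy := by
    rw [stdCoeff_stdElt, if_neg hy.symm]
    exact .zero
  exists_poly y := by
    rw [stdCoeff_stdElt]
    by_cases hy : w = y
    · subst hy
      exact ⟨1, by rw [if_pos rfl, signedT_self, map_one, mul_one]⟩
    · exact ⟨0, by rw [if_neg hy, map_zero, mul_zero]⟩

variable (cs J) in
open Classical in
/-- The weight with which `c_y` occurs in `(T_s - q) c_w`, for `w` with `sw > w` and `y < w`: minus
the coefficient of `q` in the coefficient of `b_y` in `x = c_w` if `s y < y`, and `0` otherwise. -/
def stepWeight (i : B) (x : Induced M J) (y : minReps cs J) : ℤ :=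
  if cs.length (cs.simple i * (y : W)) < cs.length (y : W) then -(stdCoeff y x).coeff 1 else 0

theorem stepWeight_eq_zero {i : B} {x : Induced M J} {y : minReps cs J}
    (h : stdCoeff y x = 0) : stepWeight cs J i x y = 0 := by
  rw [stepWeight, h]
  simp

theorem stdCoeff_ne_zero_of_stepWeight {i : B} {x : Induced M J} {y : minReps cs J}
    (h : stepWeight cs J i x y ≠ 0) : stdCoeff y x ≠ 0 := fun h' => h (stepWeight_eq_zero h')

variable (cs J) in
/-- The correction term `∑ μ(z, w) c_z` in the recursion for the canonical basis. -/
def stepSum (i : B) (x : Induced M J) (c : minReps cs J → Induced M J) : Induced M J :=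
  ∑ z ∈ (finite_support_stdCoeff (cs := cs) x).toFinset, stepWeight cs J i x z • c z

variable (cs J) in
/-- The element `(T_s - q) c_w - ∑ μ(z, w) c_z`, for `x = c_w`. -/
def stepElt (i : B) (x : Induced M J) (c : minReps cs J → Induced M J) : Induced M J :=
  heckeGen M i • x - qq • x - stepSum cs J i x c

/-- The element `T_s - q` of the Hecke algebra is bar-invariant. -/
theorem inducedBar_heckeGen_sub {x : Induced M J} (h : inducedBar M J x = x) (i : B) :
    inducedBar M J (heckeGen M i • x - qq • x) = heckeGen M i • x - qq • x := by
  rw [map_sub, inducedBar_heckeGen_smul, inducedBar_smul, h, barA_qq, sub_smul]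
  abel

section Step

variable {w : minReps cs J} {i : B} {x : Induced M J} {c : minReps cs J → Induced M J}

theorem IsCanonical.inducedBar_stepElt (hx : IsCanonical w x)
    (hc : ∀ z : minReps cs J, cs.length (z : W) ≤ cs.length (w : W) → IsCanonical z (c z)) :
    inducedBar M J (stepElt cs J i x c) = stepElt cs J i x c := by
  rw [stepElt, map_sub, inducedBar_heckeGen_sub hx.bar, stepSum, map_sum]
  congr 1
  refine Finset.sum_congr rfl fun z hz => ?_
  rw [map_zsmul, (hc z _).bar]
  rw [Set.Finite.mem_toFinset] at hz
  by_contra hle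
  exact hz (hx.eq_zero z fun h => hle h.length_le)

theorem IsCanonical.bruhatLE_of_stdCoeff_ne_zero (hx : IsCanonical w x) {z : minReps cs J}
    (hz : stdCoeff z x ≠ 0) : BruhatLE cs (z : W) w := by
  by_contra h
  exact hz (hx.eq_zero z h)

theorem stdCoeff_stepSum (y : minReps cs J) : stdCoeff y (stepSum cs J i x c) =
    ∑ z ∈ (finite_support_stdCoeff (cs := cs) x).toFinset,
      stepWeight cs J i x z • stdCoeff y (c z) := by
  rw [stepSum, map_sum]
  exact Finset.sum_congr rfl fun z _ => map_zsmul _ _ _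

/-- Up to `q ℤ[q]`, the coefficient of `b_y` in the correction term is the weight of `c_y`. -/
theorem IsCanonical.isPos_stepSum (hx : IsCanonical w x)
    (hc : ∀ z : minReps cs J, cs.length (z : W) ≤ cs.length (w : W) → IsCanonical z (c z))
    (y : minReps cs J) :
    IsPos (stdCoeff y (stepSum cs J i x c) - stepWeight cs J i x y • 1) := by
  classical
  set F := (finite_support_stdCoeff (cs := cs) x).toFinset with hF
  have h1 : (stepWeight cs J i x y • 1 : LRing) =
      ∑ z ∈ F, if z = y then stepWeight cs J i x y • 1 else 0 := by
    rw [Finset.sum_ite_eq']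
    by_cases hy : y ∈ F
    · rw [if_pos hy]
    · rw [if_neg hy, stepWeight_eq_zero, zero_smul]
      rw [hF, Set.Finite.mem_toFinset] at hy
      exact not_not.1 hy
  rw [h1, stdCoeff_stepSum, ← Finset.sum_sub_distrib]
  refine IsPos.sum fun z hz => ?_
  rw [Set.Finite.mem_toFinset] at hz
  have hcz := hc z (hx.bruhatLE_of_stdCoeff_ne_zero hz).length_le
  by_cases hzy : z = y
  · subst hzy
    rw [if_pos rfl, hcz.self, sub_self]
    exact .zero
  · rw [if_neg hzy, sub_zero]
    exact (hcz.isPos y (Ne.symm hzy)).zsmul _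

theorem stdCoeff_sub_of_gt {y y' : minReps cs J} (hy : (y' : W) = cs.simple i * y)
    (hly : cs.length (y' : W) < cs.length (y : W)) (x : Induced M J) :
    stdCoeff y (heckeGen M i • x - qq • x) = stdCoeff y' x - qinv * stdCoeff y x := by
  rw [map_sub, stdCoeff_heckeGen_smul_of_gt hy hly, map_smul, smul_eq_mul]
  ring

theorem stdCoeff_sub_of_lt {y y' : minReps cs J} (hy : (y' : W) = cs.simple i * y)
    (hly : cs.length (y : W) < cs.length (y' : W)) (x : Induced M J) :
    stdCoeff y (heckeGen M i • x - qq • x) = stdCoeff y' x - qq * stdCoeff y x := by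
  rw [map_sub, stdCoeff_heckeGen_smul_of_lt hy hly, map_smul, smul_eq_mul]

theorem stdCoeff_sub_of_notMem {y : minReps cs J} (hy : cs.simple i * (y : W) ∉ minReps cs J)
    (x : Induced M J) : stdCoeff y (heckeGen M i • x - qq • x) = 0 := by
  rw [map_sub, stdCoeff_heckeGen_smul_of_notMem hy, map_smul, smul_eq_mul, sub_self]

open Classical in
/-- Up to `q ℤ[q]`, the coefficient of `b_y` in `(T_s - q) c_w` is the weight of `c_y`, with `1`
added if `y = s w`. -/
theorem IsCanonical.isPos_sub (hx : IsCanonical w x)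
    (hw : ¬ cs.length (cs.simple i * (w : W)) < cs.length (w : W)) (y : minReps cs J) :
    IsPos (stdCoeff y (heckeGen M i • x - qq • x) - stepWeight cs J i x y • 1 -
      if (y : W) = cs.simple i * w then 1 else 0) := by
  obtain ⟨y', hy, hly⟩ | ⟨y', hy, hly⟩ | hy := minReps_trichotomy y i
  · have hyw : y ≠ w := by
      rintro rfl
      exact hw (hy ▸ hly)
    have h1 : IsPos (stdCoeff y' x - if (y : W) = cs.simple i * w then 1 else 0) := by
      by_cases h : y' = w
      · rw [if_pos (h ▸ eq_simple_mul_comm hy), h, hx.self, sub_self]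
        exact .zero
      · rw [if_neg, sub_zero]
        · exact hx.isPos y' h
        · intro h'
          apply h
          rw [Subtype.ext_iff, hy, h', cs.simple_mul_simple_cancel_left]
    have h2 : IsPos (-(qinv * stdCoeff y x) - stepWeight cs J i x y • 1) := by
      intro n hn
      rw [AddMonoidAlgebra.coeff_sub, Finsupp.sub_apply, AddMonoidAlgebra.coeff_neg,
        Finsupp.neg_apply, qinv, coeff_T_mul, coeff_zsmul, coeff_one, stepWeight,
        if_pos (hy ▸ hly), sub_neg_eq_add]
      by_cases h0 : n = 0
      · subst h0
        simp
      · rw [if_neg h0, hx.isPos y hyw _ (by omega)]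
        simp
    rw [stdCoeff_sub_of_gt hy hly]
    convert h1.add h2 using 1
    ring
  · have hyw : y' ≠ w := by
      rintro rfl
      rw [← eq_simple_mul_comm hy] at hw
      exact hw hly
    have hyw' : (y : W) ≠ cs.simple i * w := by
      intro h
      rw [h, cs.simple_mul_simple_cancel_left] at hy
      exact hyw (Subtype.ext hy)
    rw [stdCoeff_sub_of_lt hy hly, if_neg hyw', sub_zero, stepWeight, if_neg (by rw [← hy]; omega),
      zero_smul, sub_zero]
    refine (hx.isPos y' hyw).sub ?_
    by_cases h : y = w
    · rw [h, hx.self, mul_one]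
      exact isPos_qq
    · exact (hx.isPos y h).qq_mul
  · have hyw : (y : W) ≠ cs.simple i * w := by
      intro h
      rw [h, cs.simple_mul_simple_cancel_left] at hy
      exact hy w.2
    rw [stdCoeff_sub_of_notMem hy, if_neg hyw, stepWeight,
      if_neg fun h => hy (simple_mul_mem_minReps y.2 h), zero_smul, sub_zero, sub_zero]
    exact .zero

open Classical in
theorem IsCanonical.isPos_stepElt (hx : IsCanonical w x)
    (hc : ∀ z : minReps cs J, cs.length (z : W) ≤ cs.length (w : W) → IsCanonical z (c z))
    (hw : ¬ cs.length (cs.simple i * (w : W)) < cs.length (w : W)) (y : minReps cs J) :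
    IsPos (stdCoeff y (stepElt cs J i x c) - if (y : W) = cs.simple i * w then 1 else 0) := by
  rw [stepElt, map_sub]
  convert (hx.isPos_sub hw y).sub (hx.isPos_stepSum (i := i) hc y) using 1
  ring

/-- An even power of `q` can be moved into the polynomial in `q⁻²`. -/
theorem signedT_eq_of_add_two_mul (m n j : ℕ) :
    signedT m n = signedT (m + 2 * j) n * evalInvSq (X ^ j) := by
  rw [map_pow, evalInvSq_X]
  induction j with
  | zero => simp
  | succ j ih =>
    have h : (T (-2) : LRing) = qinv * qinv := by
      rw [qinv, ← T_add]
      rfl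
    rw [ih, show m + 2 * (j + 1) = m + 2 * j + 1 + 1 by ring, signedT_succ_left, signedT_succ_left,
      pow_succ, h]
    linear_combination (-signedT (m + 2 * j) n * (qinv * qinv) ^ j * (1 + qq * qinv)) * qq_mul_qinv

/-- A canonical element has a `q`-linear coefficient at `z` only if `l(w) - l(z)` is odd. -/
theorem IsCanonical.exists_length_eq (hx : IsCanonical w x) {z : minReps cs J}
    (h : stepWeight cs J i x z ≠ 0) :
    ∃ j : ℕ, cs.length (w : W) + 1 = cs.length (z : W) + 2 * j := by
  have h1 : (stdCoeff z x).coeff 1 ≠ 0 := by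
    intro h0
    rw [stepWeight, h0] at h
    simp at h
  obtain ⟨f, hf⟩ := hx.exists_poly z
  rw [hf, signedT_mul_evalInvSq] at h1
  by_contra hj
  refine h1 (coeff_T_mul_evalInvSq_eq_zero _ _ _ fun j hj' => hj ⟨j + 1, ?_⟩)
  omega

theorem exists_signedT_mul_sub {m n : ℕ} {a b : LRing}
    (ha : ∃ f : ℤ[X], a = signedT m n * evalInvSq f)
    (hb : ∃ f : ℤ[X], b = signedT m n * evalInvSq f) :
    ∃ f : ℤ[X], a - b = signedT m n * evalInvSq f := by
  obtain ⟨f, rfl⟩ := ha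
  obtain ⟨g, rfl⟩ := hb
  exact ⟨f - g, by rw [map_sub, mul_sub]⟩

theorem IsCanonical.exists_poly_stepSum (hx : IsCanonical w x)
    (hc : ∀ z : minReps cs J, cs.length (z : W) ≤ cs.length (w : W) → IsCanonical z (c z))
    (y : minReps cs J) : ∃ f : ℤ[X], stdCoeff y (stepSum cs J i x c) =
      signedT (cs.length (w : W) + 1) (cs.length (y : W)) * evalInvSq f := by
  have h : ∀ z : minReps cs J, ∃ f : ℤ[X], stepWeight cs J i x z • stdCoeff y (c z) =
      signedT (cs.length (w : W) + 1) (cs.length (y : W)) * evalInvSq f := by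
    intro z
    by_cases hz : stepWeight cs J i x z = 0
    · exact ⟨0, by rw [hz, zero_smul, map_zero, mul_zero]⟩
    have hcz := hc z (hx.bruhatLE_of_stdCoeff_ne_zero
      (stdCoeff_ne_zero_of_stepWeight hz)).length_le
    obtain ⟨f, hf⟩ := hcz.exists_poly y
    obtain ⟨j, hj⟩ := hx.exists_length_eq hz
    refine ⟨stepWeight cs J i x z • (X ^ j * f), ?_⟩
    rw [hf, hj, signedT_eq_of_add_two_mul _ _ j, map_zsmul, map_mul, mul_smul_comm, mul_assoc]
  choose f hf using h
  refine ⟨∑ z ∈ (finite_support_stdCoeff (cs := cs) x).toFinset, f z, ?_⟩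
  rw [stdCoeff_stepSum, map_sum, Finset.mul_sum]
  exact Finset.sum_congr rfl fun z _ => hf z

theorem IsCanonical.exists_poly_sub (hx : IsCanonical w x) (y : minReps cs J) :
    ∃ f : ℤ[X], stdCoeff y (heckeGen M i • x - qq • x) =
      signedT (cs.length (w : W) + 1) (cs.length (y : W)) * evalInvSq f := by
  have hT : (T (-2) : LRing) = qinv * qinv := by
    rw [qinv, ← T_add]
    rfl
  obtain ⟨f, hf⟩ := hx.exists_poly y
  obtain ⟨y', hy, hly⟩ | ⟨y', hy, hly⟩ | hy := minReps_trichotomy y i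
  · obtain ⟨g, hg⟩ := hx.exists_poly y'
    refine ⟨g + X * f, ?_⟩
    rw [stdCoeff_sub_of_gt hy hly, hf, hg, length_eq_of_simple_mul_lt hy hly, signedT_succ_succ,
      signedT_succ_right, map_add, map_mul, evalInvSq_X, hT]
    ring
  · obtain ⟨g, hg⟩ := hx.exists_poly y'
    refine ⟨X * g + f, ?_⟩
    rw [stdCoeff_sub_of_lt hy hly, hf, hg,
      length_eq_of_simple_mul_lt (eq_simple_mul_comm hy) hly, signedT_succ_right,
      signedT_succ_left, map_add, map_mul, evalInvSq_X, hT]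
    linear_combination (signedT (cs.length (w : W)) (cs.length (y : W)) * evalInvSq g * qinv) *
      qq_mul_qinv
  · exact ⟨0, by rw [stdCoeff_sub_of_notMem hy, map_zero, mul_zero]⟩

theorem IsCanonical.stdCoeff_stepSum_eq_zero (hx : IsCanonical w x)
    (hc : ∀ z : minReps cs J, cs.length (z : W) ≤ cs.length (w : W) → IsCanonical z (c z))
    {y : minReps cs J} (hy : ¬ BruhatLE cs (y : W) w) : stdCoeff y (stepSum cs J i x c) = 0 := by
  rw [stdCoeff_stepSum]
  refine Finset.sum_eq_zero fun z hz => ?_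
  rw [Set.Finite.mem_toFinset] at hz
  have hzw := hx.bruhatLE_of_stdCoeff_ne_zero hz
  rw [(hc z hzw.length_le).eq_zero y fun h => hy (h.trans hzw), smul_zero]

/-- The recursion for the canonical basis: if `w' = s w > w`, then `(T_s - q) c_w - ∑ μ(z, w) c_z`
is the canonical element attached to `w'`. -/
theorem IsCanonical.stepElt (hx : IsCanonical w x)
    (hc : ∀ z : minReps cs J, cs.length (z : W) ≤ cs.length (w : W) → IsCanonical z (c z))
    {w' : minReps cs J} (hw : (w : W) = cs.simple i * w')
    (hl : cs.length (w : W) < cs.length (w' : W)) : IsCanonical w' (stepElt cs J i x c) where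
  bar := hx.inducedBar_stepElt hc
  self := by
    have h : ¬ BruhatLE cs (w' : W) w := fun h => not_le.2 hl h.length_le
    rw [ParabolicKL.stepElt, map_sub, hx.stdCoeff_stepSum_eq_zero hc h, stdCoeff_sub_of_gt hw hl,
      hx.self, hx.eq_zero w' h, mul_zero, sub_zero, sub_zero]
  eq_zero y hy := by
    have h : ¬ BruhatLE cs (y : W) w := fun h => hy (h.of_lt_simple_mul hw hl)
    rw [ParabolicKL.stepElt, map_sub, hx.stdCoeff_stepSum_eq_zero hc h, sub_zero]
    obtain ⟨y', hy', hly⟩ | ⟨y', hy', hly⟩ | hy' := minReps_trichotomy y i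
    · rw [stdCoeff_sub_of_gt hy' hly, hx.eq_zero y h,
        hx.eq_zero y' fun h' => hy (h'.of_simple_mul hw hl hy'), mul_zero, sub_zero]
    · rw [stdCoeff_sub_of_lt hy' hly, hx.eq_zero y h,
        hx.eq_zero y' fun h' => hy (h'.of_simple_mul hw hl hy'), mul_zero, sub_zero]
    · exact stdCoeff_sub_of_notMem hy' x
  isPos y hy := by
    classical
    have h := hx.isPos_stepElt hc (i := i) (by
      rw [← eq_simple_mul_comm hw]
      exact not_lt.2 hl.le) y
    rwa [if_neg, sub_zero] at h
    intro e
    exact hy (Subtype.ext (e.trans (eq_simple_mul_comm hw).symm))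
  exists_poly y := by
    rw [ParabolicKL.stepElt, map_sub, length_eq_of_simple_mul_lt hw hl]
    exact exists_signedT_mul_sub (hx.exists_poly_sub y) (hx.exists_poly_stepSum hc y)

end Step

/-- Canonical elements exist, by induction along left descents. -/
theorem exists_isCanonical (w : minReps cs J) : ∃ x : Induced M J, IsCanonical w x := by
  induction hn : cs.length (w : W) using Nat.strong_induction_on generalizing w with
  | _ n ih =>
  by_cases hw : (w : W) = 1
  · exact ⟨_, isCanonical_one hw⟩
  obtain ⟨i, hi⟩ := cs.exists_leftDescent_of_ne_one hw
  have hc : ∀ z : minReps cs J, ∃ x : Induced M J,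
      cs.length (z : W) < n → IsCanonical z x := by
    intro z
    by_cases hz : cs.length (z : W) < n
    · obtain ⟨x, hx⟩ := ih _ hz z rfl
      exact ⟨x, fun _ => hx⟩
    · exact ⟨0, fun h => absurd h hz⟩
  choose c hc using hc
  let w' : minReps cs J := ⟨_, simple_mul_mem_minReps w.2 hi⟩
  have hw' : cs.length (w' : W) < n := hn ▸ hi
  exact ⟨_, (hc w' hw').stepElt (i := i) (fun z hz => hc z (hz.trans_lt hw')) rfl hi⟩

end Canonical

/-! ### The canonical basis -/

section CanonicalBasis

variable {B W : Type*} [Group W] {M : CoxeterMatrix B} (cs : CoxeterSystem M W) (J : Set B)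

/-- The canonical basis element `c_w` of the induced module. -/
def canonElt (w : minReps cs J) : Induced M J := (exists_isCanonical w).choose

variable {cs J}

theorem isCanonical_canonElt (w : minReps cs J) : IsCanonical w (canonElt cs J w) :=
  (exists_isCanonical w).choose_spec

variable (cs J)

/-- The transition matrix to the `b_w` is unitriangular with respect to the length. -/
theorem linearIndependent_canonElt : LinearIndependent LRing (canonElt cs J) := by
  rw [linearIndependent_iff]
  intro a ha
  by_contra hne
  obtain ⟨w, hw, hmax⟩ := Finset.exists_max_image a.support
    (fun y => cs.length (y : W)) (Finsupp.support_nonempty_iff.2 hne)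
  have h := congrArg (stdCoeff w) ha
  rw [Finsupp.linearCombination_apply, Finsupp.sum, map_sum, map_zero, Finset.sum_eq_single w,
    map_smul, (isCanonical_canonElt w).self, smul_eq_mul, mul_one] at h
  · exact Finsupp.mem_support_iff.1 hw h
  · intro z hz hzw
    rw [map_smul, (isCanonical_canonElt z).eq_zero, smul_zero]
    intro hle
    obtain e | hlt := hle.eq_or_length_lt
    · exact hzw (Subtype.ext e.symm)
    · exact absurd (hmax z hz) (not_le.2 hlt)
  · exact fun h => absurd hw h

theorem span_canonElt : Submodule.span LRing (Set.range (canonElt cs J)) = ⊤ := by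
  classical
  set N := Submodule.span LRing (Set.range (canonElt cs J))
  rw [eq_top_iff, ← span_stdElt cs J, Submodule.span_le]
  rintro _ ⟨w, rfl⟩
  induction hn : cs.length (w : W) using Nat.strong_induction_on generalizing w with
  | _ n ih =>
  have hc := isCanonical_canonElt w
  have h1 : canonElt cs J w = stdElt cs J w +
      ∑ z ∈ ((stdBasis cs J).repr (canonElt cs J w)).support.erase w,
        stdCoeff z (canonElt cs J w) • stdElt cs J z := by
    conv_lhs => rw [← (stdBasis cs J).linearCombination_repr (canonElt cs J w),
      Finsupp.linearCombination_apply]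
    have hw : w ∈ ((stdBasis cs J).repr (canonElt cs J w)).support := by
      rw [Finsupp.mem_support_iff]
      change stdCoeff w _ ≠ 0
      rw [hc.self]
      exact one_ne_zero
    rw [Finsupp.sum, ← Finset.add_sum_erase _ _ hw]
    congr 1
    · change stdCoeff w _ • _ = _
      rw [hc.self, one_smul, stdBasis_apply]
    · refine Finset.sum_congr rfl fun z _ => ?_
      rw [stdBasis_apply]
      rfl
  rw [← sub_eq_iff_eq_add] at h1
  rw [← h1]
  refine sub_mem (Submodule.subset_span ⟨w, rfl⟩) (sum_mem fun z hz => N.smul_mem _ ?_)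
  rw [Finset.mem_erase, Finsupp.mem_support_iff] at hz
  have hle := hc.bruhatLE_of_stdCoeff_ne_zero hz.2
  exact ih _ (hn ▸ hle.eq_or_length_lt.resolve_left fun e => hz.1 (Subtype.ext e)) z rfl

/-- The canonical basis of the induced module. -/
def canonBasis : Module.Basis (minReps cs J) LRing (Induced M J) :=
  .mk (linearIndependent_canonElt cs J) (span_canonElt cs J).ge

theorem canonBasis_apply (w : minReps cs J) : canonBasis cs J w = canonElt cs J w := by
  simp [canonBasis]

end CanonicalBasis

/-! ### The canonical basis is a `W`-graph basis -/

section WGraph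

variable {B W : Type*} [Group W] {M : CoxeterMatrix B} {cs : CoxeterSystem M W} {J : Set B}

/-- The image of `T_s - q` consists of eigenvectors, by the quadratic relation
`(T_s - q)(T_s + q⁻¹) = 0`. -/
theorem heckeGen_smul_sub_qq_smul (i : B) (x : Induced M J) :
    heckeGen M i • (heckeGen M i • x - qq • x) = -qinv • (heckeGen M i • x - qq • x) := by
  have h : heckeGen M i • heckeGen M i • x = x + (qq - qinv) • heckeGen M i • x := by
    rw [← mul_smul, heckeGen_mul_self, add_smul, one_smul, smul_assoc]
  have h' : qinv • qq • x = x := by rw [smul_smul, mul_comm, qq_mul_qinv, one_smul]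
  rw [smul_sub, h, smul_comm (heckeGen M i) qq x, neg_smul, smul_sub, h', sub_smul]
  abel

theorem canonElt_eq_stepElt {w w' : minReps cs J} {i : B} (hw : (w' : W) = cs.simple i * w)
    (hl : cs.length (w' : W) < cs.length (w : W)) :
    canonElt cs J w = stepElt cs J i (canonElt cs J w') (canonElt cs J) :=
  (isCanonical_canonElt w).unique
    ((isCanonical_canonElt w').stepElt (fun z _ => isCanonical_canonElt z) hw hl)

/-- The descents of `w` act on `c_w` by `-q⁻¹`. -/
theorem heckeGen_smul_canonElt_of_gt {w : minReps cs J} {i : B}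
    (h : cs.length (cs.simple i * (w : W)) < cs.length (w : W)) :
    heckeGen M i • canonElt cs J w = -qinv • canonElt cs J w := by
  induction hn : cs.length (w : W) using Nat.strong_induction_on generalizing w with
  | _ n ih =>
  let w' : minReps cs J := ⟨_, simple_mul_mem_minReps w.2 h⟩
  rw [canonElt_eq_stepElt (w' := w') rfl h, stepElt, smul_sub, heckeGen_smul_sub_qq_smul,
    smul_sub (-qinv) (heckeGen M i • _ - qq • _)]
  congr 1
  rw [stepSum, Finset.smul_sum, Finset.smul_sum]
  refine Finset.sum_congr rfl fun z hz => ?_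
  rw [Set.Finite.mem_toFinset] at hz
  by_cases hz0 : stepWeight cs J i (canonElt cs J w') z = 0
  · simp [hz0]
  have hzl : cs.length (cs.simple i * (z : W)) < cs.length (z : W) := by
    by_contra hzl
    exact hz0 (by rw [stepWeight, if_neg hzl])
  have hle := ((isCanonical_canonElt w').bruhatLE_of_stdCoeff_ne_zero hz).length_le
  rw [smul_comm, ih _ (hn ▸ hle.trans_lt h) hzl rfl, smul_comm]

/-- If `s w ∉ D_J`, then `(T_s - q) c_w - ∑ μ(z, w) c_z` is bar-invariant with coefficients in
`q ℤ[q]`, since it has no leading term. -/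
theorem stepElt_eq_zero {w : minReps cs J} {i : B}
    (h : cs.simple i * (w : W) ∉ minReps cs J) :
    stepElt cs J i (canonElt cs J w) (canonElt cs J) = 0 := by
  classical
  have hc := isCanonical_canonElt w
  refine eq_zero_of_inducedBar_eq (cs := cs)
    (hc.inducedBar_stepElt fun z _ => isCanonical_canonElt z) fun y => ?_
  have h1 := hc.isPos_stepElt (fun z _ => isCanonical_canonElt z) (i := i)
    (fun h' => h (simple_mul_mem_minReps w.2 h')) y
  rwa [if_neg, sub_zero] at h1
  intro e
  exact h (e ▸ y.2)

/-- If `s w > w` and `s u < u`, then the coefficient of `b_w` in `c_u` is divisible by `q`, with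
`q`-linear term `-1` or `0` according to whether `u = s w` or not. -/
theorem coeff_one_stdCoeff_canonElt {u w : minReps cs J} {i : B}
    (hu : cs.length (cs.simple i * (u : W)) < cs.length (u : W))
    (hw : ¬ cs.length (cs.simple i * (w : W)) < cs.length (w : W))
    [Decidable ((u : W) = cs.simple i * w)] :
    -(stdCoeff w (canonElt cs J u)).coeff 1 = if (u : W) = cs.simple i * w then 1 else 0 := by
  have hc := isCanonical_canonElt u
  have h := congrArg (stdCoeff w) (heckeGen_smul_canonElt_of_gt (w := u) hu)
  rw [(stdCoeff w).map_smul (-qinv), smul_eq_mul] at h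
  obtain ⟨w', hw', hlw⟩ | ⟨w', hw', hlw⟩ | hw' := minReps_trichotomy w i
  · exact absurd (hw' ▸ hlw) hw
  · rw [stdCoeff_heckeGen_smul_of_lt hw' hlw] at h
    have h1 : stdCoeff w (canonElt cs J u) = -(qq * stdCoeff w' (canonElt cs J u)) := by
      rw [h]
      linear_combination (-stdCoeff w (canonElt cs J u)) * qq_mul_qinv
    rw [h1, AddMonoidAlgebra.coeff_neg, Finsupp.neg_apply, neg_neg, qq, coeff_T_mul, sub_self]
    by_cases e : w' = u
    · subst e
      rw [if_pos hw', hc.self, coeff_one, if_pos rfl]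
    · rw [if_neg fun e' => e (Subtype.ext (hw'.trans e'.symm)), hc.isPos w' e 0 le_rfl]
  -- here multiplication by `q` and by `-q⁻¹` agree on the coefficient, which therefore vanishes
  · rw [stdCoeff_heckeGen_smul_of_notMem hw'] at h
    have h1 : stdCoeff w (canonElt cs J u) = 0 := by
      have h2 : (T 2 + 1) * stdCoeff w (canonElt cs J u) = 0 := by
        rw [T_two_eq]
        linear_combination qq * h - stdCoeff w (canonElt cs J u) * qq_mul_qinv
      refine (mul_eq_zero.1 h2).resolve_left fun h3 => ?_
      have := congrArg (fun f : LRing => f.coeff 0) h3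
      rw [← mul_one (T 2)] at this
      simp only [AddMonoidAlgebra.coeff_add, Finsupp.add_apply, coeff_T_mul, coeff_one] at this
      simp at this
    rw [h1, if_neg fun (e : (u : W) = cs.simple i * w) => hw' (e ▸ u.2)]
    simp

/-- The action of `T_s` on `c_w` for `s w > w`. -/
theorem heckeGen_smul_canonElt_of_lt {w : minReps cs J} {i : B}
    (h : ¬ cs.length (cs.simple i * (w : W)) < cs.length (w : W)) :
    ∃ e : Induced M J, heckeGen M i • canonElt cs J w = qq • canonElt cs J w +
      (stepSum cs J i (canonElt cs J w) (canonElt cs J) + e) ∧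
      ((∃ w' : minReps cs J, (w' : W) = cs.simple i * w ∧ e = canonElt cs J w') ∨
        cs.simple i * (w : W) ∉ minReps cs J ∧ e = 0) := by
  refine ⟨stepElt cs J i (canonElt cs J w) (canonElt cs J), by rw [stepElt]; abel, ?_⟩
  obtain ⟨w', hw, hl⟩ | ⟨w', hw, hl⟩ | hw := minReps_trichotomy w i
  · exact absurd (hw ▸ hl) h
  · exact .inl ⟨w', hw, (canonElt_eq_stepElt (eq_simple_mul_comm hw) hl).symm⟩
  · exact .inr ⟨hw, stepElt_eq_zero hw⟩

/-- The canonical basis is a `W`-graph basis, for any symmetric weights `μ` such that `μ(u, v)`, for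
`u < v`, is minus the coefficient of `q` in the coefficient of `b_u` in `c_v`. -/
theorem isWGraphBasis_canonBasis {μ : minReps cs J → minReps cs J → ℤ}
    (hlt : ∀ u v : minReps cs J, BruhatLT cs (u : W) v →
      μ u v = -(stdCoeff u (canonElt cs J v)).coeff 1)
    (hgt : ∀ u v : minReps cs J, BruhatLT cs (v : W) u →
      μ u v = -(stdCoeff v (canonElt cs J u)).coeff 1)
    (hincomp : ∀ u v : minReps cs J, ¬ BruhatLT cs (u : W) v → ¬ BruhatLT cs (v : W) u →
      μ u v = 0) :
    IsWGraphBasis M (canonBasis cs J) μ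
      (fun w => {i : B | cs.length (cs.simple i * w) < cs.length w}) := by
  classical
  have hμ : ∀ (u v : minReps cs J) (i : B),
      cs.length (cs.simple i * (u : W)) < cs.length (u : W) →
      ¬ cs.length (cs.simple i * (v : W)) < cs.length (v : W) →
      μ u v = stepWeight cs J i (canonElt cs J v) u +
        if (u : W) = cs.simple i * v then 1 else 0 := by
    intro u v i hu hv
    by_cases h1 : BruhatLT cs (u : W) v
    · rw [hlt u v h1, stepWeight, if_pos hu, if_neg, add_zero]
      intro e
      have := h1.length_lt
      rw [← e] at hv
      exact hv this
    have h0 : stepWeight cs J i (canonElt cs J v) u = 0 := by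
      apply stepWeight_eq_zero
      by_contra h2
      have hle := (isCanonical_canonElt v).bruhatLE_of_stdCoeff_ne_zero h2
      refine h1 (hle.lt_of_ne fun e => ?_)
      rw [e] at hu
      exact hv hu
    rw [h0, zero_add]
    by_cases h2 : BruhatLT cs (v : W) u
    · rw [hgt u v h2, coeff_one_stdCoeff_canonElt hu hv]
    · rw [hincomp u v h1 h2, if_neg]
      intro e
      apply h2
      rw [e]
      exact BruhatLT.of_length_lt_simple_mul (lt_length_simple_mul_of_not_lt cs hv)
  have hfin : ∀ (v : minReps cs J) (i : B),
      {u : minReps cs J | (u : W) = cs.simple i * v}.Finite := fun v i =>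
    Set.Subsingleton.finite fun a ha b hb => Subtype.ext (Eq.trans ha (Eq.symm hb))
  refine ⟨fun i v hv => ?_, fun i v hv => ?_, fun i v hv => ?_⟩
  · rw [canonBasis_apply]
    exact heckeGen_smul_canonElt_of_gt hv
  · refine ((finite_support_stdCoeff (cs := cs) (canonElt cs J v)).union (hfin v i)).subset ?_
    rintro u ⟨hu, hne⟩
    rw [hμ u v i hu hv] at hne
    by_cases e : (u : W) = cs.simple i * v
    · exact .inr e
    · rw [if_neg e, add_zero] at hne
      exact .inl (stdCoeff_ne_zero_of_stepWeight hne)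
  · set S : Set (minReps cs J) :=
      {u | i ∈ {i : B | cs.length (cs.simple i * (u : W)) < cs.length (u : W)}}
    have hind : ∀ u : minReps cs J, S.indicator (fun u => μ u v • canonBasis cs J u) u =
        stepWeight cs J i (canonElt cs J v) u • canonElt cs J u +
          if (u : W) = cs.simple i * v then canonElt cs J u else 0 := by
      intro u
      by_cases hu : cs.length (cs.simple i * (u : W)) < cs.length (u : W)
      · rw [Set.indicator_of_mem (show u ∈ S from hu), hμ u v i hu hv, add_smul,
          canonBasis_apply, ite_smul, one_smul, zero_smul]
      · rw [Set.indicator_of_notMem (show u ∉ S from hu), stepWeight, if_neg hu, zero_smul,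
          if_neg, add_zero]
        intro e
        rw [e, cs.simple_mul_simple_cancel_left] at hu
        exact hu (lt_length_simple_mul_of_not_lt cs hv)
    have hsub : Function.support
        (fun u => stepWeight cs J i (canonElt cs J v) u • canonElt cs J u) ⊆
        ((finite_support_stdCoeff (cs := cs) (canonElt cs J v)).toFinset : Set (minReps cs J)) := by
      intro u hu
      rw [Set.Finite.coe_toFinset]
      refine stdCoeff_ne_zero_of_stepWeight (i := i) fun h => hu ?_
      simp only [h, zero_smul]
    have hsub' : Function.support (fun u : minReps cs J =>
        if (u : W) = cs.simple i * v then canonElt cs J u else 0) ⊆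
        {u : minReps cs J | (u : W) = cs.simple i * v} := by
      intro u hu
      by_contra h
      exact hu (if_neg h)
    rw [finsum_mem_def, finsum_congr hind, finsum_add_distrib
      ((Finset.finite_toSet _).subset hsub) ((hfin v i).subset hsub'),
      finsum_eq_sum_of_support_subset _ hsub, canonBasis_apply]
    obtain ⟨e, he, ⟨w', hw', rfl⟩ | ⟨hw', rfl⟩⟩ := heckeGen_smul_canonElt_of_lt hv
    · rw [finsum_eq_single _ w', if_pos hw']
      · exact he
      · intro u hu
        exact if_neg fun e => hu (Subtype.ext (e.trans hw'.symm))
    · rw [finsum_eq_zero_of_forall_eq_zero]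
      · exact he
      · intro u
        exact if_neg fun (e : (u : W) = cs.simple i * v) => hw' (e ▸ u.2)

end WGraph

/-! ### Parabolic Kazhdan-Lusztig polynomials -/

section KLPolynomials

variable {B W : Type*} [Group W] {M : CoxeterMatrix B} {cs : CoxeterSystem M W} {J : Set B}

variable (cs J) in
theorem finite_minReps_bruhatLE (w : W) : {y : minReps cs J | BruhatLE cs (y : W) w}.Finite :=
  (finite_bruhatLE cs w).preimage Subtype.val_injective.injOn

/-- The coefficients of `x` are those of `∑ (-q) ^ (l(w) - l(y)) P_{y,w}(q⁻²) b_y`. -/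
def HasKLCoeffs (P : minReps cs J → minReps cs J → ℤ[X]) (w : minReps cs J) (x : Induced M J) :
    Prop :=
  ∀ y, stdCoeff y x = signedT (cs.length (w : W)) (cs.length (y : W)) * evalInvSq (P y w)

/-- The coefficients of the bar conjugate are the sums in Deodhar's identity. -/
theorem HasKLCoeffs.stdCoeff_inducedBar {P R : minReps cs J → minReps cs J → ℤ[X]}
    {w : minReps cs J} {x : Induced M J} (hx : HasKLCoeffs P w x)
    (hP : ∀ u v : minReps cs J, ¬ BruhatLE cs (u : W) v → P u v = 0)
    (hR : IsDeodharR cs J X R) (u : minReps cs J) :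
    stdCoeff u (inducedBar M J x) = signedT (cs.length (u : W)) (cs.length (w : W)) *
      evalSq (∑ᶠ z ∈ {z : minReps cs J | BruhatLE cs u z ∧ BruhatLE cs z w}, R u z * P z w) := by
  have hR' := hR.representsBar
  have hfin : {z : minReps cs J | BruhatLE cs (u : W) z ∧ BruhatLE cs (z : W) w}.Finite :=
    (finite_minReps_bruhatLE cs J w).subset fun z hz => hz.2
  rw [ParabolicKL.stdCoeff_inducedBar, Finsupp.sum, finsum_mem_eq_finite_toFinset_sum _ hfin,
    map_sum, Finset.mul_sum]
  refine Finset.sum_congr_of_eq_on_inter (fun z _ hz => ?_) (fun z _ hz => ?_) (fun z _ _ => ?_)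
  · rw [Set.Finite.mem_toFinset, Set.mem_ofPred_eq, not_and_or] at hz
    change barA (stdCoeff z x) * _ = 0
    obtain hz | hz := hz
    · rw [barCoeff_eq_zero u z hz, mul_zero]
    · rw [hx z, hP z w hz, map_zero, mul_zero, map_zero, zero_mul]
  · have h0 : stdCoeff z x = 0 := Finsupp.notMem_support_iff.1 hz
    have h1 : P z w = 0 := by
      apply signedT_mul_evalInvSq_injective (cs.length (w : W)) (cs.length (z : W))
      rw [← hx z, h0, map_zero, mul_zero]
    rw [h1, mul_zero, map_zero, mul_zero]
  · change barA (stdCoeff z x) * _ = _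
    rw [hx z, hR' u z, map_mul, barA_signedT, barA_evalInvSq, map_mul,
      ← signedT_mul (cs.length (u : W)) (cs.length (z : W)) (cs.length (w : W))]
    ring

/-- Bar invariance is equivalent to Deodhar's identity for the Kazhdan-Lusztig polynomials. -/
theorem HasKLCoeffs.inducedBar_eq_iff {P R : minReps cs J → minReps cs J → ℤ[X]}
    {w : minReps cs J} {x : Induced M J} (hx : HasKLCoeffs P w x)
    (hP : ∀ u v : minReps cs J, ¬ BruhatLE cs (u : W) v → P u v = 0)
    (hR : IsDeodharR cs J X R) :
    inducedBar M J x = x ↔ ∀ u : minReps cs J, BruhatLE cs (u : W) w →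
      LaurentPolynomial.T ((cs.length (w : W) : ℤ) - cs.length (u : W)) *
          LaurentPolynomial.invert (Polynomial.toLaurent (P u w)) =
        Polynomial.toLaurent
          (∑ᶠ z ∈ {z : minReps cs J | BruhatLE cs u z ∧ BruhatLE cs z w}, R u z * P z w) := by
  have key : ∀ u : minReps cs J, stdCoeff u (inducedBar M J x) = stdCoeff u x ↔
      LaurentPolynomial.T ((cs.length (w : W) : ℤ) - cs.length (u : W)) *
          LaurentPolynomial.invert (Polynomial.toLaurent (P u w)) =
        Polynomial.toLaurent
          (∑ᶠ z ∈ {z : minReps cs J | BruhatLE cs u z ∧ BruhatLE cs z w}, R u z * P z w) := by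
    intro u
    have h1 : evalInvSq (P u w) = barA (evalSq (P u w)) := by rw [← barA_evalInvSq, barA_barA]
    have h2 : signedT (cs.length (w : W)) (cs.length (u : W)) =
        signedT (cs.length (u : W)) (cs.length (w : W)) *
          sqHom (T ((cs.length (w : W) : ℤ) - cs.length (u : W))) := by
      rw [sqHom_T, signedT, signedT, mul_assoc, ← T_add, add_comm]
      congr 2
      ring
    rw [hx.stdCoeff_inducedBar hP hR, hx u, h1, h2, mul_assoc,
      (isUnit_signedT _ _).mul_right_inj, ← sqHom_toLaurent, ← sqHom_toLaurent, ← sqHom_barA,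
      ← map_mul, sqHom_injective.eq_iff]
    exact eq_comm
  constructor
  · intro h u _
    rw [← key, h]
  · intro h
    refine stdCoeff_ext (cs := cs) fun u => ?_
    by_cases hu : BruhatLE cs (u : W) w
    · exact (key u).2 (h u hu)
    · rw [hx.stdCoeff_inducedBar hP hR, hx u, hP u w hu, map_zero, mul_zero,
        finsum_mem_eq_zero_of_forall_eq_zero, map_zero, mul_zero]
      rintro z ⟨h1, h2⟩
      exact absurd (h1.trans h2) hu

/-- The element of the induced module whose coefficients are given by `P`. The sum is finite because
lower Bruhat intervals are. -/
theorem exists_hasKLCoeffs (P : minReps cs J → minReps cs J → ℤ[X])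
    (hP : ∀ u v : minReps cs J, ¬ BruhatLE cs (u : W) v → P u v = 0) (w : minReps cs J) :
    ∃ x : Induced M J, HasKLCoeffs P w x := by
  classical
  refine ⟨∑ y ∈ (finite_minReps_bruhatLE cs J (w : W)).toFinset,
    (signedT (cs.length (w : W)) (cs.length (y : W)) * evalInvSq (P y w)) • stdElt cs J y,
    fun y => ?_⟩
  simp only [map_sum, map_smul, stdCoeff_stdElt, smul_eq_mul, mul_ite, mul_one, mul_zero]
  rw [Finset.sum_ite_eq']
  split_ifs with h
  · rfl
  · rw [hP, map_zero, mul_zero]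
    simpa using h

/-- The polynomials read off from the coefficients of the canonical basis. -/
theorem exists_canonPoly : ∃ P : minReps cs J → minReps cs J → ℤ[X],
    ∀ w, HasKLCoeffs P w (canonElt cs J w) := by
  choose P hP using fun w : minReps cs J => (isCanonical_canonElt w).exists_poly
  exact ⟨fun y w => P w y, fun w y => hP w y⟩

/-- The coefficients of the canonical basis satisfy the defining conditions of Deodhar's
polynomials. -/
theorem isDeodharKL_of_hasKLCoeffs {P : minReps cs J → minReps cs J → ℤ[X]}
    (h : ∀ w, HasKLCoeffs P w (canonElt cs J w)) : IsDeodharKL cs J X P := by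
  have h0 : ∀ u v : minReps cs J, ¬ BruhatLE cs (u : W) v → P u v = 0 := by
    intro u v huv
    apply signedT_mul_evalInvSq_injective (cs.length (v : W)) (cs.length (u : W))
    rw [← h v u, (isCanonical_canonElt v).eq_zero u huv, map_zero, mul_zero]
  refine ⟨h0, fun u => ?_, fun u v huv => ?_, ?_⟩
  · apply signedT_mul_evalInvSq_injective (cs.length (u : W)) (cs.length (u : W))
    rw [← h u u, (isCanonical_canonElt u).self, signedT_self, map_one, mul_one]
  · have h1 := (isCanonical_canonElt v).isPos u fun e => huv.2 (congrArg _ e)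
    rw [h v u] at h1
    exact h1.natDegree_lt huv.length_lt
  · obtain ⟨R, hR⟩ := exists_representsBar (cs := cs) (J := J)
    exact ⟨R, hR.isDeodharR, fun u v huv => ((h v).inducedBar_eq_iff h0 hR.isDeodharR).1
      (isCanonical_canonElt v).bar u huv⟩

/-- Deodhar's polynomials give canonical elements, and are therefore unique. -/
theorem IsDeodharKL.hasKLCoeffs {P : minReps cs J → minReps cs J → ℤ[X]}
    (hP : IsDeodharKL cs J X P) (w : minReps cs J) : HasKLCoeffs P w (canonElt cs J w) := by
  obtain ⟨x, hx⟩ := exists_hasKLCoeffs P hP.eq_zero w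
  obtain ⟨R, hR, hid⟩ := hP.identity
  have hc : IsCanonical w x :=
    { bar := (hx.inducedBar_eq_iff hP.eq_zero hR).2 fun u hu => hid u w hu
      self := by rw [hx w, hP.self, signedT_self, map_one, mul_one]
      eq_zero := fun y hy => by rw [hx y, hP.eq_zero y w hy, map_zero, mul_zero]
      isPos := fun y hy => by
        rw [hx y]
        by_cases hle : BruhatLE cs (y : W) w
        · exact isPos_signedT_mul_evalInvSq
            (hP.degree_le y w (hle.lt_of_ne fun e => hy (Subtype.ext e)))
        · rw [hP.eq_zero y w hle, map_zero, mul_zero]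
          exact .zero
      exists_poly := fun y => ⟨_, hx y⟩ }
  rw [(isCanonical_canonElt w).unique hc]
  exact hx

/-- The Laurent polynomial `(-q) ^ n f(q⁻²)` is a polynomial in `q` of degree at most `n` if
`2 deg f ≤ n`. -/
theorem exists_toLaurent_eq {n : ℕ} {f : ℤ[X]} (h : 2 * f.natDegree ≤ n) :
    ∃ p : ℤ[X], p.natDegree ≤ n ∧ Polynomial.toLaurent p = (-qq) ^ n * evalInvSq f := by
  refine ⟨∑ j ∈ Finset.range (f.natDegree + 1),
    Polynomial.C ((-1) ^ n * f.coeff j) * X ^ (n - 2 * j),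
    ?_, ?_⟩
  · refine Polynomial.natDegree_sum_le_of_forall_le _ _ fun j _ => ?_
    exact (Polynomial.natDegree_C_mul_X_pow_le _ _).trans (Nat.sub_le _ _)
  · conv_rhs => rw [f.as_sum_range' (f.natDegree + 1) (Nat.lt_succ_self _)]
    rw [map_sum, map_sum, Finset.mul_sum]
    refine Finset.sum_congr rfl fun j hj => ?_
    have hj' : 2 * j ≤ n := by
      rw [Finset.mem_range] at hj
      omega
    rw [Polynomial.toLaurent_C_mul_X_pow, evalInvSq_monomial, neg_pow qq n, qq, T_pow, mul_one,
      map_mul, map_pow, map_neg, map_one, Nat.cast_sub hj', mul_mul_mul_comm, ← T_add]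
    congr 2

theorem coeff_toLaurent (f : ℤ[X]) (n : ℕ) : (Polynomial.toLaurent f).coeff n = f.coeff n := by
  induction f using Polynomial.induction_on' with
  | add f g hf hg => rw [map_add, AddMonoidAlgebra.coeff_add, Finsupp.add_apply, hf, hg,
      Polynomial.coeff_add]
  | monomial k a =>
    rw [← Polynomial.C_mul_X_pow_eq_monomial, Polynomial.toLaurent_C_mul_X_pow,
      ← LaurentPolynomial.single_eq_C_mul_T, AddMonoidAlgebra.coeff_single, Finsupp.single_apply,
      Polynomial.coeff_C_mul_X_pow]
    congr! 1
    omega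

theorem signedT_eq_neg_qq_pow {m n : ℕ} (h : n < m) :
    signedT m n = -qq * (-qq) ^ (m - n - 1) := by
  obtain ⟨k, rfl⟩ := Nat.exists_eq_add_of_lt h
  rw [← pow_succ', show n + k + 1 - n - 1 + 1 = k + 1 by omega]
  clear h
  induction k with
  | zero => rw [add_zero, signedT_succ_left, signedT_self]; ring
  | succ k ih => rw [show n + (k + 1) + 1 = n + k + 1 + 1 by ring, signedT_succ_left, ih]; ring

end KLPolynomials

end ParabolicKL

end

theorem mainTheorem8 {B W : Type*} [Group W] {M : CoxeterMatrix B} (cs : CoxeterSystem M W)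
    (J : Set B) :
    -- the sums below are finite
    (∀ w : minReps cs J, {y : minReps cs J | BruhatLT cs y w}.Finite) ∧
    -- Deodhar's polynomials for the parameter `q` exist and are unique
    ∃ P : minReps cs J → minReps cs J → ℤ[X],
      IsDeodharKL cs J X P ∧ (∀ P', IsDeodharKL cs J X P' → P' = P) ∧
    ∃ (c : Module.Basis (minReps cs J) LRing (Induced M J))
      (p : minReps cs J → minReps cs J → ℤ[X]),
      -- a `W`-graph basis, with edge weights the constant terms of the `p y w`
      IsWGraphBasis M c (edgeWeight cs J p)
        (fun w => {i : B | cs.length (cs.simple i * w) < cs.length w}) ∧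
      (∀ w, inducedBar M J (c w) = c w) ∧
      (∀ w, c w = stdElt cs J w -
        ∑ᶠ y ∈ {y : minReps cs J | BruhatLT cs y w},
          (qq * Polynomial.toLaurent (p y w)) • stdElt cs J y) ∧
      (∀ y w : minReps cs J, BruhatLT cs y w →
        (p y w).natDegree ≤ cs.length (w : W) - cs.length (y : W) - 1) ∧
      (∀ y w : minReps cs J, BruhatLT cs y w →
        Polynomial.toLaurent (p y w) =
          (-qq) ^ (cs.length (w : W) - cs.length (y : W) - 1) *
            Polynomial.aeval (LaurentPolynomial.T (-2) : LRing) (P y w)) := by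
  obtain ⟨P, hP⟩ := exists_canonPoly (cs := cs) (J := J)
  have hKL := isDeodharKL_of_hasKLCoeffs hP
  have hfin : ∀ w : minReps cs J, {y : minReps cs J | BruhatLT cs y w}.Finite := fun w =>
    (finite_minReps_bruhatLE cs J w).subset fun y hy => hy.1
  refine ⟨hfin, P, hKL, fun P' hP' => ?_, ?_⟩
  · funext y w
    apply signedT_mul_evalInvSq_injective (cs.length (w : W)) (cs.length (y : W))
    rw [← hP w y, ← hP'.hasKLCoeffs w y]
  have hp : ∀ y w : minReps cs J, ∃ p : ℤ[X], BruhatLT cs y w →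
      p.natDegree ≤ cs.length (w : W) - cs.length (y : W) - 1 ∧
      Polynomial.toLaurent p =
        (-qq) ^ (cs.length (w : W) - cs.length (y : W) - 1) * evalInvSq (P y w) := by
    intro y w
    by_cases h : BruhatLT cs (y : W) w
    · obtain ⟨p, h1, h2⟩ := exists_toLaurent_eq (f := P y w)
        (n := cs.length (w : W) - cs.length (y : W) - 1) (by
          have := hKL.degree_le y w h
          omega)
      exact ⟨p, fun _ => ⟨h1, h2⟩⟩
    · exact ⟨0, fun h' => absurd h' h⟩
  choose p hp using hp
  have hcoeff : ∀ y w : minReps cs J, BruhatLT cs y w →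
      stdCoeff y (canonElt cs J w) = -(qq * Polynomial.toLaurent (p y w)) := by
    intro y w h
    rw [hP w y, (hp y w h).2, signedT_eq_neg_qq_pow h.length_lt]
    ring
  have hcoeff_one : ∀ y w : minReps cs J, BruhatLT cs y w →
      (p y w).coeff 0 = -(stdCoeff y (canonElt cs J w)).coeff 1 := by
    intro y w h
    rw [hcoeff y w h, AddMonoidAlgebra.coeff_neg, Finsupp.neg_apply, neg_neg, qq, coeff_T_mul,
      sub_self]
    exact (coeff_toLaurent (p y w) 0).symm
  refine ⟨canonBasis cs J, p, isWGraphBasis_canonBasis (fun u v h => ?_) (fun u v h => ?_)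
    (fun u v h h' => ?_), fun w => ?_, fun w => ?_, fun y w h => (hp y w h).1,
    fun y w h => (hp y w h).2⟩
  · rw [edgeWeight, if_pos h, hcoeff_one u v h]
  · rw [edgeWeight, if_neg fun h' => h.not_le h'.1, if_pos h, hcoeff_one v u h]
  · rw [edgeWeight, if_neg h, if_neg h']
  · rw [canonBasis_apply]
    exact (isCanonical_canonElt w).bar
  · classical
    rw [canonBasis_apply, finsum_mem_eq_finite_toFinset_sum _ (hfin w)]
    refine stdCoeff_ext (cs := cs) fun y => ?_
    simp only [map_sub, map_sum, map_smul, stdCoeff_stdElt, smul_eq_mul, mul_ite, mul_one, mul_zero]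
    simp only [Finset.sum_ite_eq', Set.Finite.mem_toFinset, Set.mem_ofPred_eq]
    by_cases hyw : w = y
    · subst hyw
      rw [(isCanonical_canonElt w).self, if_pos rfl, if_neg, sub_zero]
      exact fun h => h.2 rfl
    · rw [if_neg hyw, zero_sub]
      by_cases h : BruhatLT cs (y : W) w
      · rw [if_pos h, hcoeff y w h]
      · rw [if_neg h, neg_zero, (isCanonical_canonElt w).eq_zero]
        exact fun h' => h (h'.lt_of_ne fun e => hyw (Subtype.ext e.symm))
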